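/- Let $1\le m$ and $n$ be integers. A closed manifold is a compact Hausdorff manifold without boundary; $B_r(x)$ is the open ball in $\mathbb{R}^n$, and volume on subsets of $\mathbb{R}^n$ is the ($m$-dimensional, Lebesgue-normalized) Hausdorff measure. **The class $\mathcal{M}(k,\varepsilon_0,b,V)$.** For $\varepsilon_0,b,V>0$ and an integer $k\ge 3$, let $\mathcal{M}(k,\varepsilon_0,b,V)$ be the set of all $M'\subset\mathbb{R}^n$ of volume at most $V$ for which there are a closed $m$-dimensional $C^k$ manifold $N$ and a $C^k$ immersion $g\colon N\to\mathbb{R}^n$ with $g(N)=M'$ such that for every $x\in M'$: (1) $g^{-1}(B_{\varepsilon_0}(x))$ is a disjoint union of finitely many sets $W_1,\dots,W_\ell$; (2) each $W_i$ is open in $N$ and $C^k$-diffeomorphic to an open $m$-ball; (3) $g|_{W_i}$ is a $C^k$-diffeomorphism onto $W_i'=g(W_i)$; (4) whenever $x\in W_i'$, the set $W_i'$ is the graph (with origin $x$) of a $C^k$ function $h_i\colon U_i\to (T_xW_i')^\perp$ on an open set $U_i\subset T_xW_i'$, with $|\partial^\mu h_i|\le b$ on $U_i$ for every choice of orthonormal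 axes of $T_xW_i'$ and every multi-index $\mu$ with $0\le|\mu|\le k$. **The energy.** For $F\colon(0,\infty)\to\mathbb{R}$, Hadamard's finite part of $F$ at $0^+$ is the number $c$, if it exists, such that $F(\varepsilon)=\sum_{p\in S}a_p\,\varepsilon^{-p}+d\log\varepsilon+c+o(1)$ as $\varepsilon\to0^+$ with a finite set $S\subset(0,\infty)$ and real $a_p,d$. For a closed $m$-dimensional submanifold $M\subset\mathbb{R}^n$, $\mathrm{Pf.}\int_M|x-y|^\alpha\,dy$ is the finite part of $\varepsilon\mapsto\int_{M\setminus B_\varepsilon(x)}|x-y|^\alpha\,dy$, and $$E_\alpha(M)=\int_M\Big(\mathrm{Pf.}\int_M|x-y|^\alpha\,dy\Big)dx .$$ **Theorem.** Let $\varepsilon_0,b,V>0$, let $\alpha\le-2m$ be real, and put $\overline\alpha=\max\{\lfloor-\alpha\rfloor-m,0\}$. For every $C>0$ there is $\delta>0$ such that the following holds. Let $M\in\mathcal{M}(\overline\alpha+3,\varepsilon_0,b,V)$ be a closed $m$-dimensional submanifold embedded in $\mathbb{R}^n$ of class $C^{\overline\alpha+3}$, and suppose: 1. There are a $C^{\overline\alpha+3}$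 immersion $f\colon M\to\mathbb{R}^n$ whose image $M'=f(M)$ belongs to $\mathcal{M}(\overline\alpha+3,\varepsilon_0,b,V)$ and which satisfies $|f(x)-x|<\delta$ for all $x\in M$, and a double point $x'$ of it, i.e. $x'=f(x_1)=f(x_2)$ for some $x_1\ne x_2$ in $M$. 2. $f^{-1}(B_{\varepsilon_0}(x'))$ is a disjoint union of open sets $W_1,\dots,W_l$ ($2\le l<\infty$), each $C^{\overline\alpha+3}$-diffeomorphic to an open $m$-ball, such that each $f|_{W_i}$ is a $C^{\overline\alpha+3}$ embedding. Then $E_\alpha(M)$ is well defined (the integrals and finite parts exist) and $E_\alpha(M)>C$. -/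

import Mathlib

open MeasureTheory Filter Topology Metric
open scoped Manifold ContDiff

namespace RieszRepulsion

noncomputable section

/-- `ℝᵈ` with its Euclidean norm. -/
abbrev Euc (d : ℕ) : Type := EuclideanSpace ℝ (Fin d)

/-! ### Hadamard's finite part and the regularized Riesz energy -/

/-- `c` is the constant term of the expansion of `F ε` as `ε → 0+` in finitely many negative
(possibly non-integral) powers of `ε`, a multiple of `log ε`, a constant, and a vanishing rest. -/
def HasFinitePart (F : ℝ → ℝ) (c : ℝ) : Prop :=
  ∃ (S : Finset ℝ) (a : ℝ → ℝ) (d : ℝ), (∀ p ∈ S, 0 < p) ∧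
    Tendsto (fun ε : ℝ => F ε - (∑ p ∈ S, a p * ε ^ (-p) + d * Real.log ε)) (𝓝[>] 0) (𝓝 c)

theorem tendsto_two_mul : Tendsto (fun ε : ℝ => 2 * ε) (𝓝[>] 0) (𝓝[>] 0) := by
  refine tendsto_nhdsWithin_iff.2 ⟨?_, ?_⟩
  · have h : Tendsto (fun ε : ℝ => 2 * ε) (𝓝 0) (𝓝 (2 * 0)) := tendsto_id.const_mul 2
    rw [mul_zero] at h
    exact h.mono_left nhdsWithin_le_nhds
  · filter_upwards [self_mem_nhdsWithin] with ε hε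
    have : (0 : ℝ) < ε := hε
    show (0 : ℝ) < 2 * ε
    linarith

theorem finitePart_aux (S : Finset ℝ) : ∀ (a : ℝ → ℝ) (d c : ℝ), (∀ p ∈ S, 0 < p) →
    Tendsto (fun ε : ℝ => ∑ p ∈ S, a p * ε ^ (-p) + d * Real.log ε) (𝓝[>] 0) (𝓝 c) →
    d = 0 ∧ c = 0 := by
  induction S using Finset.induction_on with
  | empty =>
    intro a d c _ h
    have h2 := (h.comp tendsto_two_mul).sub h
    have h3 : Tendsto (fun _ : ℝ => d * Real.log 2) (𝓝[>] (0 : ℝ)) (𝓝 (c - c)) := by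
      refine h2.congr' ?_
      filter_upwards [self_mem_nhdsWithin] with ε hε
      have hε' : (0 : ℝ) < ε := hε
      simp only [Function.comp, Finset.sum_empty]
      rw [Real.log_mul two_ne_zero hε'.ne']
      ring
    have h4 := tendsto_nhds_unique h3 tendsto_const_nhds
    have hd : d = 0 := by
      have := Real.log_pos one_lt_two
      rcases mul_eq_zero.1 (h4.symm.trans (sub_self c)) with h | h
      · exact h
      · exact absurd h this.ne'
    subst hd
    refine ⟨rfl, ?_⟩
    have h5 : Tendsto (fun _ : ℝ => (0 : ℝ)) (𝓝[>] (0 : ℝ)) (𝓝 c) := by simpa using h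
    exact tendsto_nhds_unique h5 tendsto_const_nhds
  | insert q S hq ih =>
    intro a d c hp h
    have hq0 : 0 < q := hp q (Finset.mem_insert_self _ _)
    have h2 := ((h.comp tendsto_two_mul).sub (h.const_mul ((2 : ℝ) ^ (-q)))).sub_const
      (d * Real.log 2)
    have h3 : Tendsto (fun ε : ℝ => ∑ p ∈ S, (a p * ((2 : ℝ) ^ (-p) - 2 ^ (-q))) * ε ^ (-p)
        + (d * (1 - 2 ^ (-q))) * Real.log ε) (𝓝[>] 0)
        (𝓝 (c - (2 : ℝ) ^ (-q) * c - d * Real.log 2)) := by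
      refine h2.congr' ?_
      filter_upwards [self_mem_nhdsWithin] with ε hε
      have hε' : (0 : ℝ) < ε := hε
      simp only [Function.comp, Finset.sum_insert hq]
      have hs : ∑ p ∈ S, (a p * ((2 : ℝ) ^ (-p) - 2 ^ (-q))) * ε ^ (-p)
          = ∑ p ∈ S, a p * (2 * ε) ^ (-p) - 2 ^ (-q) * ∑ p ∈ S, a p * ε ^ (-p) := by
        rw [Finset.mul_sum, ← Finset.sum_sub_distrib]
        refine Finset.sum_congr rfl fun p _ => ?_
        rw [Real.mul_rpow two_pos.le hε'.le]
        ring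
      rw [hs, Real.log_mul two_ne_zero hε'.ne', Real.mul_rpow two_pos.le hε'.le]
      ring
    have h2q : (2 : ℝ) ^ (-q) < 1 := Real.rpow_lt_one_of_one_lt_of_neg one_lt_two (by linarith)
    obtain ⟨e1, e2⟩ := ih _ _ _ (fun p hpS => hp p (Finset.mem_insert_of_mem hpS)) h3
    have hd : d = 0 := by
      rcases mul_eq_zero.1 e1 with h | h
      · exact h
      · linarith
    subst hd
    refine ⟨rfl, ?_⟩
    have : c * (1 - (2 : ℝ) ^ (-q)) = 0 := by linarith
    rcases mul_eq_zero.1 this with h | h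
    · exact h
    · linarith

/-- The finite part is unique. -/
theorem HasFinitePart.unique {F : ℝ → ℝ} {c c' : ℝ} (h : HasFinitePart F c)
    (h' : HasFinitePart F c') : c = c' := by
  classical
  obtain ⟨S, a, d, hS, hc⟩ := h
  obtain ⟨S', a', d', hS', hc'⟩ := h'
  have key := hc'.sub hc
  have := finitePart_aux (S ∪ S')
    (fun p => (if p ∈ S then a p else 0) - (if p ∈ S' then a' p else 0)) (d - d') (c' - c)
    (fun p hp => (Finset.mem_union.1 hp).elim (hS p) (hS' p)) (by
      refine key.congr' (Eventually.of_forall fun ε => ?_)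
      have e1 : ∑ p ∈ S ∪ S', (if p ∈ S then a p else 0) * ε ^ (-p)
          = ∑ p ∈ S, a p * ε ^ (-p) := by
        simp only [ite_mul, zero_mul, Finset.sum_ite_mem,
          Finset.inter_eq_right.2 (Finset.subset_union_left (s₁ := S) (s₂ := S'))]
      have e2 : ∑ p ∈ S ∪ S', (if p ∈ S' then a' p else 0) * ε ^ (-p)
          = ∑ p ∈ S', a' p * ε ^ (-p) := by
        simp only [ite_mul, zero_mul, Finset.sum_ite_mem,
          Finset.inter_eq_right.2 (Finset.subset_union_right (s₁ := S) (s₂ := S'))]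
      simp only [sub_mul, Finset.sum_sub_distrib, e1, e2]
      ring)
  linarith [this.2]

open Classical in
/-- Hadamard's finite part of `F` at `0+`; the value is `0` if there is none. -/
def finitePart (F : ℝ → ℝ) : ℝ :=
  if h : ∃ c, HasFinitePart F c then h.choose else 0

/-- The truncated potential `∫_{y ∈ M, |x - y| ≥ ε} |x - y| ^ α dy`, where `dy` is the
`m`-dimensional volume (the Hausdorff measure normalized to agree with Lebesgue measure). -/
def truncatedPotential {n : ℕ} (m : ℕ) (α : ℝ) (M : Set (Euc n)) (x : Euc n) (ε : ℝ) : ℝ :=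
  ∫ y in M \ ball x ε, dist x y ^ α ∂(μHE[m] : Measure (Euc n))

/-- `Pf. ∫_M |x - y| ^ α dy`. -/
def potential {n : ℕ} (m : ℕ) (α : ℝ) (M : Set (Euc n)) (x : Euc n) : ℝ :=
  finitePart (truncatedPotential m α M x)

/-- The regularized `α`-energy `E_α(M) = ∫_M (Pf. ∫_M |x - y| ^ α dy) dx`. -/
def rieszEnergy {n : ℕ} (m : ℕ) (α : ℝ) (M : Set (Euc n)) : ℝ :=
  ∫ x in M, potential m α M x ∂(μHE[m] : Measure (Euc n))

/-- All the integrals and finite parts that occur in `rieszEnergy` exist. -/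
structure RieszEnergyDefined {n : ℕ} (m : ℕ) (α : ℝ) (M : Set (Euc n)) : Prop where
  integrableOn_trunc : ∀ x ∈ M, ∀ ε > 0,
    IntegrableOn (fun y => dist x y ^ α) (M \ ball x ε) (μHE[m] : Measure (Euc n))
  exists_finitePart : ∀ x ∈ M, ∃ c, HasFinitePart (truncatedPotential m α M x) c
  integrableOn_potential : IntegrableOn (potential m α M) M (μHE[m] : Measure (Euc n))

/-! ### Immersions, sheets, and the bounded-geometry class -/

section Immersions

variable {m n : ℕ} {N : Type*} [TopologicalSpace N] [ChartedSpace (Euc m) N]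

/-- A `C^k` immersion of an `m`-manifold into `ℝⁿ` (used for `k ≥ 1`). -/
def IsImm (k : ℕ) (f : N → Euc n) : Prop :=
  ContMDiff (𝓡 m) 𝓘(ℝ, Euc n) k f ∧
    ∀ p : N, Function.Injective (mfderiv (𝓡 m) 𝓘(ℝ, Euc n) f p)

/-- The open subset `W` is `C^k`-diffeomorphic to the open unit `m`-ball. -/
def IsDiffeoToBall (m k : ℕ) {N : Type*} [TopologicalSpace N] [ChartedSpace (Euc m) N]
    (W : Set N) : Prop :=
  ∃ e : OpenPartialHomeomorph (Euc m) N, e.source = ball 0 1 ∧ e.target = W ∧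
    ContMDiffOn (𝓡 m) (𝓡 m) k e e.source ∧ ContMDiffOn (𝓡 m) (𝓡 m) k e.symm e.target

/-- `f⁻¹(B_r(x))` is the disjoint union of `W₁, …, W_ℓ`, each `C^k`-diffeomorphic to an `m`-ball,
and `f` restricted to each `W_i` is a homeomorphism onto its image. For a `C^k` immersion `f` the
last property says that `f|W_i` is a `C^k` embedding, i.e. a `C^k`-diffeomorphism onto `f(W_i)`. -/
structure IsSheets (m k : ℕ) {n : ℕ} {N : Type*} [TopologicalSpace N] [ChartedSpace (Euc m) N]
    (f : N → Euc n) (x : Euc n) (r : ℝ) {l : ℕ} (W : Fin l → Set N) : Prop where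
  iUnion_eq : ⋃ i, W i = f ⁻¹' ball x r
  disjoint : Pairwise fun i j => Disjoint (W i) (W j)
  ball : ∀ i, IsDiffeoToBall m k (W i)
  embedding : ∀ i, IsEmbedding (fun p : W i => f p)

/-- The tangent space at `f p` of the sheet through `p`, as a linear subspace of `ℝⁿ`. -/
def tangentPlane (m : ℕ) {n : ℕ} {N : Type*} [TopologicalSpace N] [ChartedSpace (Euc m) N]
    (f : N → Euc n) (p : N) : Submodule ℝ (Euc n) :=
  let D : Euc m →L[ℝ] Euc n := mfderiv (𝓡 m) 𝓘(ℝ, Euc n) f p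
  LinearMap.range D.toLinearMap

end Immersions

/-- `S` is the graph (with origin `x`) of a `C^k` function `h : U → Tᗮ`, `U ⊆ T` open, all of whose
partial derivatives `∂^μ h`, `0 ≤ |μ| ≤ k`, with respect to any orthonormal basis of the
`m`-dimensional subspace `T` are bounded by `b` on `U`. -/
def IsBoundedGraph (m k : ℕ) (b : ℝ) {n : ℕ} (x : Euc n) (T : Submodule ℝ (Euc n))
    (S : Set (Euc n)) : Prop :=
  ∃ (U : Set T) (h : T → Tᗮ), IsOpen U ∧ ContDiffOn ℝ k h U ∧
    S = (fun u : T => x + (u : Euc n) + (h u : Euc n)) '' U ∧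
    ∀ (e : OrthonormalBasis (Fin m) ℝ T) (j : ℕ), j ≤ k → ∀ s : Fin j → Fin m, ∀ u ∈ U,
      ‖iteratedFDeriv ℝ j h u (fun i => e (s i))‖ ≤ b

/-- The class of closed immersed `m`-dimensional submanifolds `M'` of `ℝⁿ` of volume at most `V`
that are the image of a `C^k` immersion `g` of a closed `C^k` manifold `N` such that, for every
`x ∈ M'`, the preimage of the ball `B_{ε₀}(x)` splits into finitely many embedded `m`-balls, and
each of these sheets passing through `x` is a graph over its tangent space at `x` with derivatives
up to order `k` bounded by `b`. -/
def BoundedGeometry (m n k : ℕ) (ε₀ b V : ℝ) : Set (Set (Euc n)) :=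
  {M' | (μHE[m] : Measure (Euc n)) M' ≤ ENNReal.ofReal V ∧
    ∃ (N : Type) (_ : TopologicalSpace N) (_ : ChartedSpace (Euc m) N)
      (_ : IsManifold (𝓡 m) k N) (_ : CompactSpace N) (_ : T2Space N) (g : N → Euc n),
      IsImm (m := m) k g ∧ Set.range g = M' ∧
      ∀ x ∈ M', ∃ (l : ℕ) (W : Fin l → Set N), IsSheets m k g x ε₀ W ∧
        ∀ i, ∀ p ∈ W i, g p = x → IsBoundedGraph m k b x (tangentPlane m g p) (g '' W i)}

/-- `ᾱ = max {⌊-α⌋ - m, 0}`. -/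
def alphaBar (m : ℕ) (α : ℝ) : ℕ := (⌊-α⌋ - (m : ℤ)).toNat

end

end RieszRepulsion

/-! Fix x in M and split M into a graph Q of uniform size through x and the rest. The rest
contributes a convergent nonnegative integral to the potential. The finite part over Q is bounded by
a constant that depends only on m, n, α, ε₀ and b. Indeed, the layer-cake formula
`setIntegral_dist_rpow_eq` expresses the truncated integral through the volumes of Q ∩ B_t(x). These
volumes are t^m times a polynomial in t with bounded coefficients, up to O(t^(m+ᾱ+1)), uniformly
over all graphs with the given bounds (`GraphDatum.hasUniformExpansion_volume`). Since α + m + ᾱ + 1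
> 0, the remainder can be integrated down to 0, while the explicit powers and logarithm have finite
part 0 (`exists_tendsto_truncated`, `exists_potential_sub_le`). So, up to a uniform additive
constant, the potential at x dominates the integral of |x-y|^α over any part of M disjoint from the
sheet through x (`exists_setIntegral_le_potential_add`).

A double point of f yields two points of M at distance less than 2δ. The small sheet of M through
the second one is disjoint from the sheet through every point x of the first: otherwise the union of
these sheets would be connected, so its points would all lie in one W_i, where f is injective
although it identifies the two points (`disjoint_sheet_of_isSheets`). Hence the mutual interaction
of the two sheets is counted in the energy up to a uniform error. At each dyadic scale σ between δ
and r, pieces of volume about σ^m at distance at most 5σ interact with strength of order σ^(α+2m),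
which is bounded below because α ≤ -2m and σ ≤ 1. The number J of scales tends to infinity as δ
tends to 0 (`le_setIntegral_of_close_sheets`).

The volume expansion is computed in polar coordinates of the parameter domain. Along each ray the
Jacobian has a Taylor expansion, and the exit parameter of the ray from B_t satisfies an implicit
equation from which its expansion is bootstrapped.

The embeddedness of M enters through a radius ρ below which M near x is a single sheet. This ρ is
not uniform in M; it serves only to show that integrals and finite parts exist, and it does not
enter the lower bound. -/

namespace RieszRepulsion

noncomputable section

/-! ### Uniform one-sided expansions at `0` -/

section UniformExpansion

variable {I : Type*} {N : ℕ} {φ ψ : I → ℝ → ℝ}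

/-- `φ i t = ∑_{j < N} c i j * t ^ j + O(t ^ N)` as `t → 0+`, with bounded coefficients and a
remainder that is uniform in the index `i`. -/
def HasUniformExpansionWith (N : ℕ) (φ : I → ℝ → ℝ) (c : I → ℕ → ℝ) (K R : ℝ) : Prop :=
  0 < R ∧ (∀ i j, |c i j| ≤ K) ∧
    ∀ i t, 0 < t → t < R → |φ i t - ∑ j ∈ Finset.range N, c i j * t ^ j| ≤ K * t ^ N

/-- The family `φ` has an expansion of order `N` at `0+` which is uniform in the index. -/
def HasUniformExpansion (N : ℕ) (φ : I → ℝ → ℝ) : Prop :=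
  ∃ c K R, HasUniformExpansionWith N φ c K R

theorem HasUniformExpansion.congr (h : HasUniformExpansion N φ) {R' : ℝ} (hR' : 0 < R')
    (he : ∀ i t, 0 < t → t < R' → φ i t = ψ i t) : HasUniformExpansion N ψ := by
  obtain ⟨c, K, R, hR, hc, hb⟩ := h
  refine ⟨c, K, min R R', lt_min hR hR', hc, fun i t h0 ht => ?_⟩
  rw [← he i t h0 (ht.trans_le (min_le_right _ _))]
  exact hb i t h0 (ht.trans_le (min_le_left _ _))

theorem HasUniformExpansion.of_bound {K R : ℝ} (hR : 0 < R)
    (h : ∀ i t, 0 < t → t < R → |φ i t| ≤ K * t ^ N) : HasUniformExpansion N φ := by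
  refine ⟨fun _ _ => 0, |K|, R, hR, fun i j => by simp, fun i t h0 ht => ?_⟩
  simp only [zero_mul, Finset.sum_const_zero, sub_zero]
  exact (h i t h0 ht).trans (by gcongr; exact le_abs_self K)

/-- A normalization: for an empty index type nothing else forces K to be nonnegative. -/
theorem HasUniformExpansion.nonneg_bound {c : I → ℕ → ℝ} {K R : ℝ}
    (h : HasUniformExpansionWith N φ c K R) : HasUniformExpansionWith N φ c (max K 0) R := by
  obtain ⟨hR, hc, hb⟩ := h
  exact ⟨hR, fun i j => (hc i j).trans (le_max_left _ _), fun i t h0 ht =>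
    (hb i t h0 ht).trans (by gcongr; exact le_max_left _ _)⟩

theorem HasUniformExpansion.exists_bound (h : HasUniformExpansion N φ) :
    ∃ K R, 0 < R ∧ 0 ≤ K ∧ ∀ i t, 0 < t → t < R → |φ i t| ≤ K := by
  obtain ⟨c, K, R, h⟩ := h
  obtain ⟨hR, hc, hb⟩ := HasUniformExpansion.nonneg_bound h
  set K' := max K 0
  have hK : 0 ≤ K' := le_max_right _ _
  refine ⟨K' + N * K', min R 1, lt_min hR one_pos, by positivity, fun i t h0 ht => ?_⟩
  have ht1 : t ≤ 1 := (ht.trans_le (min_le_right _ _)).le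
  have h1 := hb i t h0 (ht.trans_le (min_le_left _ _))
  have h2 : |∑ j ∈ Finset.range N, c i j * t ^ j| ≤ N * K' := by
    refine (Finset.abs_sum_le_sum_abs _ _).trans ?_
    refine (Finset.sum_le_card_nsmul _ _ K' fun j _ => ?_).trans (by simp)
    rw [abs_mul, abs_of_nonneg (pow_nonneg h0.le j)]
    exact (mul_le_mul (hc i j) (pow_le_one₀ h0.le ht1) (by positivity) hK).trans (by simp)
  have h3 : K' * t ^ N ≤ K' := mul_le_of_le_one_right hK (pow_le_one₀ h0.le ht1)
  have h4 := abs_sub_abs_le_abs_sub (φ i t) (∑ j ∈ Finset.range N, c i j * t ^ j)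
  linarith

theorem HasUniformExpansion.add (h : HasUniformExpansion N φ) (h' : HasUniformExpansion N ψ) :
    HasUniformExpansion N (fun i t => φ i t + ψ i t) := by
  obtain ⟨c, K, R, hR, hc, hb⟩ := h
  obtain ⟨c', K', R', hR', hc', hb'⟩ := h'
  refine ⟨fun i j => c i j + c' i j, K + K', min R R', lt_min hR hR', fun i j =>
    (abs_add_le _ _).trans (add_le_add (hc i j) (hc' i j)), fun i t h0 ht => ?_⟩
  have h1 := hb i t h0 (ht.trans_le (min_le_left _ _))
  have h2 := hb' i t h0 (ht.trans_le (min_le_right _ _))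
  simp only [add_mul, Finset.sum_add_distrib]
  rw [add_sub_add_comm]
  exact (abs_add_le _ _).trans (add_le_add h1 h2)

theorem HasUniformExpansion.zero : HasUniformExpansion N (fun (_ : I) _ => 0) :=
  .of_bound (K := 0) one_pos (by simp)

theorem HasUniformExpansion.sum {κ : Type*} {s : Finset κ} {Φ : κ → I → ℝ → ℝ}
    (h : ∀ k ∈ s, HasUniformExpansion N (Φ k)) :
    HasUniformExpansion N (fun i t => ∑ k ∈ s, Φ k i t) := by
  classical
  induction s using Finset.induction_on with
  | empty => simpa using HasUniformExpansion.zero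
  | insert a s ha ih =>
    simp only [Finset.sum_insert ha]
    exact (h a (Finset.mem_insert_self _ _)).add
      (ih fun k hk => h k (Finset.mem_insert_of_mem hk))

theorem HasUniformExpansion.coeff_mul (h : HasUniformExpansion N φ) {a : I → ℝ} {A : ℝ}
    (ha : ∀ i, |a i| ≤ A) : HasUniformExpansion N (fun i t => a i * φ i t) := by
  obtain ⟨c, K, R, h⟩ := h
  obtain ⟨hR, hc, hb⟩ := HasUniformExpansion.nonneg_bound h
  have hK : 0 ≤ max K 0 := le_max_right _ _
  refine ⟨fun i j => a i * c i j, |A| * max K 0, R, hR, fun i j => ?_, fun i t h0 ht => ?_⟩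
  · rw [abs_mul]
    exact mul_le_mul ((ha i).trans (le_abs_self A)) (hc i j) (abs_nonneg _) (abs_nonneg _)
  · have : a i * φ i t - ∑ j ∈ Finset.range N, a i * c i j * t ^ j
        = a i * (φ i t - ∑ j ∈ Finset.range N, c i j * t ^ j) := by
      rw [mul_sub, Finset.mul_sum]
      simp only [mul_assoc]
    rw [this, abs_mul, mul_assoc]
    exact mul_le_mul ((ha i).trans (le_abs_self A)) (hb i t h0 ht) (abs_nonneg _) (abs_nonneg _)

/-- The gain of one order is what drives the bootstrap in
`GraphDatum.hasUniformExpansion_radius_div`. -/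
theorem HasUniformExpansion.t_mul (h : HasUniformExpansion N φ) :
    HasUniformExpansion (N + 1) (fun i t => t * φ i t) := by
  obtain ⟨c, K, R, h⟩ := h
  obtain ⟨hR, hc, hb⟩ := HasUniformExpansion.nonneg_bound h
  have hK : 0 ≤ max K 0 := le_max_right _ _
  refine ⟨fun i j => if j = 0 then 0 else c i (j - 1), max K 0, R, hR, fun i j => ?_,
    fun i t h0 ht => ?_⟩
  · dsimp only
    split_ifs
    · simp
    · exact hc _ _
  · have : t * φ i t - ∑ j ∈ Finset.range (N + 1), (if j = 0 then 0 else c i (j - 1)) * t ^ j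
        = t * (φ i t - ∑ j ∈ Finset.range N, c i j * t ^ j) := by
      rw [Finset.sum_range_succ', mul_sub, Finset.mul_sum]
      simp only [Nat.add_eq_zero_iff, one_ne_zero, and_false, if_false, Nat.add_sub_cancel,
        if_true, zero_mul, add_zero]
      congr 1
      exact Finset.sum_congr rfl fun j _ => by ring
    rw [this, abs_mul, abs_of_pos h0]
    calc t * _ ≤ t * (max K 0 * t ^ N) := by gcongr; exact hb i t h0 ht
      _ = _ := by ring

theorem HasUniformExpansion.of_succ (h : HasUniformExpansion (N + 1) φ) :
    HasUniformExpansion N φ := by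
  obtain ⟨c, K, R, h⟩ := h
  obtain ⟨hR, hc, hb⟩ := HasUniformExpansion.nonneg_bound h
  have hK : 0 ≤ max K 0 := le_max_right _ _
  refine ⟨c, max K 0 + max K 0, min R 1, lt_min hR one_pos, fun i j =>
    (hc i j).trans (by linarith), fun i t h0 ht => ?_⟩
  have ht1 : t ≤ 1 := (ht.trans_le (min_le_right _ _)).le
  have h1 := hb i t h0 (ht.trans_le (min_le_left _ _))
  rw [Finset.sum_range_succ, ← sub_sub] at h1
  have h2 : |c i N * t ^ N| ≤ max K 0 * t ^ N := by
    rw [abs_mul, abs_of_nonneg (pow_nonneg h0.le N)]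
    gcongr
    exact hc i N
  have h3 : max K 0 * t ^ (N + 1) ≤ max K 0 * t ^ N := by
    gcongr 1
    exact pow_le_pow_of_le_one h0.le ht1 (Nat.le_succ N)
  have h4 := abs_sub_abs_le_abs_sub (φ i t - ∑ j ∈ Finset.range N, c i j * t ^ j) (c i N * t ^ N)
  rw [add_mul]
  linarith

theorem HasUniformExpansion.mono {N' : ℕ} (h : HasUniformExpansion N φ) (hN : N' ≤ N) :
    HasUniformExpansion N' φ := by
  induction hN with
  | refl => exact h
  | step _ ih => exact ih h.of_succ

theorem HasUniformExpansion.pow_t_mul (h : HasUniformExpansion N φ) (j : ℕ) :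
    HasUniformExpansion N (fun i t => t ^ j * φ i t) := by
  induction j with
  | zero => simpa using h
  | succ j ih =>
    refine ih.t_mul.of_succ.congr one_pos fun i t _ _ => ?_
    ring

/-- Replacing the first factor by its polynomial leaves a combination of the functions t^j ψ. The
error is O(t^N) times ψ, and ψ is uniformly bounded near 0. -/
theorem HasUniformExpansion.mul (h : HasUniformExpansion N φ) (h' : HasUniformExpansion N ψ) :
    HasUniformExpansion N (fun i t => φ i t * ψ i t) := by
  obtain ⟨K', R', hR', hK', hb'⟩ := h'.exists_bound
  obtain ⟨c, K, R, h⟩ := h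
  obtain ⟨hR, hc, hb⟩ := HasUniformExpansion.nonneg_bound h
  have hK : 0 ≤ max K 0 := le_max_right _ _
  have h1 : HasUniformExpansion N
      (fun i t => ∑ j ∈ Finset.range N, c i j * (t ^ j * ψ i t)) :=
    .sum fun j _ => (h'.pow_t_mul j).coeff_mul fun i => hc i j
  have h2 : HasUniformExpansion N
      (fun i t => (φ i t - ∑ j ∈ Finset.range N, c i j * t ^ j) * ψ i t) := by
    refine .of_bound (K := max K 0 * K') (lt_min hR hR') fun i t h0 ht => ?_
    rw [abs_mul]
    calc _ ≤ (max K 0 * t ^ N) * K' :=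
          mul_le_mul (hb i t h0 (ht.trans_le (min_le_left _ _)))
            (hb' i t h0 (ht.trans_le (min_le_right _ _))) (abs_nonneg _) (by positivity)
      _ = _ := by ring
  refine (h1.add h2).congr one_pos fun i t _ _ => ?_
  rw [sub_mul, Finset.sum_mul]
  simp only [mul_assoc]
  ring

theorem HasUniformExpansion.const {a : I → ℝ} {A : ℝ} (ha : ∀ i, |a i| ≤ A) :
    HasUniformExpansion N (fun i _ => a i) := by
  cases N with
  | zero => exact .of_bound (K := A) one_pos fun i t _ _ => by simpa using ha i
  | succ N =>
    refine ⟨fun i j => if j = 0 then a i else 0, |A|, 1, one_pos, fun i j => ?_,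
      fun i t h0 ht => ?_⟩
    · dsimp only
      split_ifs
      · exact (ha i).trans (le_abs_self A)
      · simp
    · rw [Finset.sum_range_succ']
      simp
      positivity

theorem HasUniformExpansion.pow (h : HasUniformExpansion N φ) (j : ℕ) :
    HasUniformExpansion N (fun i t => φ i t ^ j) := by
  induction j with
  | zero =>
    simpa using HasUniformExpansion.const (I := I) (a := fun _ => (1 : ℝ)) (A := 1) (by simp)
  | succ j ih => simpa only [pow_succ] using ih.mul h

theorem HasUniformExpansion.prod {κ : Type*} {s : Finset κ} {Φ : κ → I → ℝ → ℝ}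
    (h : ∀ k ∈ s, HasUniformExpansion N (Φ k)) :
    HasUniformExpansion N (fun i t => ∏ k ∈ s, Φ k i t) := by
  classical
  induction s using Finset.induction_on with
  | empty =>
    simpa using HasUniformExpansion.const (I := I) (a := fun _ => (1 : ℝ)) (A := 1) (by simp)
  | insert a s ha ih =>
    simp only [Finset.prod_insert ha]
    exact (h a (Finset.mem_insert_self _ _)).mul
      (ih fun k hk => h k (Finset.mem_insert_of_mem hk))

theorem HasUniformExpansion.det {κ : Type*} [Fintype κ] [DecidableEq κ]
    {A : I → ℝ → Matrix κ κ ℝ} (h : ∀ a b, HasUniformExpansion N (fun i t => A i t a b)) :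
    HasUniformExpansion N (fun i t => (A i t).det) := by
  simp only [Matrix.det_apply']
  refine .sum fun σ _ => ?_
  refine (HasUniformExpansion.prod fun k _ => h (σ k) k).coeff_mul
    (a := fun _ => ((Equiv.Perm.sign σ : ℤ) : ℝ)) (A := 1) fun _ => ?_
  rcases Int.units_eq_one_or (Equiv.Perm.sign σ) with h | h <;> simp [h]

/-- Composition with a function that is approximated by polynomials along `φ`. -/
theorem HasUniformExpansion.comp_of_bound {c : I → ℕ → ℝ} {K R K' R' : ℝ} (hR : 0 < R)
    (hc : ∀ i j, |c i j| ≤ K) (hφ : HasUniformExpansion N φ)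
    (hb : ∀ i t, 0 < t → t < R →
      |ψ i t - ∑ j ∈ Finset.range N, c i j * φ i t ^ j| ≤ K * |φ i t| ^ N)
    (hR' : 0 < R') (hφt : ∀ i t, 0 < t → t < R' → |φ i t| ≤ K' * t) :
    HasUniformExpansion N ψ := by
  have h1 : HasUniformExpansion N (fun i t => ∑ j ∈ Finset.range N, c i j * φ i t ^ j) :=
    .sum fun j _ => (hφ.pow j).coeff_mul fun i => hc i j
  have h2 : HasUniformExpansion N
      (fun i t => ψ i t - ∑ j ∈ Finset.range N, c i j * φ i t ^ j) := by
    refine .of_bound (K := |K| * |K'| ^ N) (lt_min hR hR') fun i t h0 ht => ?_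
    refine (hb i t h0 (ht.trans_le (min_le_left _ _))).trans ?_
    have := hφt i t h0 (ht.trans_le (min_le_right _ _))
    calc K * |φ i t| ^ N ≤ |K| * (|K'| * t) ^ N := by
          gcongr
          · exact le_abs_self K
          · exact this.trans (by gcongr; exact le_abs_self K')
      _ = _ := by rw [mul_pow]; ring
  exact (h1.add h2).congr one_pos fun i t _ _ => by ring

theorem HasUniformExpansionWith.tendsto {c : I → ℕ → ℝ} {K R : ℝ}
    (h : HasUniformExpansionWith (N + 1) φ c K R) (i : I) :
    Tendsto (φ i) (𝓝[>] 0) (𝓝 (c i 0)) := by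
  obtain ⟨hR, hc, hb⟩ := h
  have h1 : Tendsto (fun t : ℝ => ∑ j ∈ Finset.range (N + 1), c i j * t ^ j) (𝓝[>] 0)
      (𝓝 (c i 0)) := by
    have : Continuous (fun t : ℝ => ∑ j ∈ Finset.range (N + 1), c i j * t ^ j) := by fun_prop
    have h := this.tendsto 0
    simp only [Finset.sum_range_succ', ne_eq, Nat.add_eq_zero_iff, one_ne_zero, and_false,
      not_false_eq_true, zero_pow, mul_zero, Finset.sum_const_zero, pow_zero, mul_one,
      zero_add] at h
    simp only [Finset.sum_range_succ', pow_zero, mul_one]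
    exact h.mono_left nhdsWithin_le_nhds
  have h2 : Tendsto (fun t : ℝ => φ i t - ∑ j ∈ Finset.range (N + 1), c i j * t ^ j) (𝓝[>] 0)
      (𝓝 0) := by
    have h3 : Tendsto (fun t : ℝ => K * t ^ (N + 1)) (𝓝[>] 0) (𝓝 0) := by
      have : Continuous (fun t : ℝ => K * t ^ (N + 1)) := by fun_prop
      simpa using (this.tendsto 0).mono_left nhdsWithin_le_nhds
    refine squeeze_zero_norm' ?_ h3
    filter_upwards [self_mem_nhdsWithin, nhdsWithin_le_nhds (Iio_mem_nhds hR)] with t h0 ht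
    exact hb i t h0 ht
  simpa using h1.add h2

theorem HasUniformExpansion.exists_sub_le (h : HasUniformExpansion (N + 1) φ) {a : ℝ}
    (ha : ∀ i, Tendsto (φ i) (𝓝[>] 0) (𝓝 a)) :
    ∃ K R, 0 < R ∧ 0 ≤ K ∧ ∀ i t, 0 < t → t < R → |φ i t - a| ≤ K * t := by
  obtain ⟨c, K, R, hexp⟩ := h.mono (N' := 1) (Nat.le_add_left 1 N)
  have hc0 : ∀ i, c i 0 = a := fun i => tendsto_nhds_unique (hexp.tendsto i) (ha i)
  obtain ⟨hR, hc, hb⟩ := HasUniformExpansion.nonneg_bound hexp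
  refine ⟨max K 0, R, hR, le_max_right _ _, fun i t h0 ht => ?_⟩
  simpa [hc0 i] using hb i t h0 ht

/-- The limit 0 forces the constant coefficients to vanish, so the remaining ones shift down by one
place. -/
theorem HasUniformExpansion.div_t (h : HasUniformExpansion (N + 1) φ)
    (h0 : ∀ i, Tendsto (φ i) (𝓝[>] 0) (𝓝 0)) :
    HasUniformExpansion N (fun i t => φ i t / t) := by
  obtain ⟨c, K, R, hexp⟩ := h
  have hc0 : ∀ i, c i 0 = 0 := fun i => tendsto_nhds_unique (hexp.tendsto i) (h0 i)
  obtain ⟨hR, hc, hb⟩ := hexp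
  refine ⟨fun i j => c i (j + 1), K, R, hR, fun i j => hc i (j + 1), fun i t ht0 ht => ?_⟩
  have h1 := hb i t ht0 ht
  rw [Finset.sum_range_succ'] at h1
  simp only [hc0, zero_mul, add_zero] at h1
  have : φ i t / t - ∑ j ∈ Finset.range N, c i (j + 1) * t ^ j
      = (φ i t - ∑ j ∈ Finset.range N, c i (j + 1) * t ^ (j + 1)) / t := by
    rw [sub_div, Finset.sum_div]
    congr 1
    refine Finset.sum_congr rfl fun j _ => ?_
    rw [pow_succ]
    field_simp
  rw [this, abs_div, abs_of_pos ht0, div_le_iff₀ ht0]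
  calc _ ≤ _ := h1
    _ = _ := by ring

/-- Since all members share the limit a, the difference φ - a is O(t) with a single constant. The
Taylor polynomial of G at a can therefore be substituted uniformly in the index. -/
theorem HasUniformExpansion.comp_analytic (h : HasUniformExpansion (N + 1) φ) {a : ℝ}
    (ha : ∀ i, Tendsto (φ i) (𝓝[>] 0) (𝓝 a)) {G : ℝ → ℝ} (hG : AnalyticAt ℝ G a) :
    HasUniformExpansion (N + 1) (fun i t => G (φ i t)) := by
  obtain ⟨K, R, hR, hK, hb⟩ := h.exists_sub_le ha
  obtain ⟨p, hp⟩ := hG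
  obtain ⟨C, hC⟩ := (hp.isBigO_sub_partialSum_pow (N + 1)).bound
  obtain ⟨δ, hδ, hball⟩ := Metric.eventually_nhds_iff.1 hC
  set A := |C| + ∑ j ∈ Finset.range (N + 1), |p.coeff j| with hA
  have hφ' : HasUniformExpansion (N + 1) (fun i t => φ i t - a) := by
    simpa only [sub_eq_add_neg] using
      h.add (HasUniformExpansion.const (a := fun _ => -a) (A := |a|) (by simp))
  refine HasUniformExpansion.comp_of_bound (φ := fun i t => φ i t - a)
    (c := fun _ j => if j < N + 1 then p.coeff j else 0) (K := A)
    (R := min R (δ / (K + 1))) (R' := R) (lt_min hR (by positivity)) ?_ hφ' ?_ hR hb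
  · intro i j
    have h0 : 0 ≤ |C| := abs_nonneg _
    split_ifs with hj
    · have := Finset.single_le_sum (f := fun j => |p.coeff j|) (fun j _ => abs_nonneg _)
        (Finset.mem_range.2 hj)
      linarith
    · simp only [abs_zero, hA]
      positivity
  · intro i t h0 ht
    have h1 := hb i t h0 (ht.trans_le (min_le_left _ _))
    have h2 : t < δ / (K + 1) := ht.trans_le (min_le_right _ _)
    rw [lt_div_iff₀ (by positivity)] at h2
    have h3 := @hball (φ i t - a) (by rw [Real.dist_eq, sub_zero]; nlinarith)
    rw [add_sub_cancel, Real.norm_eq_abs, norm_pow, norm_norm, Real.norm_eq_abs] at h3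
    have h4 : p.partialSum (N + 1) (φ i t - a) = ∑ j ∈ Finset.range (N + 1),
        (if j < N + 1 then p.coeff j else 0) * (φ i t - a) ^ j := by
      rw [FormalMultilinearSeries.partialSum]
      refine Finset.sum_congr rfl fun j hj => ?_
      rw [if_pos (Finset.mem_range.1 hj), FormalMultilinearSeries.apply_eq_pow_smul_coeff,
        smul_eq_mul, mul_comm]
    rw [← h4]
    refine h3.trans ?_
    gcongr
    calc C ≤ |C| := le_abs_self C
      _ ≤ A := le_add_of_nonneg_right (Finset.sum_nonneg fun j _ => abs_nonneg _)

/-- The coefficients are determined successively by limits at 0+: first that of φ, then that of (φ -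
c₀)/t, and so on. Each is a pointwise limit of a sequence of measurable functions. -/
theorem HasUniformExpansionWith.measurable_coeff {Θ : Type*} [MeasurableSpace Θ]
    {φ : Θ → ℝ → ℝ} {c : Θ → ℕ → ℝ} {K R : ℝ} (h : HasUniformExpansionWith N φ c K R)
    (hm : ∀ t, 0 < t → t < R → Measurable fun θ => φ θ t) :
    ∀ j < N, Measurable fun θ => c θ j := by
  induction N generalizing φ c with
  | zero => intro j hj; omega
  | succ N ih =>
    have h0 : Measurable fun θ => c θ 0 := by
      obtain ⟨u, -, hu, hlim⟩ := exists_seq_strictAnti_tendsto' h.1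
      refine measurable_of_tendsto_metrizable (f := fun n θ => φ θ (u n))
        (fun n => hm _ (hu n).1 (hu n).2) (tendsto_pi_nhds.2 fun θ => ?_)
      refine (h.tendsto θ).comp (tendsto_nhdsWithin_iff.2 ⟨hlim, ?_⟩)
      exact Eventually.of_forall fun n => (hu n).1
    have h1 : HasUniformExpansionWith N (fun θ t => (φ θ t - c θ 0) / t)
        (fun θ j => c θ (j + 1)) K R := by
      obtain ⟨hR, hc, hb⟩ := h
      refine ⟨hR, fun i j => hc i (j + 1), fun i t ht0 ht => ?_⟩
      have h1 := hb i t ht0 ht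
      rw [Finset.sum_range_succ'] at h1
      simp only [pow_zero, mul_one] at h1
      have : (φ i t - c i 0) / t - ∑ j ∈ Finset.range N, c i (j + 1) * t ^ j
          = (φ i t - (∑ j ∈ Finset.range N, c i (j + 1) * t ^ (j + 1) + c i 0)) / t := by
        rw [sub_div, sub_div, add_div, Finset.sum_div]
        have : ∑ j ∈ Finset.range N, c i (j + 1) * t ^ (j + 1) / t
            = ∑ j ∈ Finset.range N, c i (j + 1) * t ^ j := by
          refine Finset.sum_congr rfl fun j _ => ?_
          rw [pow_succ]
          field_simp
        rw [this]
        ring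
      rw [this, abs_div, abs_of_pos ht0, div_le_iff₀ ht0]
      calc _ ≤ _ := h1
        _ = _ := by ring
    intro j hj
    cases j with
    | zero => exact h0
    | succ j =>
      exact ih h1 (fun t ht0 ht => ((hm t ht0 ht).sub h0).div_const t) j (by omega)

/-- Uniform expansions may be integrated with respect to part of the index. -/
theorem HasUniformExpansion.integral {Θ : Type*} [MeasurableSpace Θ] {σ : Measure Θ}
    [IsFiniteMeasure σ] {φ : I × Θ → ℝ → ℝ} (h : HasUniformExpansion N φ) {R' : ℝ} (hR' : 0 < R')
    (hm : ∀ i t, 0 < t → t < R' → Measurable fun θ => φ (i, θ) t) :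
    HasUniformExpansion N (fun i t => ∫ θ, φ (i, θ) t ∂σ) := by
  obtain ⟨c, K, R, h⟩ := h
  obtain ⟨hR, hc, hb⟩ := HasUniformExpansion.nonneg_bound h
  have hK : 0 ≤ max K 0 := le_max_right _ _
  have hcm : ∀ i, ∀ j < N, Measurable fun θ => c (i, θ) j := fun i =>
    HasUniformExpansionWith.measurable_coeff (φ := fun θ => φ (i, θ)) (K := max K 0)
      (R := min R R')
      ⟨lt_min hR hR', fun θ j => hc _ j, fun θ t h0 ht =>
        hb _ t h0 (ht.trans_le (min_le_left _ _))⟩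
      fun t h0 ht => hm i t h0 (ht.trans_le (min_le_right _ _))
  have hci : ∀ i, ∀ j < N, Integrable (fun θ => c (i, θ) j) σ := fun i j hj =>
    (integrable_const (max K 0)).mono' (hcm i j hj).aestronglyMeasurable
      (Eventually.of_forall fun θ => hc _ j)
  refine ⟨fun i j => ∫ θ, c (i, θ) j ∂σ, max K 0 * σ.real Set.univ, min R R', lt_min hR hR',
    fun i j => ?_, fun i t h0 ht => ?_⟩
  · have : ∀ θ, ‖c (i, θ) j‖ ≤ max K 0 := fun θ => hc _ j
    exact norm_integral_le_of_norm_le_const (Eventually.of_forall this)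
  · have hsum : Integrable (fun θ => ∑ j ∈ Finset.range N, c (i, θ) j * t ^ j) σ :=
      integrable_finsetSum _ fun j hj => (hci i j (Finset.mem_range.1 hj)).mul_const _
    have hbt : ∀ θ, ‖φ (i, θ) t - ∑ j ∈ Finset.range N, c (i, θ) j * t ^ j‖ ≤ max K 0 * t ^ N :=
      fun θ => hb _ t h0 (ht.trans_le (min_le_left _ _))
    have hdiff : Integrable
        (fun θ => φ (i, θ) t - ∑ j ∈ Finset.range N, c (i, θ) j * t ^ j) σ :=
      (integrable_const (max K 0 * t ^ N)).mono'
        ((hm i t h0 (ht.trans_le (min_le_right _ _))).aestronglyMeasurable.sub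
          hsum.aestronglyMeasurable) (Eventually.of_forall hbt)
    have hintg : Integrable (fun θ => φ (i, θ) t) σ :=
      (hdiff.add hsum).congr (Eventually.of_forall fun θ => by simp)
    have hs : ∑ j ∈ Finset.range N, (∫ θ, c (i, θ) j ∂σ) * t ^ j
        = ∫ θ, ∑ j ∈ Finset.range N, c (i, θ) j * t ^ j ∂σ := by
      rw [integral_finsetSum _ fun j hj => (hci i j (Finset.mem_range.1 hj)).mul_const _]
      simp only [integral_mul_const]
    rw [hs, ← integral_sub hintg hsum]
    refine (norm_integral_le_of_norm_le_const (Eventually.of_forall hbt)).trans_eq ?_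
    ring

end UniformExpansion


/-! ### Algebra of finite parts -/

section FinitePart

theorem hasFinitePart_of_tendsto {F : ℝ → ℝ} {c : ℝ} (h : Tendsto F (𝓝[>] 0) (𝓝 c)) :
    HasFinitePart F c :=
  ⟨∅, 0, 0, by simp, by simpa using h⟩

theorem HasFinitePart.add {F G : ℝ → ℝ} {c c' : ℝ} (h : HasFinitePart F c)
    (h' : HasFinitePart G c') : HasFinitePart (fun ε => F ε + G ε) (c + c') := by
  classical
  obtain ⟨S, a, d, hS, hc⟩ := h
  obtain ⟨S', a', d', hS', hc'⟩ := h'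
  refine ⟨S ∪ S', fun p => (if p ∈ S then a p else 0) + (if p ∈ S' then a' p else 0), d + d',
    fun p hp => (Finset.mem_union.1 hp).elim (hS p) (hS' p), ?_⟩
  refine (hc.add hc').congr' (Eventually.of_forall fun ε => ?_)
  have e1 : ∑ p ∈ S ∪ S', (if p ∈ S then a p else 0) * ε ^ (-p)
      = ∑ p ∈ S, a p * ε ^ (-p) := by
    simp only [ite_mul, zero_mul, Finset.sum_ite_mem,
      Finset.inter_eq_right.2 (Finset.subset_union_left (s₁ := S) (s₂ := S'))]
  have e2 : ∑ p ∈ S ∪ S', (if p ∈ S' then a' p else 0) * ε ^ (-p)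
      = ∑ p ∈ S', a' p * ε ^ (-p) := by
    simp only [ite_mul, zero_mul, Finset.sum_ite_mem,
      Finset.inter_eq_right.2 (Finset.subset_union_right (s₁ := S) (s₂ := S'))]
  simp only [add_mul, Finset.sum_add_distrib, e1, e2]
  ring

theorem HasFinitePart.const_mul {F : ℝ → ℝ} {c : ℝ} (h : HasFinitePart F c) (r : ℝ) :
    HasFinitePart (fun ε => r * F ε) (r * c) := by
  obtain ⟨S, a, d, hS, hc⟩ := h
  refine ⟨S, fun p => r * a p, r * d, hS, (hc.const_mul r).congr fun ε => ?_⟩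
  rw [mul_sub, mul_add, Finset.mul_sum]
  simp only [mul_assoc]

theorem HasFinitePart.sum {κ : Type*} {s : Finset κ} {F : κ → ℝ → ℝ} {c : κ → ℝ}
    (h : ∀ k ∈ s, HasFinitePart (F k) (c k)) :
    HasFinitePart (fun ε => ∑ k ∈ s, F k ε) (∑ k ∈ s, c k) := by
  classical
  induction s using Finset.induction_on with
  | empty => simpa using hasFinitePart_of_tendsto (tendsto_const_nhds (x := (0 : ℝ)))
  | insert a s ha ih =>
    simp only [Finset.sum_insert ha]
    exact (h a (Finset.mem_insert_self _ _)).add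
      (ih fun k hk => h k (Finset.mem_insert_of_mem hk))

theorem hasFinitePart_rpow {q : ℝ} (hq : q < 0) : HasFinitePart (fun ε => ε ^ q) 0 :=
  ⟨{-q}, fun _ => 1, 0, by simpa using hq, by simp⟩

theorem hasFinitePart_log : HasFinitePart Real.log 0 :=
  ⟨∅, 0, 1, by simp, by simp⟩

theorem finitePart_eq {F : ℝ → ℝ} {c : ℝ} (h : HasFinitePart F c) : finitePart F = c := by
  have h' : ∃ c, HasFinitePart F c := ⟨c, h⟩
  rw [finitePart, dif_pos h']
  exact h'.choose_spec.unique h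

/-- The singular function of `ε` contributed to the truncated potential by a term `s ^ (q - α)` in
the volume of a ball of radius `s`. -/
def gauge (α q ε : ℝ) : ℝ := if q = 0 then α * Real.log ε else (α / q - 1) * ε ^ q

theorem hasFinitePart_gauge (α : ℝ) {q : ℝ} (hq : q ≤ 0) : HasFinitePart (gauge α q) 0 := by
  unfold gauge
  rcases hq.lt_or_eq with h | h
  · simpa only [h.ne, if_false, mul_zero] using (hasFinitePart_rpow h).const_mul (α / q - 1)
  · simpa only [h, if_true, mul_zero] using hasFinitePart_log.const_mul α

end FinitePart

/-! ### The truncated potential through the volume of balls -/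

section LayerCake

variable {n : ℕ}

/-- The layer-cake identity at one point: d^α - R^α is the integral of its derivative from d to R,
written over a range of s that does not depend on d so that Fubini applies. -/
theorem integral_Ioc_indicator_rpow {α d ε R : ℝ} (hα : α < 0) (hε : 0 < ε) (hd : ε ≤ d)
    (hdR : d < R) :
    ∫ s in Set.Ioc ε R, (Set.Ioi d).indicator (fun s : ℝ => -α * s ^ (α - 1)) s
      = d ^ α - R ^ α := by
  have hset : Set.Ioc ε R ∩ Set.Ioi d = Set.Ioc d R := by
    ext s
    simp only [Set.mem_inter_iff, Set.mem_Ioc, Set.mem_Ioi]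
    constructor
    · rintro ⟨⟨_, h⟩, h'⟩; exact ⟨h', h⟩
    · rintro ⟨h, h'⟩; exact ⟨⟨hd.trans_lt h, h'⟩, h⟩
  have hα' : α ≠ 0 := hα.ne
  rw [setIntegral_indicator measurableSet_Ioi, hset, integral_const_mul,
    ← intervalIntegral.integral_of_le hdR.le, integral_rpow]
  · rw [sub_add_cancel]
    field_simp
    ring
  · right
    refine ⟨by linarith, ?_⟩
    rw [Set.uIcc_of_le hdR.le, Set.mem_Icc]
    intro h
    linarith [h.1]

/-- Write |x-y|^α as R^α plus the integral of -α s^(α-1) over s between |x-y| and R, then exchange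
the integrals. The inner integral becomes the measure of a ball minus that of B_ε(x). -/
theorem setIntegral_dist_rpow_eq {μ : Measure (Euc n)} {Q : Set (Euc n)} (hQ : MeasurableSet Q)
    (hfin : μ Q ≠ ⊤) {x : Euc n} {α ε R : ℝ} (hα : α < 0) (hε : 0 < ε) (hεR : ε < R)
    (hQR : Q ⊆ ball x R) :
    ∫ y in Q \ ball x ε, dist x y ^ α ∂μ
      = R ^ α * μ.real (Q ∩ ball x R) - ε ^ α * μ.real (Q ∩ ball x ε)
        + ∫ s in ε..R, -α * s ^ (α - 1) * μ.real (Q ∩ ball x s) := by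
  have hR : 0 < R := hε.trans hεR
  have hα' : α ≠ 0 := hα.ne
  set B : ℝ → ℝ := fun s => μ.real (Q ∩ ball x s) with hB
  have hBmono : Monotone B := fun s t hst =>
    measureReal_mono (Set.inter_subset_inter_right _ (ball_subset_ball hst))
      (measure_ne_top_of_subset Set.inter_subset_left hfin)
  have hAm : MeasurableSet (Q \ ball x ε) := hQ.diff measurableSet_ball
  set ν := μ.restrict (Q \ ball x ε) with hν
  have : IsFiniteMeasure ν :=
    isFiniteMeasure_restrict.2 (measure_ne_top_of_subset Set.sdiff_subset hfin)
  set g : ℝ → ℝ := fun s => -α * s ^ (α - 1) with hg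
  have hνs : ∀ s, ε ≤ s → ν.real (ball x s) = B s - B ε := by
    intro s hs
    have h1 : ν.real (ball x s) = μ.real ((Q ∩ ball x s) \ (Q ∩ ball x ε)) := by
      rw [hν, measureReal_restrict_apply measurableSet_ball]
      congr 1
      ext y
      simp only [Set.mem_inter_iff, Set.mem_sdiff]
      tauto
    rw [h1, measureReal_sdiff (Set.inter_subset_inter_right _ (ball_subset_ball hs))
      (hQ.inter measurableSet_ball) (measure_ne_top_of_subset Set.inter_subset_left hfin)]
  have hgc : ContinuousOn g (Set.Icc ε R) := by
    refine continuousOn_const.mul (continuousOn_id.rpow_const fun s hs => Or.inl ?_)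
    exact (hε.trans_le hs.1).ne'
  have hgm : Measurable g := by fun_prop
  have hpt : ∀ y ∈ Q \ ball x ε, dist x y ^ α
      = R ^ α + ∫ s in Set.Ioc ε R, (ball x s).indicator (fun _ => g s) y := by
    intro y hy
    have h1 : ε ≤ dist x y := by
      have := hy.2
      rw [mem_ball, dist_comm] at this
      exact not_lt.1 this
    have h2 : dist x y < R := by
      have := hQR hy.1
      rwa [mem_ball, dist_comm] at this
    have h3 := integral_Ioc_indicator_rpow hα hε h1 h2
    have h4 : ∀ s, (ball x s).indicator (fun _ => g s) y
        = (Set.Ioi (dist x y)).indicator g s := by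
      intro s
      simp only [Set.indicator, mem_ball, Set.mem_Ioi, dist_comm y x]
    simp only [h4]
    rw [h3]
    ring
  have hjm : Measurable (fun p : Euc n × ℝ => (ball x p.2).indicator (fun _ => g p.2) p.1) := by
    have : (fun p : Euc n × ℝ => (ball x p.2).indicator (fun _ => g p.2) p.1)
        = {p : Euc n × ℝ | dist p.1 x < p.2}.indicator (fun p => g p.2) := by
      ext p
      simp only [Set.indicator, mem_ball, Set.mem_ofPred_eq]
    rw [this]
    refine (hgm.comp measurable_snd).indicator ?_
    exact measurableSet_lt (by fun_prop) measurable_snd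
  obtain ⟨Cg, hCg⟩ := isCompact_Icc.exists_bound_of_continuousOn hgc
  -- Fubini is harmless here: s stays away from 0, so the integrand is bounded on a product of
  -- finite measures.
  have hji : Integrable (Function.uncurry fun y s => (ball x s).indicator (fun _ => g s) y)
      (ν.prod (volume.restrict (Set.Ioc ε R))) := by
    refine (integrable_const Cg).mono' hjm.aestronglyMeasurable ?_
    have hae : ∀ᵐ p ∂(ν.prod (volume.restrict (Set.Ioc ε R))), p.2 ∈ Set.Ioc ε R :=
      Measure.quasiMeasurePreserving_snd.ae (ae_restrict_mem measurableSet_Ioc)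
    filter_upwards [hae] with p hp
    have h1 := hCg p.2 ⟨hp.1.le, hp.2⟩
    simp only [Function.uncurry, Set.indicator]
    split_ifs
    · exact h1
    · simpa using (norm_nonneg _).trans h1
  have hji' : Integrable
      (fun y => ∫ s in Set.Ioc ε R, (ball x s).indicator (fun _ => g s) y) ν :=
    hji.integral_prod_left
  rw [setIntegral_congr_fun hAm hpt, ← hν, integral_add (integrable_const _) hji',
    integral_integral_swap hji, integral_const, smul_eq_mul]
  have h5 : ∀ s ∈ Set.Ioc ε R, ∫ y, (ball x s).indicator (fun _ => g s) y ∂ν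
      = g s * B s - g s * B ε := by
    intro s hs
    rw [integral_indicator measurableSet_ball, setIntegral_const, hνs s hs.1.le, smul_eq_mul]
    ring
  rw [setIntegral_congr_fun measurableSet_Ioc h5, ← intervalIntegral.integral_of_le hεR.le]
  have hgi : IntervalIntegrable g volume ε R := by
    apply ContinuousOn.intervalIntegrable
    rwa [Set.uIcc_of_le hεR.le]
  have hgB : IntervalIntegrable (fun s => g s * B s) volume ε R := by
    refine (hBmono.intervalIntegrable).continuousOn_mul ?_
    rwa [Set.uIcc_of_le hεR.le]
  rw [intervalIntegral.integral_sub hgB (hgi.mul_const _), intervalIntegral.integral_mul_const]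
  have h6 : ∫ s in ε..R, g s = ε ^ α - R ^ α := by
    rw [hg, intervalIntegral.integral_const_mul, integral_rpow]
    · rw [sub_add_cancel]
      field_simp
      ring
    · right
      refine ⟨by linarith, ?_⟩
      rw [Set.uIcc_of_le hεR.le, Set.mem_Icc]
      intro h
      linarith [h.1]
  have h7 : ν.real Set.univ = B R - B ε := by
    rw [← hνs R hεR.le]
    rw [hν, measureReal_restrict_apply .univ, measureReal_restrict_apply measurableSet_ball,
      Set.univ_inter]
    congr 1
    ext y
    simp only [Set.mem_inter_iff, Set.mem_sdiff]
    exact ⟨fun h => ⟨hQR h.1, h⟩, fun h => h.2⟩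
  rw [h6, h7]
  simp only [hB, hg]
  ring

/-- If the volume of the balls `Q ∩ B_t(x)` has an expansion in powers of `t`, then the truncated
potential of `Q` at `x` is a combination of the functions `gauge` up to a convergent term, whose
limit is bounded in terms of the bounds for the expansion. -/
theorem exists_tendsto_truncated (m N : ℕ) {α K R : ℝ} (hα : α < 0)
    (hN : 0 < α + m + N) (hR : 0 < R) :
    ∃ C, ∀ {μ : Measure (Euc n)} {Q : Set (Euc n)} {x : Euc n} {a : ℕ → ℝ},
      MeasurableSet Q → μ Q ≠ ⊤ → Q ⊆ ball x R → (∀ j, |a j| ≤ K) →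
      (∀ t, 0 < t → t ≤ R → |μ.real (Q ∩ ball x t)
        - ∑ j ∈ Finset.range N, a j * t ^ (m + j)| ≤ K * t ^ (m + N)) →
      ∃ c, |c| ≤ C ∧ Tendsto (fun ε => (∫ y in Q \ ball x ε, dist x y ^ α ∂μ)
        - ∑ j ∈ Finset.range N, a j * gauge α (α + m + j) ε) (𝓝[>] 0) (𝓝 c) := by
  -- κ q collects what `gauge` leaves out of -ε^q - α ∫_ε^R s^(q-1) ds, namely the part independent
  -- of ε; see `hterm`.
  set κ : ℝ → ℝ := fun q => if q = 0 then -1 - α * Real.log R else -α * R ^ q / q with hκ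
  refine ⟨R ^ α * (∑ j ∈ Finset.range N, K * R ^ (m + j) + K * R ^ (m + N))
    + ∑ j ∈ Finset.range N, K * |κ (α + m + j)|
    + -α * K * (R ^ (α + m + N) / (α + m + N)), ?_⟩
  intro μ Q x a hQ hfin hQR ha hb
  set B : ℝ → ℝ := fun s => μ.real (Q ∩ ball x s) with hB
  set P : ℝ → ℝ := fun s => ∑ j ∈ Finset.range N, a j * s ^ (m + j) with hP
  set E : ℝ → ℝ := fun s => s ^ (α - 1) * (B s - P s) with hE
  have hBmono : Monotone B := fun s t hst =>
    measureReal_mono (Set.inter_subset_inter_right _ (ball_subset_ball hst))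
      (measure_ne_top_of_subset Set.inter_subset_left hfin)
  have hPc : Continuous P := by fun_prop
  have hEm : Measurable E := by
    have := hBmono.measurable
    fun_prop
  -- The exponent exceeds -1 by `hN`, so the remainder is integrable down to 0, with an integral
  -- controlled by K and R alone.
  have hEb : ∀ s, 0 < s → s ≤ R → ‖E s‖ ≤ K * s ^ (α + m + N - 1) := by
    intro s hs hsR
    rw [hE, norm_mul, Real.norm_of_nonneg (Real.rpow_nonneg hs.le _)]
    calc _ ≤ s ^ (α - 1) * (K * s ^ (m + N)) := by gcongr; exact hb s hs hsR
      _ = K * (s ^ (α - 1) * s ^ ((m + N : ℕ) : ℝ)) := by rw [Real.rpow_natCast]; ring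
      _ = _ := by
        rw [← Real.rpow_add hs]
        congr 2
        push_cast
        ring
  have hmaj : ∀ c, IntervalIntegrable (fun s : ℝ => K * s ^ (α + m + N - 1)) volume 0 c :=
    fun c => (intervalIntegral.intervalIntegrable_rpow' (by linarith)).const_mul K
  have hmajI : ∀ c, ∫ s in (0 : ℝ)..c, K * s ^ (α + m + N - 1)
      = K * (c ^ (α + m + N) / (α + m + N)) := by
    intro c
    rw [intervalIntegral.integral_const_mul, integral_rpow (Or.inl (by linarith)),
      sub_add_cancel, Real.zero_rpow hN.ne', sub_zero]
  have hEi : ∀ c, 0 ≤ c → c ≤ R → IntervalIntegrable E volume 0 c := by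
    intro c hc hcR
    refine (hmaj c).mono_fun' hEm.aestronglyMeasurable ?_
    rw [Set.uIoc_of_le hc]
    filter_upwards [ae_restrict_mem measurableSet_Ioc] with s hs
    exact hEb s hs.1 (hs.2.trans hcR)
  have hEI : ∀ c, 0 ≤ c → c ≤ R →
      ‖∫ s in (0 : ℝ)..c, E s‖ ≤ K * (c ^ (α + m + N) / (α + m + N)) := by
    intro c hc hcR
    rw [← hmajI c]
    refine intervalIntegral.norm_integral_le_of_norm_le hc ?_ (hmaj c)
    exact Eventually.of_forall fun s hs => hEb s hs.1 (hs.2.trans hcR)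
  have hterm : ∀ ε, 0 < ε → ε < R → ∀ q : ℝ,
      -ε ^ q + -α * ∫ s in ε..R, s ^ (q - 1) = gauge α q ε + κ q := by
    intro ε hε hεR q
    have h0 : (0 : ℝ) ∉ Set.uIcc ε R := by
      rw [Set.uIcc_of_le hεR.le, Set.mem_Icc]
      intro h
      linarith [h.1]
    by_cases hq : q = 0
    · subst hq
      have : ∀ s : ℝ, s ^ ((0 : ℝ) - 1) = s⁻¹ := fun s => by
        rw [zero_sub, Real.rpow_neg_one]
      simp only [this, gauge, hκ, if_true, Real.rpow_zero]
      rw [integral_inv h0, Real.log_div hR.ne' hε.ne']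
      ring
    · simp only [gauge, hκ, hq, if_false]
      rw [integral_rpow (Or.inr ⟨fun h => hq (by linarith), h0⟩), sub_add_cancel]
      field_simp
      ring
  -- An exact identity: the polynomial part reproduces the gauges, and the dependence on ε that is
  -- left sits in an integral of E over (0, ε) and a boundary term, both of which vanish in the
  -- limit.
  have hF : ∀ ε, 0 < ε → ε < R → (∫ y in Q \ ball x ε, dist x y ^ α ∂μ)
        - ∑ j ∈ Finset.range N, a j * gauge α (α + m + j) ε
      = R ^ α * B R + ∑ j ∈ Finset.range N, a j * κ (α + m + j)
        + -α * ((∫ s in (0 : ℝ)..R, E s) - ∫ s in (0 : ℝ)..ε, E s)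
        - ε ^ α * (B ε - P ε) := by
    intro ε hε hεR
    have hpow : ∀ s : ℝ, 0 < s → ∀ j : ℕ, s ^ (α - 1) * (a j * s ^ (m + j))
        = a j * s ^ (α + m + j - 1) := by
      intro s hs j
      rw [mul_left_comm, ← Real.rpow_natCast s (m + j), ← Real.rpow_add hs]
      congr 2
      push_cast
      ring
    have hci : ∀ q : ℝ, IntervalIntegrable (fun s : ℝ => s ^ q) volume ε R := by
      intro q
      refine ContinuousOn.intervalIntegrable (continuousOn_id.rpow_const fun s hs => Or.inl ?_)
      rw [Set.uIcc_of_le hεR.le] at hs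
      exact (hε.trans_le hs.1).ne'
    have hsplit : ∫ s in ε..R, -α * s ^ (α - 1) * B s
        = -α * (∑ j ∈ Finset.range N, a j * ∫ s in ε..R, s ^ (α + m + j - 1))
          + -α * ((∫ s in (0 : ℝ)..R, E s) - ∫ s in (0 : ℝ)..ε, E s) := by
      have e0 : (∫ s in (0 : ℝ)..R, E s) - ∫ s in (0 : ℝ)..ε, E s = ∫ s in ε..R, E s :=
        intervalIntegral.integral_interval_sub_left (hEi R hR.le le_rfl) (hEi ε hε.le hεR.le)
      have hEi' : IntervalIntegrable E volume ε R :=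
        (hEi ε hε.le hεR.le).symm.trans (hEi R hR.le le_rfl)
      have e1 : ∑ j ∈ Finset.range N, a j * ∫ s in ε..R, s ^ (α + m + j - 1)
          = ∫ s in ε..R, ∑ j ∈ Finset.range N, a j * s ^ (α + m + j - 1) := by
        rw [intervalIntegral.integral_finsetSum fun j _ => (hci _).const_mul _]
        simp only [intervalIntegral.integral_const_mul]
      have hsi : IntervalIntegrable
          (fun s : ℝ => ∑ j ∈ Finset.range N, a j * s ^ (α + m + j - 1)) volume ε R := by
        have := IntervalIntegrable.sum (Finset.range N)
          (f := fun (j : ℕ) (s : ℝ) => a j * s ^ (α + m + j - 1)) (μ := volume) (a := ε) (b := R)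
          fun j _ => (hci _).const_mul _
        refine this.congr fun s _ => ?_
        simp
      rw [e0, e1, ← mul_add, ← intervalIntegral.integral_add hsi hEi',
        ← intervalIntegral.integral_const_mul]
      refine intervalIntegral.integral_congr fun s hs => ?_
      rw [Set.uIcc_of_le hεR.le] at hs
      have hs0 : 0 < s := hε.trans_le hs.1
      simp only [hE, hP, mul_sub, Finset.mul_sum, hpow s hs0]
      ring
    rw [setIntegral_dist_rpow_eq hQ hfin hα hε hεR hQR, hsplit]
    have e2 : ε ^ α * P ε = ∑ j ∈ Finset.range N, a j * ε ^ (α + m + j) := by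
      rw [hP, Finset.mul_sum]
      refine Finset.sum_congr rfl fun j _ => ?_
      rw [mul_left_comm, ← Real.rpow_natCast ε (m + j), ← Real.rpow_add hε]
      congr 2
      push_cast
      ring
    have e3 : ∑ j ∈ Finset.range N, a j * gauge α (α + m + j) ε
        = -ε ^ α * P ε + -α * (∑ j ∈ Finset.range N, a j * ∫ s in ε..R, s ^ (α + m + j - 1))
          - ∑ j ∈ Finset.range N, a j * κ (α + m + j) := by
      rw [neg_mul, e2, ← Finset.sum_neg_distrib, Finset.mul_sum, ← Finset.sum_add_distrib,
        ← Finset.sum_sub_distrib]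
      refine Finset.sum_congr rfl fun j _ => ?_
      have := hterm ε hε hεR (α + m + j)
      rw [eq_sub_iff_add_eq, ← mul_add, ← this]
      ring
    rw [e3]
    simp only [hB]
    ring
  refine ⟨R ^ α * B R + ∑ j ∈ Finset.range N, a j * κ (α + m + j)
    + -α * ((∫ s in (0 : ℝ)..R, E s) - 0) - 0, ?_, ?_⟩
  · have h1 : |R ^ α * B R|
        ≤ R ^ α * (∑ j ∈ Finset.range N, K * R ^ (m + j) + K * R ^ (m + N)) := by
      rw [abs_mul, abs_of_nonneg (Real.rpow_nonneg hR.le α)]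
      gcongr
      have h2 := hb R hR le_rfl
      have h3 : |P R| ≤ ∑ j ∈ Finset.range N, K * R ^ (m + j) := by
        refine (Finset.abs_sum_le_sum_abs _ _).trans (Finset.sum_le_sum fun j _ => ?_)
        rw [abs_mul, abs_of_nonneg (pow_nonneg hR.le _)]
        gcongr
        exact ha j
      have h4 := abs_sub_abs_le_abs_sub (B R) (P R)
      simp only [hB, hP] at h2 h3 h4 ⊢
      linarith
    have h2 : |∑ j ∈ Finset.range N, a j * κ (α + m + j)|
        ≤ ∑ j ∈ Finset.range N, K * |κ (α + m + j)| := by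
      refine (Finset.abs_sum_le_sum_abs _ _).trans (Finset.sum_le_sum fun j _ => ?_)
      rw [abs_mul]
      gcongr
      exact ha j
    have h3 : |-α * ((∫ s in (0 : ℝ)..R, E s) - 0)|
        ≤ -α * K * (R ^ (α + m + N) / (α + m + N)) := by
      rw [sub_zero, abs_mul, abs_of_pos (neg_pos.2 hα), mul_assoc]
      exact mul_le_mul_of_nonneg_left (hEI R hR.le le_rfl) (neg_pos.2 hα).le
    rw [sub_zero (_ + _)]
    exact (abs_add_three _ _ _).trans (add_le_add (add_le_add h1 h2) h3)
  · have hq0 : Tendsto (fun ε : ℝ => ε ^ (α + m + N)) (𝓝[>] 0) (𝓝 0) := by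
      have := (Real.continuousAt_rpow_const 0 (α + m + N) (Or.inr hN.le)).tendsto
      rw [Real.zero_rpow hN.ne'] at this
      exact this.mono_left nhdsWithin_le_nhds
    have hev : ∀ᶠ ε in 𝓝[>] (0 : ℝ), 0 < ε ∧ ε < R := by
      filter_upwards [self_mem_nhdsWithin, nhdsWithin_le_nhds (Iio_mem_nhds hR)] with ε h0 h1
      exact ⟨h0, h1⟩
    have t1 : Tendsto (fun ε => ∫ s in (0 : ℝ)..ε, E s) (𝓝[>] 0) (𝓝 0) := by
      refine squeeze_zero_norm' (a := fun ε => K * (ε ^ (α + m + N) / (α + m + N))) ?_ ?_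
      · filter_upwards [hev] with ε hε
        exact hEI ε hε.1.le hε.2.le
      · simpa using (hq0.div_const (α + m + N)).const_mul K
    have t2 : Tendsto (fun ε => ε ^ α * (B ε - P ε)) (𝓝[>] 0) (𝓝 0) := by
      refine squeeze_zero_norm' (a := fun ε => K * ε ^ (α + m + N)) ?_ ?_
      · filter_upwards [hev] with ε hε
        rw [norm_mul, Real.norm_of_nonneg (Real.rpow_nonneg hε.1.le _)]
        calc _ ≤ ε ^ α * (K * ε ^ (m + N)) := by
              have := Real.rpow_nonneg hε.1.le α
              gcongr
              exact hb ε hε.1 hε.2.le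
          _ = K * (ε ^ α * ε ^ ((m + N : ℕ) : ℝ)) := by rw [Real.rpow_natCast]; ring
          _ = _ := by
            rw [← Real.rpow_add hε.1]
            congr 2
            push_cast
            ring
      · simpa using hq0.const_mul K
    refine Tendsto.congr' ?_ ((((tendsto_const_nhds (x := ∫ s in (0 : ℝ)..R, E s)).sub
      t1).const_mul (-α)).const_add
        (R ^ α * B R + ∑ j ∈ Finset.range N, a j * κ (α + m + j)) |>.sub t2)
    filter_upwards [hev] with ε hε
    exact (hF ε hε.1 hε.2).symm

end LayerCake


/-! ### The area formula for expanding `C^1` maps -/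

section AreaFormula

variable {m n : ℕ}

/-- The map sending g a to f a is K-Lipschitz on the image of g. With a common parameter set the
estimate can be used in both directions between a map and its linearization. -/
theorem euclideanHausdorffMeasure_image_le_of_edist_le {X Y Z : Type*} [EMetricSpace X]
    [MeasurableSpace X] [BorelSpace X] [EMetricSpace Y] [MeasurableSpace Y] [BorelSpace Y]
    {f : Z → X} {g : Z → Y} {A : Set Z} {K : NNReal} (d : ℕ)
    (h : ∀ a ∈ A, ∀ b ∈ A, edist (f a) (f b) ≤ K * edist (g a) (g b)) :
    (μHE[d] : Measure X) (f '' A) ≤ (K : ENNReal) ^ d * (μHE[d] : Measure Y) (g '' A) := by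
  classical
  rcases A.eq_empty_or_nonempty with rfl | ⟨a₀, ha₀⟩
  · simp
  have : Nonempty Z := ⟨a₀⟩
  set F : Y → X := fun y => f (Function.invFunOn g A y)
  have hinv : ∀ a ∈ A, Function.invFunOn g A (g a) ∈ A ∧ g (Function.invFunOn g A (g a)) = g a :=
    fun a ha => ⟨Function.invFunOn_mem ⟨a, ha, rfl⟩, Function.invFunOn_eq ⟨a, ha, rfl⟩⟩
  have hF : LipschitzOnWith K F (g '' A) := by
    rintro _ ⟨a, ha, rfl⟩ _ ⟨b, hb, rfl⟩
    have := h _ (hinv a ha).1 _ (hinv b hb).1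
    rwa [(hinv a ha).2, (hinv b hb).2] at this
  have himg : F '' (g '' A) = f '' A := by
    rw [Set.image_image]
    refine Set.image_congr fun a ha => ?_
    have := h _ (hinv a ha).1 _ ha
    rw [(hinv a ha).2, edist_self, mul_zero, nonpos_iff_eq_zero, edist_eq_zero] at this
    exact this
  have := hF.hausdorffMeasure_image_le (d := (d : ℝ)) (Nat.cast_nonneg d)
  rw [himg, ENNReal.rpow_natCast] at this
  simp only [Measure.euclideanHausdorffMeasure_def, Measure.smul_apply]
  calc _ ≤ _ • ((K : ENNReal) ^ d * μH[(d : ℝ)] (g '' A)) := by gcongr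
    _ = _ := by rw [mul_smul_comm]

/-- The `m`-dimensional Jacobian of a linear map. -/
def jacobian (L : Euc m →L[ℝ] Euc n) : ℝ :=
  Real.sqrt (Matrix.gram ℝ fun i => L (EuclideanSpace.basisFun (Fin m) ℝ i)).det

theorem normDet_eq_jacobian (L : Euc m →L[ℝ] Euc n) : L.toLinearMap.normDet = jacobian L := by
  have := L.toLinearMap.normDet_sq_eq_det_gram (EuclideanSpace.basisFun (Fin m) ℝ)
  rw [jacobian, ← Real.sqrt_sq L.toLinearMap.normDet_nonneg]
  congr 1

theorem continuous_jacobian : Continuous (jacobian : (Euc m →L[ℝ] Euc n) → ℝ) := by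
  unfold jacobian
  refine Real.continuous_sqrt.comp (Continuous.matrix_det ?_)
  refine continuous_matrix fun i j => ?_
  simp only [Matrix.gram_apply]
  fun_prop

theorem jacobian_pos {L : Euc m →L[ℝ] Euc n} (hL : Function.Injective L) : 0 < jacobian L := by
  rw [← normDet_eq_jacobian]
  refine lt_of_le_of_ne (LinearMap.normDet_nonneg _) (Ne.symm ?_)
  exact (L.toLinearMap.normDet_ne_zero_tfae.out 0 4).2 hL

theorem euclideanHausdorffMeasure_linear_image (L : Euc m →L[ℝ] Euc n) (A : Set (Euc m)) :
    (μHE[m] : Measure (Euc n)) (L '' A) = ENNReal.ofReal (jacobian L) * volume A := by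
  have := L.toLinearMap.euclideanHausdorffMeasure_image_eq_normDet_mul_volume A
  rw [finrank_euclideanSpace_fin, normDet_eq_jacobian] at this
  exact this

theorem norm_le_norm_fderiv_of_expanding {φ : Euc m → Euc n} {O : Set (Euc m)} (hO : IsOpen O)
    (hexp : ∀ u ∈ O, ∀ v ∈ O, ‖u - v‖ ≤ ‖φ u - φ v‖) {u : Euc m} (hu : u ∈ O)
    (hd : DifferentiableAt ℝ φ u) (v : Euc m) : ‖v‖ ≤ ‖fderiv ℝ φ u v‖ := by
  have h1 := ((hd.hasFDerivAt.hasLineDerivAt v).tendsto_slope_zero_right).norm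
  refine ge_of_tendsto h1 ?_
  have h2 : ∀ᶠ t : ℝ in 𝓝[>] 0, u + t • v ∈ O := by
    have : Tendsto (fun t : ℝ => u + t • v) (𝓝[>] 0) (𝓝 u) := by
      have hc : Continuous (fun t : ℝ => u + t • v) := by fun_prop
      simpa using (hc.tendsto 0).mono_left nhdsWithin_le_nhds
    exact this.eventually (hO.mem_nhds hu)
  filter_upwards [h2, self_mem_nhdsWithin] with t ht ht0
  have ht0' : (0 : ℝ) < t := ht0
  have h3 := hexp _ ht u hu
  rw [add_sub_cancel_left, norm_smul, Real.norm_of_nonneg ht0'.le] at h3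
  rw [norm_smul, norm_inv, Real.norm_of_nonneg ht0'.le, ← div_eq_inv_mul, le_div_iff₀ ht0']
  linarith

/-- Near each point the volume of images under an expanding `C^1` map is given by the Jacobian up
to a factor close to `1`. -/
theorem exists_nhds_image_measure_le {φ : Euc m → Euc n} {O : Set (Euc m)} (hO : IsOpen O)
    (hφ : ContDiffOn ℝ 1 φ O) (hexp : ∀ u ∈ O, ∀ v ∈ O, ‖u - v‖ ≤ ‖φ u - φ v‖)
    {u : Euc m} (hu : u ∈ O) {κ : NNReal} (hκ : 1 < κ) :
    ∃ V ∈ 𝓝 u, ∀ A ⊆ V, MeasurableSet A →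
      (μHE[m] : Measure (Euc n)) (φ '' A)
          ≤ (κ : ENNReal) ^ (m + 1) * ∫⁻ a in A, ENNReal.ofReal (jacobian (fderiv ℝ φ a)) ∧
        ∫⁻ a in A, ENNReal.ofReal (jacobian (fderiv ℝ φ a))
          ≤ (κ : ENNReal) ^ (m + 1) * (μHE[m] : Measure (Euc n)) (φ '' A) := by
  have hcd : ContDiffAt ℝ 1 φ u := hφ.contDiffAt (hO.mem_nhds hu)
  have hL : ∀ v, ‖v‖ ≤ ‖fderiv ℝ φ u v‖ :=
    norm_le_norm_fderiv_of_expanding hO hexp hu (hcd.differentiableAt one_ne_zero)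
  have hκ1 : (1 : ℝ) < κ := by exact_mod_cast hκ
  have hκ0 : (0 : ℝ) < κ := one_pos.trans hκ1
  have hκ0' : κ ≠ 0 := (one_pos.trans hκ).ne'
  -- With this η one has 1 - η = κ⁻¹ and 1 + η ≤ κ, so both relative errors of the linearization are
  -- absorbed by the factor κ.
  set η : ℝ := 1 - (κ : ℝ)⁻¹ with hη
  have hη0 : 0 < η := sub_pos.2 (inv_lt_one_of_one_lt₀ hκ1)
  have hηκ : 1 + η ≤ κ := by
    rw [hη]
    have : (κ : ℝ) * (κ : ℝ)⁻¹ = 1 := mul_inv_cancel₀ hκ0.ne'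
    nlinarith [sq_nonneg ((κ : ℝ) - 1), inv_pos.2 hκ0]
  have hJpos : 0 < jacobian (fderiv ℝ φ u) := by
    refine jacobian_pos ((injective_iff_map_eq_zero _).2 fun v hv => ?_)
    have := hL v
    rw [hv, norm_zero] at this
    exact norm_le_zero_iff.1 this
  have hstrict := (hcd.hasStrictFDerivAt one_ne_zero).isLittleO.bound hη0
  rw [nhds_prod_eq] at hstrict
  obtain ⟨V₁, hV₁, hV₁'⟩ := eventually_prod_self_iff'.1 hstrict
  have hJc : ContinuousAt (fun a => jacobian (fderiv ℝ φ a)) u :=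
    continuous_jacobian.continuousAt.comp
      (hcd.fderiv_right (m := 0) (by norm_num)).continuousAt
  have hV₂ : ∀ᶠ a in 𝓝 u, jacobian (fderiv ℝ φ a) < κ * jacobian (fderiv ℝ φ u) ∧
      (κ : ℝ)⁻¹ * jacobian (fderiv ℝ φ u) < jacobian (fderiv ℝ φ a) := by
    refine (hJc.eventually (gt_mem_nhds ?_)).and (hJc.eventually (lt_mem_nhds ?_))
    · nlinarith
    · exact mul_lt_of_lt_one_left hJpos (inv_lt_one_of_one_lt₀ hκ1)
  refine ⟨_, inter_mem hV₁ hV₂, fun A hA hAm => ?_⟩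
  have hfar : ∀ a ∈ A, ∀ b ∈ A,
      ‖φ a - φ b‖ ≤ κ * ‖fderiv ℝ φ u a - fderiv ℝ φ u b‖ ∧
      ‖fderiv ℝ φ u a - fderiv ℝ φ u b‖ ≤ κ * ‖φ a - φ b‖ := by
    intro a ha b hb
    have h1 := hV₁' a (hA ha).1 b (hA hb).1
    simp only at h1
    rw [← map_sub]
    have h2 := hL (a - b)
    have h3 : ‖φ a - φ b - fderiv ℝ φ u (a - b)‖ ≤ η * ‖fderiv ℝ φ u (a - b)‖ :=
      h1.trans (by gcongr)
    have h4 := norm_sub_norm_le (φ a - φ b) (fderiv ℝ φ u (a - b))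
    have h5 := norm_sub_norm_le (fderiv ℝ φ u (a - b)) (φ a - φ b)
    rw [norm_sub_rev (fderiv ℝ φ u (a - b)) (φ a - φ b)] at h5
    have h6 : (κ : ℝ)⁻¹ * ‖fderiv ℝ φ u (a - b)‖ ≤ ‖φ a - φ b‖ := by
      have : (κ : ℝ)⁻¹ = 1 - η := by rw [hη]; ring
      rw [this]
      linarith
    refine ⟨?_, ?_⟩
    · nlinarith [norm_nonneg (fderiv ℝ φ u (a - b))]
    · rwa [inv_mul_le_iff₀ hκ0] at h6
  have hedist : ∀ a ∈ A, ∀ b ∈ A,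
      edist (φ a) (φ b) ≤ κ * edist (fderiv ℝ φ u a) (fderiv ℝ φ u b) ∧
      edist (fderiv ℝ φ u a) (fderiv ℝ φ u b) ≤ κ * edist (φ a) (φ b) := by
    intro a ha b hb
    have := hfar a ha b hb
    simp only [edist_nndist, ← ENNReal.coe_mul, ENNReal.coe_le_coe, ← NNReal.coe_le_coe,
      NNReal.coe_mul, coe_nndist, dist_eq_norm]
    exact this
  have hm1 := euclideanHausdorffMeasure_image_le_of_edist_le (A := A) m
    fun a ha b hb => (hedist a ha b hb).1
  have hm2 := euclideanHausdorffMeasure_image_le_of_edist_le (A := A) m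
    fun a ha b hb => (hedist a ha b hb).2
  rw [euclideanHausdorffMeasure_linear_image] at hm1 hm2
  have hJ1 : ENNReal.ofReal (jacobian (fderiv ℝ φ u)) * volume A
      ≤ κ * ∫⁻ a in A, ENNReal.ofReal (jacobian (fderiv ℝ φ a)) := by
    rw [← setLIntegral_const, ← lintegral_const_mul' _ _ ENNReal.coe_ne_top]
    refine setLIntegral_mono' hAm fun a ha => ?_
    rw [← ENNReal.ofReal_coe_nnreal, ← ENNReal.ofReal_mul hκ0.le]
    refine ENNReal.ofReal_le_ofReal ?_
    have := (hA ha).2.2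
    rw [inv_mul_lt_iff₀ hκ0] at this
    exact this.le
  have hJ2 : ∫⁻ a in A, ENNReal.ofReal (jacobian (fderiv ℝ φ a))
      ≤ κ * (ENNReal.ofReal (jacobian (fderiv ℝ φ u)) * volume A) := by
    rw [← setLIntegral_const, ← lintegral_const_mul' _ _ ENNReal.coe_ne_top]
    refine setLIntegral_mono' hAm fun a ha => ?_
    rw [← ENNReal.ofReal_coe_nnreal, ← ENNReal.ofReal_mul hκ0.le]
    exact ENNReal.ofReal_le_ofReal (hA ha).2.1.le
  constructor
  · calc _ ≤ _ := hm1
      _ ≤ (κ : ENNReal) ^ m * _ := mul_le_mul_right hJ1 _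
      _ = _ := by rw [pow_succ, mul_assoc]
  · calc _ ≤ _ := hJ2
      _ ≤ (κ : ENNReal) * _ := mul_le_mul_right hm2 _
      _ = _ := by rw [pow_succ]; ring

/-- For each κ > 1, countably many neighbourhoods from `exists_nhds_image_measure_le` cover A. Made
disjoint, they have disjoint images by injectivity, so the two-sided estimate sums to all of A with
the same factor; then κ tends to 1. -/
theorem euclideanHausdorffMeasure_image_eq_lintegral {φ : Euc m → Euc n} {O : Set (Euc m)}
    (hO : IsOpen O) (hφ : ContDiffOn ℝ 1 φ O)
    (hexp : ∀ u ∈ O, ∀ v ∈ O, ‖u - v‖ ≤ ‖φ u - φ v‖) {A : Set (Euc m)} (hA : A ⊆ O)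
    (hAm : MeasurableSet A) :
    (μHE[m] : Measure (Euc n)) (φ '' A)
      = ∫⁻ a in A, ENNReal.ofReal (jacobian (fderiv ℝ φ a)) := by
  have hinj : Set.InjOn φ O := fun u hu v hv h => by
    have := hexp u hu v hv
    rw [h, sub_self, norm_zero] at this
    exact sub_eq_zero.1 (norm_le_zero_iff.1 this)
  have key : ∀ κ : NNReal, 1 < κ →
      (μHE[m] : Measure (Euc n)) (φ '' A)
          ≤ (κ : ENNReal) ^ (m + 1) * ∫⁻ a in A, ENNReal.ofReal (jacobian (fderiv ℝ φ a)) ∧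
        ∫⁻ a in A, ENNReal.ofReal (jacobian (fderiv ℝ φ a))
          ≤ (κ : ENNReal) ^ (m + 1) * (μHE[m] : Measure (Euc n)) (φ '' A) := by
    intro κ hκ
    choose! V hV hVA using fun u (hu : u ∈ A) =>
      exists_nhds_image_measure_le hO hφ hexp (hA hu) hκ
    obtain ⟨t, htA, htc, hcov⟩ :=
      TopologicalSpace.countable_cover_nhdsWithin fun u hu =>
        mem_nhdsWithin_of_mem_nhds (t := A) (interior_mem_nhds.2 (hV u hu))
    rcases A.eq_empty_or_nonempty with rfl | hne
    · simp
    have htne : t.Nonempty := by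
      obtain ⟨a, ha⟩ := hne
      obtain ⟨i, hi, -⟩ := Set.mem_iUnion₂.1 (hcov ha)
      exact ⟨i, hi⟩
    obtain ⟨w, hw⟩ := htc.exists_eq_range htne
    set D : ℕ → Set (Euc m) := fun i => A ∩ disjointed (fun j => interior (V (w j))) i with hD
    have hDm : ∀ i, MeasurableSet (D i) := fun i =>
      hAm.inter (MeasurableSet.disjointed (fun j => isOpen_interior.measurableSet) i)
    have hDd : Pairwise fun i j => Disjoint (D i) (D j) := fun i j hij =>
      (disjoint_disjointed _ hij).mono Set.inter_subset_right Set.inter_subset_right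
    have hDU : ⋃ i, D i = A := by
      rw [hD, ← Set.inter_iUnion, iUnion_disjointed, Set.inter_eq_left]
      intro a ha
      obtain ⟨i, hi, hai⟩ := Set.mem_iUnion₂.1 (hcov ha)
      rw [hw] at hi
      obtain ⟨j, rfl⟩ := hi
      exact Set.mem_iUnion.2 ⟨j, hai⟩
    have hwA : ∀ i, w i ∈ A := fun i => htA (hw ▸ Set.mem_range_self i)
    have hDV : ∀ i, D i ⊆ V (w i) := fun i =>
      Set.inter_subset_right.trans ((disjointed_subset _ i).trans interior_subset)
    have hDO : ∀ i, D i ⊆ O := fun i => Set.inter_subset_left.trans hA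
    have hsum1 : (μHE[m] : Measure (Euc n)) (φ '' A)
        = ∑' i, (μHE[m] : Measure (Euc n)) (φ '' D i) := by
      rw [← hDU, Set.image_iUnion]
      refine measure_iUnion (fun i j hij => ?_) fun i => ?_
      · rw [Function.onFun, Set.disjoint_iff_inter_eq_empty, ← hinj.image_inter (hDO i) (hDO j),
          (hDd hij).inter_eq, Set.image_empty]
      · exact (hDm i).image_of_continuousOn_injOn (hφ.continuousOn.mono (hDO i))
          (hinj.mono (hDO i))
    have hsum2 : ∫⁻ a in A, ENNReal.ofReal (jacobian (fderiv ℝ φ a))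
        = ∑' i, ∫⁻ a in D i, ENNReal.ofReal (jacobian (fderiv ℝ φ a)) := by
      conv_lhs => rw [← hDU]
      exact lintegral_iUnion hDm hDd _
    rw [hsum1, hsum2, ← ENNReal.tsum_mul_left, ← ENNReal.tsum_mul_left]
    exact ⟨ENNReal.tsum_le_tsum fun i => (hVA _ (hwA i) _ (hDV i) (hDm i)).1,
      ENNReal.tsum_le_tsum fun i => (hVA _ (hwA i) _ (hDV i) (hDm i)).2⟩
  have hlim : Tendsto (fun κ : NNReal => (κ : ENNReal) ^ (m + 1)) (𝓝[>] 1) (𝓝 1) := by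
    have : Continuous (fun κ : NNReal => (κ : ENNReal) ^ (m + 1)) :=
      (ENNReal.continuous_pow _).comp ENNReal.continuous_coe
    simpa using (this.tendsto 1).mono_left nhdsWithin_le_nhds
  have hlim' : ∀ c : ENNReal,
      Tendsto (fun κ : NNReal => (κ : ENNReal) ^ (m + 1) * c) (𝓝[>] 1) (𝓝 c) := fun c => by
    simpa using ENNReal.Tendsto.mul_const hlim (Or.inl one_ne_zero) (b := c)
  refine le_antisymm (ge_of_tendsto (hlim' _) ?_) (ge_of_tendsto (hlim' _) ?_)
  · filter_upwards [self_mem_nhdsWithin] with κ hκ using (key κ hκ).1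
  · filter_upwards [self_mem_nhdsWithin] with κ hκ using (key κ hκ).2

end AreaFormula


/-! ### Expansions along rays -/

section Rays

variable {I : Type*} {N : ℕ}

/-- The mean value theorem is applied to f minus the antiderivative of the polynomial of f'. The
remaining derivative is O(t^N), and the factor t from the increment gives the extra order. -/
theorem HasUniformExpansion.of_hasDerivAt {f f' : I → ℝ → ℝ} (h : HasUniformExpansion N f')
    {R A : ℝ} (hR : 0 < R) (hf : ∀ i t, 0 ≤ t → t < R → HasDerivAt (f i) (f' i t) t)
    (h0 : ∀ i, |f i 0| ≤ A) : HasUniformExpansion (N + 1) f := by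
  obtain ⟨c, K, R', h⟩ := h
  obtain ⟨hR', hc, hb⟩ := HasUniformExpansion.nonneg_bound h
  have hK : 0 ≤ max K 0 := le_max_right _ _
  refine ⟨fun i j => if j = 0 then f i 0 else c i (j - 1) / j, max (max K 0) A, min R R',
    lt_min hR hR', fun i j => ?_, fun i t ht0 ht => ?_⟩
  · dsimp only
    split_ifs with hj
    · exact (h0 i).trans (le_max_right _ _)
    · rw [abs_div]
      have : (1 : ℝ) ≤ |(j : ℝ)| := by
        rw [Nat.abs_cast]
        exact_mod_cast Nat.one_le_iff_ne_zero.2 hj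
      exact (div_le_self (abs_nonneg _) this).trans ((hc _ _).trans (le_max_left _ _))
  · have htR : t < R := ht.trans_le (min_le_left _ _)
    have htR' : t < R' := ht.trans_le (min_le_right _ _)
    set g : ℝ → ℝ := fun s => f i s - ∑ j ∈ Finset.range N, c i j / (j + 1) * s ^ (j + 1) with hg
    have hgd : ∀ s, 0 ≤ s → s < R → HasDerivAt g
        (f' i s - ∑ j ∈ Finset.range N, c i j * s ^ j) s := by
      intro s hs hsR
      have h1 := hf i s hs hsR
      have h2 : HasDerivAt (fun s : ℝ => ∑ j ∈ Finset.range N, c i j / (j + 1) * s ^ (j + 1))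
          (∑ j ∈ Finset.range N, c i j * s ^ j) s := by
        refine HasDerivAt.fun_sum fun j _ => ?_
        have h3 := (hasDerivAt_pow (j + 1) s).const_mul (c i j / (j + 1))
        refine h3.congr_deriv ?_
        push_cast
        have : (j : ℝ) + 1 ≠ 0 := by positivity
        field_simp
      exact h1.sub h2
    obtain ⟨ξ, hξ, hslope⟩ := exists_hasDerivAt_eq_slope g _ ht0
      (fun s hs => (hgd s hs.1 (hs.2.trans_lt htR)).continuousAt.continuousWithinAt)
      fun s hs => hgd s hs.1.le (hs.2.trans htR)
    have h1 := hb i ξ hξ.1 (hξ.2.trans htR')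
    rw [hslope, sub_zero, abs_div, abs_of_pos ht0, div_le_iff₀ ht0] at h1
    have h2 : f i t - ∑ j ∈ Finset.range (N + 1),
        (if j = 0 then f i 0 else c i (j - 1) / j) * t ^ j = g t - g 0 := by
      rw [Finset.sum_range_succ']
      simp [hg]
      ring
    rw [h2]
    calc _ ≤ _ := h1
      _ ≤ max K 0 * t ^ N * t := by
        have := hξ.1.le
        have := hξ.2.le
        gcongr
      _ = max K 0 * t ^ (N + 1) := by ring
      _ ≤ _ := mul_le_mul_of_nonneg_right (le_max_left _ _) (by positivity)

/-- Taylor's theorem with uniform constants: the top derivative is bounded, and each integration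
step adds one order. -/
theorem HasUniformExpansion.of_hasDerivAt_chain {F : ℕ → I → ℝ → ℝ} {R K : ℝ} (hR : 0 < R)
    (hd : ∀ j < N, ∀ i t, 0 ≤ t → t < R → HasDerivAt (F j i) (F (j + 1) i t) t)
    (hb : ∀ j ≤ N, ∀ i t, 0 ≤ t → t < R → |F j i t| ≤ K) : HasUniformExpansion N (F 0) := by
  induction N generalizing F with
  | zero => exact .of_bound (K := K) hR fun i t h0 ht => by simpa using hb 0 le_rfl i t h0.le ht
  | succ N ih =>
    have h1 : HasUniformExpansion N (F 1) :=
      ih (F := fun j => F (j + 1)) (fun j hj => hd (j + 1) (by omega))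
        fun j hj => hb (j + 1) (by omega)
    exact h1.of_hasDerivAt hR (fun i t h0 ht => hd 0 (by omega) i t h0 ht)
      fun i => hb 0 (by omega) i 0 le_rfl hR

variable {m : ℕ} {E : Type*} [NormedAddCommGroup E] [NormedSpace ℝ E]

/-- The j-th derivative of t ↦ ℓ(a(tθ)) is ℓ applied to the j-th derivative of a at tθ, evaluated at
(θ, …, θ). Its bound is independent of the unit vector θ and of the index. -/
theorem hasUniformExpansion_ray {a : I → Euc m → E} {r K : ℝ} (hr : 0 < r)
    (ha : ∀ i, ContDiffOn ℝ N (a i) (ball 0 r))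
    (hb : ∀ i, ∀ j ≤ N, ∀ u ∈ ball 0 r, ‖iteratedFDeriv ℝ j (a i) u‖ ≤ K) (ℓ : E →L[ℝ] ℝ) :
    HasUniformExpansion N
      (fun (p : I × sphere (0 : Euc m) 1) t => ℓ (a p.1 (t • (p.2 : Euc m)))) := by
  have hmem : ∀ (θ : sphere (0 : Euc m) 1) t, 0 ≤ t → t < r → t • (θ : Euc m) ∈ ball 0 r := by
    intro θ t h0 ht
    rw [mem_ball_zero_iff, norm_smul, Real.norm_of_nonneg h0, norm_eq_of_mem_sphere, mul_one]
    exact ht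
  have := HasUniformExpansion.of_hasDerivAt_chain (N := N) (R := r) (K := ‖ℓ‖ * |K|)
    (F := fun j (p : I × sphere (0 : Euc m) 1) t =>
      ℓ (iteratedFDeriv ℝ j (a p.1) (t • (p.2 : Euc m)) fun _ => (p.2 : Euc m))) hr ?_ ?_
  · simpa only [iteratedFDeriv_zero_apply] using this
  · rintro j hj ⟨i, θ⟩ t h0 ht
    have hu := hmem θ t h0 ht
    have h1 : HasFDerivAt (iteratedFDeriv ℝ j (a i)) _ (t • (θ : Euc m)) :=
      (((ha i).contDiffAt (isOpen_ball.mem_nhds hu)).differentiableAt_iteratedFDeriv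
        (by exact_mod_cast hj)).hasFDerivAt
    have h2 : HasDerivAt (fun t : ℝ => t • (θ : Euc m)) (θ : Euc m) t := by
      simpa using (hasDerivAt_id t).smul_const (θ : Euc m)
    have h3 := h1.comp_hasDerivAt t h2
    have h4 := ((ContinuousMultilinearMap.apply ℝ (fun _ : Fin j => Euc m) E
      fun _ => (θ : Euc m)).hasFDerivAt.comp_hasDerivAt t h3)
    have h5 := ℓ.hasFDerivAt.comp_hasDerivAt t h4
    refine h5.congr_deriv ?_
    rw [iteratedFDeriv_succ_apply_left]
    rfl
  · rintro j hj ⟨i, θ⟩ t h0 ht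
    have hu := hmem θ t h0 ht
    refine (ℓ.le_opNorm _).trans ?_
    gcongr
    refine (ContinuousMultilinearMap.le_opNorm _ _).trans ?_
    simp only [norm_eq_of_mem_sphere, Finset.prod_const_one, mul_one]
    exact (hb i j hj _ hu).trans (le_abs_self K)

end Rays


/-! ### Graphs with bounded derivatives -/

/-- A `C^k` graph `u ↦ L u + h u` over the ball of radius `r` in an `m`-plane of `ℝⁿ`, tangent to
the plane at the origin, with derivatives of `h` bounded by `K` and small slope. -/
structure GraphDatum (m n k : ℕ) (r K : ℝ) where
  /-- The isometric parametrization of the plane. -/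
  L : Euc m →ₗᵢ[ℝ] Euc n
  /-- The height function. -/
  h : Euc m → Euc n
  contDiffOn : ContDiffOn ℝ k h (ball 0 r)
  h_zero : h 0 = 0
  fderiv_zero : fderiv ℝ h 0 = 0
  inner_eq_zero : ∀ u ∈ ball 0 r, ∀ v, inner ℝ (L v) (h u) = 0
  norm_iteratedFDeriv_le : ∀ j ≤ k, ∀ u ∈ ball 0 r, ‖iteratedFDeriv ℝ j h u‖ ≤ K
  norm_fderiv_le : ∀ u ∈ ball 0 r, ‖fderiv ℝ h u‖ ≤ 1 / 2

namespace GraphDatum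

variable {m n k : ℕ} {r K : ℝ} (d : GraphDatum m n k r K)

/-- The parametrization of the graph. -/
def map (u : Euc m) : Euc n := d.L u + d.h u

theorem map_zero : d.map 0 = 0 := by simp [map, d.h_zero]

theorem norm_h_sub_le (hk : 1 ≤ k) {u v : Euc m} (hu : u ∈ ball 0 r) (hv : v ∈ ball 0 r) :
    ‖d.h u - d.h v‖ ≤ 1 / 2 * ‖u - v‖ := by
  refine (convex_ball (0 : Euc m) r).norm_image_sub_le_of_norm_fderiv_le (𝕜 := ℝ)
    (fun w hw => ?_) (fun w hw => d.norm_fderiv_le w hw) hv hu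
  exact (d.contDiffOn.contDiffAt (isOpen_ball.mem_nhds hw)).differentiableAt
    (by exact_mod_cast (by omega : k ≠ 0))

theorem norm_h_le (hr : 0 < r) (hk : 1 ≤ k) {u : Euc m} (hu : u ∈ ball 0 r) :
    ‖d.h u‖ ≤ 1 / 2 * ‖u‖ := by
  simpa [d.h_zero] using d.norm_h_sub_le hk hu (mem_ball_self hr)

/-- The heights are orthogonal to the plane, so projecting to the plane recovers u - v, and a
projection does not increase length. This supplies the expansion hypothesis of the area formula. -/
theorem norm_sub_le_norm_map_sub {u v : Euc m} (hu : u ∈ ball 0 r) (hv : v ∈ ball 0 r) :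
    ‖u - v‖ ≤ ‖d.map u - d.map v‖ := by
  have h1 : inner ℝ (d.L (u - v)) (d.map u - d.map v) = ‖u - v‖ ^ 2 := by
    have : d.map u - d.map v = d.L (u - v) + (d.h u - d.h v) := by
      simp only [map, map_sub]
      abel
    rw [this, inner_add_right, inner_sub_right, d.inner_eq_zero u hu, d.inner_eq_zero v hv,
      real_inner_self_eq_norm_sq, d.L.norm_map]
    ring
  have h2 := real_inner_le_norm (d.L (u - v)) (d.map u - d.map v)
  rw [h1, d.L.norm_map] at h2
  by_cases h0 : ‖u - v‖ = 0
  · rw [h0]; exact norm_nonneg _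
  · have h3 : 0 < ‖u - v‖ := lt_of_le_of_ne (norm_nonneg _) (Ne.symm h0)
    nlinarith

theorem norm_map_sub_le (hk : 1 ≤ k) {u v : Euc m} (hu : u ∈ ball 0 r) (hv : v ∈ ball 0 r) :
    ‖d.map u - d.map v‖ ≤ 3 / 2 * ‖u - v‖ := by
  have : d.map u - d.map v = d.L (u - v) + (d.h u - d.h v) := by
    simp only [map, map_sub]
    abel
  rw [this]
  refine (norm_add_le _ _).trans ?_
  rw [d.L.norm_map]
  linarith [d.norm_h_sub_le hk hu hv]

theorem norm_map_sq {u : Euc m} (hu : u ∈ ball 0 r) :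
    ‖d.map u‖ ^ 2 = ‖u‖ ^ 2 + ‖d.h u‖ ^ 2 := by
  have := norm_add_sq_real (d.L u) (d.h u)
  rw [d.inner_eq_zero u hu, d.L.norm_map] at this
  rw [map, this]
  ring

theorem norm_le_norm_map (hr : 0 < r) {u : Euc m} (hu : u ∈ ball 0 r) : ‖u‖ ≤ ‖d.map u‖ := by
  simpa [d.map_zero] using d.norm_sub_le_norm_map_sub hu (mem_ball_self hr)

theorem norm_map_le (hr : 0 < r) (hk : 1 ≤ k) {u : Euc m} (hu : u ∈ ball 0 r) :
    ‖d.map u‖ ≤ 3 / 2 * ‖u‖ := by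
  simpa [d.map_zero] using d.norm_map_sub_le hk hu (mem_ball_self hr)

theorem contDiffOn_map : ContDiffOn ℝ k d.map (ball 0 r) :=
  d.L.contDiff.contDiffOn.add d.contDiffOn

theorem differentiableAt_h (hk : 1 ≤ k) {u : Euc m} (hu : u ∈ ball 0 r) :
    DifferentiableAt ℝ d.h u :=
  (d.contDiffOn.contDiffAt (isOpen_ball.mem_nhds hu)).differentiableAt
    (by exact_mod_cast (by omega : k ≠ 0))

theorem fderiv_map (hk : 1 ≤ k) {u : Euc m} (hu : u ∈ ball 0 r) :
    fderiv ℝ d.map u = d.L.toContinuousLinearMap + fderiv ℝ d.h u :=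
  (d.L.toContinuousLinearMap.hasFDerivAt.add (d.differentiableAt_h hk hu).hasFDerivAt).fderiv

theorem smul_mem_ball (θ : sphere (0 : Euc m) 1) {t : ℝ} (h0 : 0 ≤ t) (ht : t < r) :
    t • (θ : Euc m) ∈ ball (0 : Euc m) r := by
  rw [mem_ball_zero_iff, norm_smul, Real.norm_of_nonneg h0, norm_eq_of_mem_sphere, mul_one]
  exact ht

theorem norm_smul_sphere (θ : sphere (0 : Euc m) 1) {t : ℝ} (h0 : 0 ≤ t) :
    ‖t • (θ : Euc m)‖ = t := by
  rw [norm_smul, Real.norm_of_nonneg h0, norm_eq_of_mem_sphere, mul_one]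

/-! #### Expansions of the height and of the Jacobian along rays -/

section Expansions

variable {N : ℕ}

/-- The square of the slope of the secant of the graph in direction `θ`. -/
def secantSq (p : GraphDatum m n k r K × sphere (0 : Euc m) 1) (t : ℝ) : ℝ :=
  ‖p.1.h (t • (p.2 : Euc m))‖ ^ 2 / t ^ 2

theorem tendsto_h_div (hr : 0 < r) (hk : 1 ≤ k) (θ : sphere (0 : Euc m) 1) (l : Fin n) :
    Tendsto (fun t : ℝ => d.h (t • (θ : Euc m)) l / t) (𝓝[>] 0) (𝓝 0) := by
  have h1 := ((d.differentiableAt_h hk (mem_ball_self hr)).hasFDerivAt.hasLineDerivAt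
    (θ : Euc m)).tendsto_slope_zero_right
  rw [d.fderiv_zero] at h1
  have h2 := ((EuclideanSpace.proj (𝕜 := ℝ) l).continuous.tendsto _).comp h1
  refine (h2.congr fun t => ?_).trans (by simp)
  simp [d.h_zero, div_eq_inv_mul]

theorem secantSq_eq (p : GraphDatum m n k r K × sphere (0 : Euc m) 1) (t : ℝ) :
    secantSq p t = ∑ l, (p.1.h (t • (p.2 : Euc m)) l / t) ^ 2 := by
  rw [secantSq, EuclideanSpace.real_norm_sq_eq, Finset.sum_div]
  simp only [div_pow]

theorem tendsto_secantSq (hr : 0 < r) (hk : 1 ≤ k)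
    (p : GraphDatum m n k r K × sphere (0 : Euc m) 1) :
    Tendsto (secantSq p) (𝓝[>] 0) (𝓝 0) := by
  have : Tendsto (fun t => ∑ l, (p.1.h (t • (p.2 : Euc m)) l / t) ^ 2) (𝓝[>] 0)
      (𝓝 (∑ _l : Fin n, (0 : ℝ) ^ 2)) :=
    tendsto_finsetSum _ fun l _ => (p.1.tendsto_h_div hr hk p.2 l).pow 2
  simp only [ne_eq, OfNat.ofNat_ne_zero, not_false_eq_true, zero_pow,
    Finset.sum_const_zero] at this
  exact this.congr fun t => (secantSq_eq p t).symm

/-- One order is lost because h is divided by t; the quotient still expands because h vanishes at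
the origin. -/
theorem hasUniformExpansion_secantSq (hr : 0 < r) (hk : N + 1 ≤ k) :
    HasUniformExpansion N (secantSq (m := m) (n := n) (k := k) (r := r) (K := K)) := by
  have h1 : ∀ l : Fin n, HasUniformExpansion (N + 1)
      (fun (p : GraphDatum m n k r K × sphere (0 : Euc m) 1) t => p.1.h (t • (p.2 : Euc m)) l) :=
    fun l => hasUniformExpansion_ray (a := fun d : GraphDatum m n k r K => d.h) (K := K) hr
      (fun d => d.contDiffOn.of_le (by exact_mod_cast hk))
      (fun d j hj => d.norm_iteratedFDeriv_le j (hj.trans hk)) (EuclideanSpace.proj (𝕜 := ℝ) l)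
  have h2 : HasUniformExpansion N
      (fun (p : GraphDatum m n k r K × sphere (0 : Euc m) 1) t =>
        ∑ l, (p.1.h (t • (p.2 : Euc m)) l / t) ^ 2) := by
    refine .sum fun l _ => (HasUniformExpansion.div_t (h1 l) fun p => ?_).pow 2
    have h3 := p.1.tendsto_h_div hr (by omega) p.2 l
    have h4 : Tendsto (fun t : ℝ => t) (𝓝[>] 0) (𝓝 0) :=
      tendsto_id.mono_left nhdsWithin_le_nhds
    have h5 := h3.mul h4
    rw [mul_zero] at h5
    refine h5.congr' ?_
    filter_upwards [self_mem_nhdsWithin] with t ht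
    exact div_mul_cancel₀ _ (ne_of_gt ht)
  exact h2.congr one_pos fun p t _ _ => (secantSq_eq p t).symm

theorem analyticAt_sqrt_one : AnalyticAt ℝ Real.sqrt 1 := by
  have h1 : AnalyticAt ℝ (fun y : ℝ => Real.exp (1 / 2 * Real.log y)) 1 :=
    (analyticAt_const.mul (analyticAt_log one_pos)).rexp
  refine h1.congr ?_
  filter_upwards [lt_mem_nhds one_pos] with y hy
  rw [Real.sqrt_eq_rpow, Real.rpow_def_of_pos hy, mul_comm]

/-- The ratio `‖u‖ / ‖map u‖` along the ray in direction `θ`. -/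
def cosSecant (p : GraphDatum m n k r K × sphere (0 : Euc m) 1) (t : ℝ) : ℝ :=
  (Real.sqrt (1 + secantSq p t))⁻¹

theorem hasUniformExpansion_cosSecant (hr : 0 < r) (hk : N + 2 ≤ k) :
    HasUniformExpansion (N + 1) (cosSecant (m := m) (n := n) (k := k) (r := r) (K := K)) := by
  have h1 := (HasUniformExpansion.const (N := N + 1)
    (I := GraphDatum m n k r K × sphere (0 : Euc m) 1) (a := fun _ => (1 : ℝ)) (A := 1)
    (by simp)).add (hasUniformExpansion_secantSq (K := K) (n := n) (m := m) hr hk)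
  have h2 : ∀ p : GraphDatum m n k r K × sphere (0 : Euc m) 1,
      Tendsto (fun t => 1 + secantSq p t) (𝓝[>] 0) (𝓝 1) := fun p => by
    simpa using (tendsto_secantSq hr (by omega) p).const_add 1
  exact h1.comp_analytic (G := fun y => (Real.sqrt y)⁻¹) h2 (analyticAt_sqrt_one.inv (by simp))

/-- The Jacobian of the parametrization along the ray in direction `θ`. -/
def jac (p : GraphDatum m n k r K × sphere (0 : Euc m) 1) (t : ℝ) : ℝ :=
  jacobian (fderiv ℝ p.1.map (t • (p.2 : Euc m)))

theorem continuousAt_fderiv_map (hk : 1 ≤ k) {u : Euc m} (hu : u ∈ ball 0 r) :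
    ContinuousAt (fderiv ℝ d.map) u :=
  ((d.contDiffOn_map.contDiffAt (isOpen_ball.mem_nhds hu)).fderiv_right (m := 0)
    (by rw [zero_add]; exact_mod_cast hk)).continuousAt

/-- The entries of the Gram matrix expand along rays because the first derivatives of h do. At the
origin the parametrization is isometric to first order, so the determinant tends to 1, where the
square root is analytic. -/
theorem hasUniformExpansion_jac (hr : 0 < r) (hk : N + 2 ≤ k) :
    HasUniformExpansion (N + 1) (jac (m := m) (n := n) (k := k) (r := r) (K := K)) := by
  set e : Fin m → Euc m := fun i => EuclideanSpace.basisFun (Fin m) ℝ i with he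
  set A : GraphDatum m n k r K × sphere (0 : Euc m) 1 → ℝ → Matrix (Fin m) (Fin m) ℝ :=
    fun p t => Matrix.gram ℝ fun i => fderiv ℝ p.1.map (t • (p.2 : Euc m)) (e i) with hA
  have h1 : ∀ (i : Fin m) (l : Fin n), HasUniformExpansion (N + 1)
      (fun (p : GraphDatum m n k r K × sphere (0 : Euc m) 1) t =>
        fderiv ℝ p.1.map (t • (p.2 : Euc m)) (e i) l) := by
    intro i l
    have h2 : HasUniformExpansion (N + 1)
        (fun (p : GraphDatum m n k r K × sphere (0 : Euc m) 1) t =>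
          fderiv ℝ p.1.h (t • (p.2 : Euc m)) (e i) l) :=
      hasUniformExpansion_ray (a := fun d : GraphDatum m n k r K => fderiv ℝ d.h) (K := K) hr
        (fun d => d.contDiffOn.fderiv_of_isOpen isOpen_ball (by exact_mod_cast hk))
        (fun d j hj u hu => by
          rw [norm_iteratedFDeriv_fderiv]
          exact d.norm_iteratedFDeriv_le (j + 1) (by omega) u hu)
        ((EuclideanSpace.proj (𝕜 := ℝ) l).comp (ContinuousLinearMap.apply ℝ (Euc n) (e i)))
    have h3 : HasUniformExpansion (N + 1)
        (fun (p : GraphDatum m n k r K × sphere (0 : Euc m) 1) (_ : ℝ) => p.1.L (e i) l) := by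
      refine .const (A := 1) fun p => ?_
      have := PiLp.norm_apply_le (p.1.L (e i)) l
      rw [p.1.L.norm_map] at this
      simpa [he] using this
    refine (h3.add h2).congr hr fun p t h0 ht => ?_
    rw [p.1.fderiv_map (by omega) (smul_mem_ball p.2 h0.le ht)]
    simp
  have h4 : HasUniformExpansion (N + 1) (fun p t => (A p t).det) := by
    refine .det fun i j => ?_
    have : (fun p t => A p t i j) = fun (p : GraphDatum m n k r K × sphere (0 : Euc m) 1) t =>
        ∑ l, fderiv ℝ p.1.map (t • (p.2 : Euc m)) (e j) l
          * fderiv ℝ p.1.map (t • (p.2 : Euc m)) (e i) l := by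
      ext p t
      simp only [hA, Matrix.gram_apply, PiLp.inner_apply]
      rfl
    rw [this]
    exact .sum fun l _ => (h1 j l).mul (h1 i l)
  refine h4.comp_analytic (a := 1) (fun p => ?_) analyticAt_sqrt_one
  have hcont : ContinuousAt (fun M : Euc m →L[ℝ] Euc n =>
      (Matrix.gram ℝ fun i => M (e i)).det) (fderiv ℝ p.1.map 0) := by
    refine Continuous.continuousAt (Continuous.matrix_det ?_)
    refine continuous_matrix fun i j => ?_
    simp only [Matrix.gram_apply]
    fun_prop
  have h5 : Tendsto (fun t : ℝ => t • (p.2 : Euc m)) (𝓝[>] 0) (𝓝 0) := by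
    have : Continuous (fun t : ℝ => t • (p.2 : Euc m)) := by fun_prop
    simpa using (this.tendsto 0).mono_left nhdsWithin_le_nhds
  have h6 := (hcont.comp
    (p.1.continuousAt_fderiv_map (by omega) (mem_ball_self hr))).tendsto.comp h5
  have h7 : (Matrix.gram ℝ fun i => fderiv ℝ p.1.map 0 (e i)).det = 1 := by
    rw [p.1.fderiv_map (by omega) (mem_ball_self hr), p.1.fderiv_zero, add_zero]
    have : Matrix.gram ℝ (fun i => p.1.L.toContinuousLinearMap (e i)) = 1 := by
      ext i j
      rw [Matrix.gram_apply, LinearIsometry.coe_toContinuousLinearMap, p.1.L.inner_map_map, he,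
        orthonormal_iff_ite.1 (EuclideanSpace.basisFun (Fin m) ℝ).orthonormal, Matrix.one_apply]
    rw [this, Matrix.det_one]
  simp only [Function.comp_def, h7] at h6
  exact h6

end Expansions

end GraphDatum


namespace GraphDatum

variable {m n k : ℕ} {r K : ℝ} (d : GraphDatum m n k r K)

/-! #### The radius function -/

section Radius

variable {N : ℕ}

/-- By Pythagoras the squared norm is s² plus the squared height. Slope at most 1/2 lets the squared
height drop by at most (s'² - s²)/4, which cannot compensate the growth of s². -/
theorem norm_map_smul_lt (hr : 0 < r) (hk : 1 ≤ k) (θ : sphere (0 : Euc m) 1) {s s' : ℝ}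
    (hs : 0 ≤ s) (hss' : s < s') (hs' : s' < r) :
    ‖d.map (s • (θ : Euc m))‖ < ‖d.map (s' • (θ : Euc m))‖ := by
  have hu := smul_mem_ball θ hs (hss'.trans hs')
  have hu' := smul_mem_ball θ (hs.trans hss'.le) hs'
  have h1 := d.norm_map_sq hu
  have h2 := d.norm_map_sq hu'
  rw [norm_smul_sphere θ hs] at h1
  rw [norm_smul_sphere θ (hs.trans hss'.le)] at h2
  have h3 := d.norm_h_sub_le hk hu hu'
  rw [← sub_smul, norm_smul, norm_eq_of_mem_sphere, mul_one, Real.norm_eq_abs,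
    abs_of_neg (sub_neg.2 hss')] at h3
  have h4 := d.norm_h_le hr hk hu
  have h5 := d.norm_h_le hr hk hu'
  rw [norm_smul_sphere θ hs] at h4
  rw [norm_smul_sphere θ (hs.trans hss'.le)] at h5
  have h6 := norm_sub_norm_le (d.h (s • (θ : Euc m))) (d.h (s' • (θ : Euc m)))
  refine lt_of_pow_lt_pow_left₀ 2 (norm_nonneg _) ?_
  rw [h1, h2]
  set a := ‖d.h (s • (θ : Euc m))‖
  set b := ‖d.h (s' • (θ : Euc m))‖
  have ha : 0 ≤ a := norm_nonneg _
  have hb : 0 ≤ b := norm_nonneg _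
  have h7 : (a - b) * (a + b) ≤ (1 / 2 * (s' - s)) * (1 / 2 * (s + s')) := by
    have h8 : a - b ≤ 1 / 2 * (s' - s) := by linarith
    have h9 : a + b ≤ 1 / 2 * (s + s') := by linarith
    calc (a - b) * (a + b) ≤ (1 / 2 * (s' - s)) * (a + b) := by gcongr
      _ ≤ _ := by
        have : 0 ≤ 1 / 2 * (s' - s) := by linarith
        gcongr
  have h10 : 0 < (s' - s) * (s + s') := mul_pos (by linarith) (by linarith)
  nlinarith

theorem exists_radius (hr : 0 < r) (hk : 1 ≤ k) (θ : sphere (0 : Euc m) 1) {t : ℝ} (h0 : 0 < t)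
    (ht : t < r) : ∃ τ, 0 < τ ∧ τ ≤ t ∧ ‖d.map (τ • (θ : Euc m))‖ = t ∧
      ∀ s, 0 < s → s < r → (‖d.map (s • (θ : Euc m))‖ < t ↔ s < τ) := by
  have hc : ContinuousOn (fun s : ℝ => ‖d.map (s • (θ : Euc m))‖) (Set.Icc 0 t) := by
    refine ContinuousOn.norm (d.contDiffOn_map.continuousOn.comp (by fun_prop) fun s hs => ?_)
    exact smul_mem_ball θ hs.1 (hs.2.trans_lt ht)
  have hmem : t ∈ Set.Icc ‖d.map ((0 : ℝ) • (θ : Euc m))‖ ‖d.map (t • (θ : Euc m))‖ := by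
    refine ⟨by simpa [d.map_zero] using h0.le, ?_⟩
    have := d.norm_le_norm_map hr (smul_mem_ball θ h0.le ht)
    rwa [norm_smul_sphere θ h0.le] at this
  obtain ⟨τ, hτ, hτt⟩ := intermediate_value_Icc h0.le hc hmem
  simp only at hτt
  have hτ0 : 0 < τ := by
    rcases hτ.1.lt_or_eq with h | h
    · exact h
    · rw [← h, zero_smul, d.map_zero, norm_zero] at hτt
      exact absurd hτt h0.ne
  refine ⟨τ, hτ0, hτ.2, hτt, fun s hs hsr => ⟨fun h => ?_, fun h => ?_⟩⟩
  · by_contra hle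
    rcases (not_lt.1 hle).lt_or_eq with h' | h'
    · have := d.norm_map_smul_lt hr hk θ hτ0.le h' hsr
      rw [hτt] at this
      linarith
    · rw [← h', hτt] at h
      exact lt_irrefl _ h
  · have := d.norm_map_smul_lt hr hk θ hs.le h (hτ.2.trans_lt ht)
    rwa [hτt] at this

open Classical in
/-- The parameter at which the ray in direction `θ` leaves the ball of radius `t`. -/
def radius (p : GraphDatum m n k r K × sphere (0 : Euc m) 1) (t : ℝ) : ℝ :=
  if h : ∃ τ, 0 < τ ∧ τ ≤ t ∧ ‖p.1.map (τ • (p.2 : Euc m))‖ = t ∧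
      ∀ s, 0 < s → s < r → (‖p.1.map (s • (p.2 : Euc m))‖ < t ↔ s < τ)
  then h.choose else 0

theorem radius_spec (hr : 0 < r) (hk : 1 ≤ k)
    (p : GraphDatum m n k r K × sphere (0 : Euc m) 1) {t : ℝ} (h0 : 0 < t) (ht : t < r) :
    0 < radius p t ∧ radius p t ≤ t ∧ ‖p.1.map (radius p t • (p.2 : Euc m))‖ = t ∧
      ∀ s, 0 < s → s < r → (‖p.1.map (s • (p.2 : Euc m))‖ < t ↔ s < radius p t) := by
  have h := p.1.exists_radius hr hk p.2 h0 ht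
  rw [radius, dif_pos h]
  exact h.choose_spec

/-- The implicit equation for the exit parameter τ: Pythagoras gives t² = τ² (1 + `secantSq`(τ)). -/
theorem radius_div_eq (hr : 0 < r) (hk : 1 ≤ k)
    (p : GraphDatum m n k r K × sphere (0 : Euc m) 1) {t : ℝ} (h0 : 0 < t) (ht : t < r) :
    radius p t / t = cosSecant p (radius p t) := by
  obtain ⟨h1, h2, h3, -⟩ := radius_spec hr hk p h0 ht
  set τ := radius p t
  have h4 := p.1.norm_map_sq (smul_mem_ball p.2 h1.le (h2.trans_lt ht))
  rw [h3, norm_smul_sphere p.2 h1.le] at h4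
  have h5 : t = τ * Real.sqrt (1 + secantSq p τ) := by
    rw [← Real.sqrt_sq h0.le, h4, secantSq]
    have : τ ^ 2 + ‖p.1.h (τ • (p.2 : Euc m))‖ ^ 2
        = τ ^ 2 * (1 + ‖p.1.h (τ • (p.2 : Euc m))‖ ^ 2 / τ ^ 2) := by
      field_simp
    rw [this, Real.sqrt_mul (sq_nonneg τ), Real.sqrt_sq h1.le]
  have h6 : 0 < Real.sqrt (1 + secantSq p τ) := by
    refine Real.sqrt_pos.2 ?_
    have : 0 ≤ secantSq p τ := by unfold secantSq; positivity
    linarith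
  rw [cosSecant]
  conv_lhs => rw [h5]
  field_simp

/-- A bootstrap on the order. If τ/t expands to order j, then τ = t (τ/t) expands to order j + 1,
hence so does `cosSecant` at τ, which equals τ/t by `radius_div_eq`. It starts from 0 < τ ≤ t and
stops at the order of `cosSecant`. -/
theorem hasUniformExpansion_radius_div (hr : 0 < r) (hk : N + 2 ≤ k) :
    HasUniformExpansion (N + 1)
      (fun (p : GraphDatum m n k r K × sphere (0 : Euc m) 1) t => radius p t / t) := by
  have key : ∀ j ≤ N + 1, HasUniformExpansion j
      (fun (p : GraphDatum m n k r K × sphere (0 : Euc m) 1) t => radius p t / t) := by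
    intro j
    induction j with
    | zero =>
      intro _
      refine .of_bound (K := 1) hr fun p t h0 ht => ?_
      obtain ⟨h1, h2, -, -⟩ := radius_spec hr (by omega) p h0 ht
      rw [abs_of_pos (div_pos h1 h0), pow_zero, mul_one]
      exact div_le_one_of_le₀ h2 h0.le
    | succ j ih =>
      intro hj
      have h1 : HasUniformExpansion (j + 1)
          (fun (p : GraphDatum m n k r K × sphere (0 : Euc m) 1) t => radius p t) :=
        (ih (by omega)).t_mul.congr hr fun p t h0 ht => mul_div_cancel₀ _ h0.ne'
      obtain ⟨c, K', R, hR, hc, hb⟩ :=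
        (hasUniformExpansion_cosSecant (m := m) (n := n) (K := K) hr hk).mono hj
      have h2 : HasUniformExpansion (j + 1)
          (fun (p : GraphDatum m n k r K × sphere (0 : Euc m) 1) t =>
            cosSecant p (radius p t)) := by
        refine h1.comp_of_bound (c := c) (K := K') (R := min R r) (R' := r) (K' := 1)
          (lt_min hR hr) hc (fun p t h0 ht => ?_) hr fun p t h0 ht => ?_
        · obtain ⟨h1, h2, -, -⟩ :=
            radius_spec hr (by omega) p h0 (ht.trans_le (min_le_right _ _))
          rw [abs_of_pos h1]
          exact hb p _ h1 (h2.trans_lt (ht.trans_le (min_le_left _ _)))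
        · obtain ⟨h1, h2, -, -⟩ := radius_spec hr (by omega) p h0 ht
          rw [abs_of_pos h1, one_mul]
          exact h2
      exact h2.congr hr fun p t h0 ht => (radius_div_eq hr (by omega) p h0 ht).symm
  exact key _ le_rfl

/-- The volume, per unit of solid angle, of the part of the graph over the ray in direction `θ`
that lies in the ball of radius `t`. -/
def sectorVolume (p : GraphDatum m n k r K × sphere (0 : Euc m) 1) (t : ℝ) : ℝ :=
  ∫ s in (0 : ℝ)..radius p t, jac p s * s ^ (m - 1)

theorem continuousOn_jac (hk : 1 ≤ k) (p : GraphDatum m n k r K × sphere (0 : Euc m) 1) :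
    ContinuousOn (jac p) (Set.Ico 0 r) := by
  intro s hs
  refine ContinuousAt.continuousWithinAt ?_
  refine continuous_jacobian.continuousAt.comp ?_
  have h1 := p.1.continuousAt_fderiv_map hk (smul_mem_ball p.2 hs.1 hs.2)
  exact ContinuousAt.comp (f := fun s : ℝ => s • (p.2 : Euc m)) h1 (by fun_prop)

theorem intervalIntegrable_jac_mul (hr : 0 < r) (hk : 1 ≤ k)
    (p : GraphDatum m n k r K × sphere (0 : Euc m) 1) {t : ℝ} (h0 : 0 < t) (ht : t < r) :
    IntervalIntegrable (fun s => jac p s * s ^ (m - 1)) volume 0 (radius p t) := by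
  obtain ⟨h1, h2, -, -⟩ := radius_spec hr hk p h0 ht
  refine ContinuousOn.intervalIntegrable ?_
  rw [Set.uIcc_of_le h1.le]
  refine ((continuousOn_jac hk p).mono fun s hs => ?_).mul (by fun_prop)
  exact ⟨hs.1, hs.2.trans_lt (h2.trans_lt ht)⟩

/-- Integrating the expansion of the Jacobian against s^(m-1) up to τ gives τ^m times a polynomial
in τ plus a remainder. The expansion of τ is then substituted, and τ^m/t^m is the m-th power of τ/t.
-/
theorem hasUniformExpansion_sectorVolume (hm : 1 ≤ m) (hr : 0 < r) (hk : N + 2 ≤ k) :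
    HasUniformExpansion (N + 1)
      (fun (p : GraphDatum m n k r K × sphere (0 : Euc m) 1) t => sectorVolume p t / t ^ m) := by
  obtain ⟨c, K', R, h⟩ := hasUniformExpansion_jac (m := m) (n := n) (K := K) hr hk
  obtain ⟨hR, hc, hb⟩ := HasUniformExpansion.nonneg_bound h
  have hK' : 0 ≤ max K' 0 := le_max_right _ _
  have hv := hasUniformExpansion_radius_div (m := m) (n := n) (K := K) hr hk
  have hτ : HasUniformExpansion (N + 1)
      (fun (p : GraphDatum m n k r K × sphere (0 : Euc m) 1) t => radius p t) :=
    hv.t_mul.of_succ.congr hr fun p t h0 ht => mul_div_cancel₀ _ h0.ne'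
  have h1 : HasUniformExpansion (N + 1)
      (fun (p : GraphDatum m n k r K × sphere (0 : Euc m) 1) t =>
        sectorVolume p t / radius p t ^ m) := by
    refine hτ.comp_of_bound (c := fun p j => c p j / (m + j : ℕ)) (K := max K' 0)
      (R := min R r) (R' := r) (K' := 1) (lt_min hR hr) (fun p j => ?_) (fun p t h0 ht => ?_) hr
      fun p t h0 ht => ?_
    · rw [abs_div, Nat.abs_cast]
      have : (1 : ℝ) ≤ (m + j : ℕ) := by exact_mod_cast (by omega)
      exact (div_le_self (abs_nonneg _) this).trans (hc p j)
    · obtain ⟨h1, h2, -, -⟩ := radius_spec hr (by omega) p h0 (ht.trans_le (min_le_right _ _))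
      have hintg := intervalIntegrable_jac_mul hr (by omega) p h0 (ht.trans_le (min_le_right _ _))
      have hsec : sectorVolume p t = ∫ s in (0 : ℝ)..radius p t, jac p s * s ^ (m - 1) := rfl
      set τ := radius p t
      have htR := ht.trans_le (min_le_left R r)
      have hpoly : ∫ s in (0 : ℝ)..τ, ∑ j ∈ Finset.range (N + 1), c p j * s ^ (m - 1 + j)
          = τ ^ m * ∑ j ∈ Finset.range (N + 1), c p j / (m + j : ℕ) * τ ^ j := by
        rw [intervalIntegral.integral_finsetSum fun j _ =>
          (Continuous.intervalIntegrable (by fun_prop) _ _), Finset.mul_sum]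
        refine Finset.sum_congr rfl fun j _ => ?_
        rw [intervalIntegral.integral_const_mul, integral_pow]
        have e1 : m - 1 + j + 1 = m + j := by omega
        have e2 : ((m - 1 + j : ℕ) : ℝ) + 1 = (m + j : ℕ) := by
          rw [← e1]
          push_cast
          ring
        rw [e1, e2, zero_pow (by omega), sub_zero, pow_add]
        ring
      have hpi : IntervalIntegrable
          (fun s : ℝ => ∑ j ∈ Finset.range (N + 1), c p j * s ^ (m - 1 + j)) volume 0 τ :=
        Continuous.intervalIntegrable (by fun_prop) _ _
      have hdiff : |sectorVolume p t
          - τ ^ m * ∑ j ∈ Finset.range (N + 1), c p j / (m + j : ℕ) * τ ^ j|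
          ≤ max K' 0 * τ ^ (N + 1) * τ ^ m := by
        rw [← hpoly, hsec, ← intervalIntegral.integral_sub hintg hpi]
        have hle : ∀ s ∈ Set.uIoc 0 τ, ‖jac p s * s ^ (m - 1)
            - ∑ j ∈ Finset.range (N + 1), c p j * s ^ (m - 1 + j)‖
            ≤ max K' 0 * τ ^ (N + 1) * τ ^ (m - 1) := by
          intro s hs
          rw [Set.uIoc_of_le h1.le] at hs
          have h3 := hb p s hs.1 (hs.2.trans_lt (h2.trans_lt htR))
          have h4 : jac p s * s ^ (m - 1) - ∑ j ∈ Finset.range (N + 1), c p j * s ^ (m - 1 + j)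
              = (jac p s - ∑ j ∈ Finset.range (N + 1), c p j * s ^ j) * s ^ (m - 1) := by
            rw [sub_mul, Finset.sum_mul]
            congr 1
            exact Finset.sum_congr rfl fun j _ => by ring
          rw [h4, norm_mul, norm_pow, Real.norm_of_nonneg hs.1.le, Real.norm_eq_abs]
          have := hs.1.le
          have := hs.2
          calc _ ≤ max K' 0 * s ^ (N + 1) * s ^ (m - 1) := by gcongr
            _ ≤ _ := by gcongr
        refine (intervalIntegral.norm_integral_le_of_norm_le_const hle).trans_eq ?_
        rw [sub_zero, abs_of_pos h1, mul_assoc _ (τ ^ (m - 1)), ← pow_succ, Nat.sub_add_cancel hm]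
      have hτm : 0 < τ ^ m := pow_pos h1 m
      have h5 : sectorVolume p t / τ ^ m
          - ∑ j ∈ Finset.range (N + 1), c p j / (m + j : ℕ) * τ ^ j
          = (sectorVolume p t - τ ^ m * ∑ j ∈ Finset.range (N + 1), c p j / (m + j : ℕ) * τ ^ j)
            / τ ^ m := by
        field_simp
      rw [h5, abs_div, abs_of_pos hτm, div_le_iff₀ hτm, abs_of_pos h1]
      exact hdiff
    · obtain ⟨h1, h2, -, -⟩ := radius_spec hr (by omega) p h0 ht
      rw [abs_of_pos h1, one_mul]
      exact h2
  refine ((hv.pow m).mul h1).congr hr fun p t h0 ht => ?_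
  obtain ⟨h2, -, -, -⟩ := radius_spec hr (by omega) p h0 ht
  have : radius p t ^ m ≠ 0 := (pow_pos h2 m).ne'
  rw [div_pow]
  field_simp

end Radius

end GraphDatum


/-! ### Polar coordinates and the volume of small balls in a graph. -/

theorem lintegral_eq_lintegral_sphere {m : ℕ} {f : Euc m → ENNReal} (hm : 1 ≤ m)
    (hf : Measurable f) :
    ∫⁻ u, f u = ∫⁻ θ : sphere (0 : Euc m) 1,
      (∫⁻ s in Set.Ioi (0 : ℝ), f (s • (θ : Euc m)) * ENNReal.ofReal (s ^ (m - 1)))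
        ∂(volume : Measure (Euc m)).toSphere := by
  have : Nonempty (Fin m) := ⟨⟨0, hm⟩⟩
  have h1 : ∫⁻ u, f u = ∫⁻ x : ({(0 : Euc m)}ᶜ : Set (Euc m)), f x
      ∂(volume : Measure (Euc m)).comap Subtype.val := by
    rw [lintegral_subtype_comap (measurableSet_singleton _).compl, restrict_compl_singleton]
  have h2 := (volume : Measure (Euc m)).measurePreserving_homeomorphUnitSphereProd
  have h3 : ∀ x : ({(0 : Euc m)}ᶜ : Set (Euc m)), f x
      = (fun q : sphere (0 : Euc m) 1 × Set.Ioi (0 : ℝ) => f ((q.2 : ℝ) • (q.1 : Euc m)))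
        (homeomorphUnitSphereProd (Euc m) x) := by
    intro x
    have hx : ‖(x : Euc m)‖ ≠ 0 := norm_ne_zero_iff.2 x.2
    simp [smul_smul, hx]
  have hgm : Measurable (fun q : sphere (0 : Euc m) 1 × Set.Ioi (0 : ℝ) =>
      f ((q.2 : ℝ) • (q.1 : Euc m))) := hf.comp (by fun_prop)
  rw [h1, lintegral_congr h3, h2.lintegral_comp hgm, lintegral_prod _ hgm.aemeasurable]
  refine lintegral_congr fun θ => ?_
  rw [Measure.volumeIoiPow, finrank_euclideanSpace_fin,
    lintegral_withDensity_eq_lintegral_mul _ (by fun_prop)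
      (g := fun s : Set.Ioi (0 : ℝ) => f ((s : ℝ) • (θ : Euc m)))
      (hgm.comp measurable_prodMk_left),
    ← lintegral_subtype_comap measurableSet_Ioi
      (fun s => f (s • (θ : Euc m)) * ENNReal.ofReal (s ^ (m - 1)))]
  refine lintegral_congr fun s => ?_
  simp only [Pi.mul_apply]
  rw [mul_comm]

namespace GraphDatum

variable {m n k : ℕ} {r K : ℝ} (d : GraphDatum m n k r K)

theorem jac_nonneg (p : GraphDatum m n k r K × sphere (0 : Euc m) 1) (t : ℝ) : 0 ≤ jac p t :=
  Real.sqrt_nonneg _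

/-- The part of the parameter domain that is mapped into the ball of radius `t`. -/
def innerDomain (t : ℝ) : Set (Euc m) := {u | u ∈ ball 0 r ∧ ‖d.map u‖ < t}

theorem isOpen_innerDomain (t : ℝ) : IsOpen (d.innerDomain t) := by
  have := d.contDiffOn_map.continuousOn.norm.isOpen_inter_preimage isOpen_ball (isOpen_Iio (a := t))
  exact this

/-- The Jacobian on the part of the parameter domain that is mapped into the ball of
radius `t`. -/
def density (t : ℝ) : Euc m → ENNReal :=
  (d.innerDomain t).indicator fun u => ENNReal.ofReal (jacobian (fderiv ℝ d.map u))

theorem measurable_density (t : ℝ) : Measurable (d.density t) :=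
  (continuous_jacobian.measurable.comp (measurable_fderiv ℝ d.map)).ennreal_ofReal.indicator
    (d.isOpen_innerDomain t).measurableSet

/-- By monotonicity along rays, the ray in direction θ meets the inner domain exactly in the
parameters between 0 and the exit parameter. -/
theorem lintegral_density_ray (hr : 0 < r) (hk : 1 ≤ k) (θ : sphere (0 : Euc m) 1) {t : ℝ}
    (h0 : 0 < t) (ht : t < r) :
    ∫⁻ s in Set.Ioi (0 : ℝ), d.density t (s • (θ : Euc m)) * ENNReal.ofReal (s ^ (m - 1))
      = ENNReal.ofReal (sectorVolume (d, θ) t) := by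
  obtain ⟨h1, h2, -, h4⟩ := radius_spec hr hk (d, θ) h0 ht
  have hintg := intervalIntegrable_jac_mul hr hk (d, θ) h0 ht
  rw [sectorVolume]
  set τ := radius (d, θ) t
  have h5 : ∀ s ∈ Set.Ioi (0 : ℝ),
      d.density t (s • (θ : Euc m)) * ENNReal.ofReal (s ^ (m - 1))
        = (Set.Ioo 0 τ).indicator
          (fun s => ENNReal.ofReal (jac (d, θ) s * s ^ (m - 1))) s := by
    intro s hs
    have hs' : (0 : ℝ) < s := hs
    have hiff : s • (θ : Euc m) ∈ d.innerDomain t ↔ s ∈ Set.Ioo 0 τ := by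
      constructor
      · rintro ⟨hb, hlt⟩
        rw [mem_ball_zero_iff, norm_smul_sphere θ hs'.le] at hb
        exact ⟨hs', (h4 s hs' hb).1 hlt⟩
      · rintro ⟨-, hlt⟩
        have hsr : s < r := hlt.trans_le (h2.trans ht.le)
        exact ⟨smul_mem_ball θ hs'.le hsr, (h4 s hs' hsr).2 hlt⟩
    by_cases hmem : s ∈ Set.Ioo 0 τ
    · rw [density, Set.indicator_of_mem (hiff.2 hmem), Set.indicator_of_mem hmem,
        ENNReal.ofReal_mul (jac_nonneg _ _)]
      rfl
    · rw [density, Set.indicator_of_notMem (fun h => hmem (hiff.1 h)),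
        Set.indicator_of_notMem hmem, zero_mul]
  rw [setLIntegral_congr_fun measurableSet_Ioi h5, lintegral_indicator measurableSet_Ioo,
    Measure.restrict_restrict measurableSet_Ioo,
    Set.inter_eq_left.2 (fun s hs => hs.1), intervalIntegral.integral_of_le h1.le,
    ← restrict_Ioo_eq_restrict_Ioc, ofReal_integral_eq_lintegral_ofReal]
  · exact (hintg.1).mono_set Set.Ioo_subset_Ioc_self
  · filter_upwards [ae_restrict_mem measurableSet_Ioo] with s hs
    exact mul_nonneg (jac_nonneg _ _) (pow_nonneg hs.1.le _)

theorem sectorVolume_nonneg (hr : 0 < r) (hk : 1 ≤ k) (θ : sphere (0 : Euc m) 1) {t : ℝ}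
    (h0 : 0 < t) (ht : t < r) : 0 ≤ sectorVolume (d, θ) t := by
  obtain ⟨h1, -, -, -⟩ := radius_spec hr hk (d, θ) h0 ht
  refine intervalIntegral.integral_nonneg h1.le fun s hs => ?_
  exact mul_nonneg (jac_nonneg _ _) (pow_nonneg hs.1 _)

/-- Measurability in θ comes from Tonelli applied to the ray integral of `density`, which avoids
studying how `radius` depends on θ. -/
theorem measurable_sectorVolume (hr : 0 < r) (hk : 1 ≤ k) {t : ℝ} (h0 : 0 < t) (ht : t < r) :
    Measurable fun θ : sphere (0 : Euc m) 1 => sectorVolume (d, θ) t := by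
  have h1 : Measurable fun θ : sphere (0 : Euc m) 1 => ∫⁻ s in Set.Ioi (0 : ℝ),
      d.density t (s • (θ : Euc m)) * ENNReal.ofReal (s ^ (m - 1)) := by
    refine Measurable.lintegral_prod_right' (ν := volume.restrict (Set.Ioi (0 : ℝ)))
      (f := fun q : sphere (0 : Euc m) 1 × ℝ =>
        d.density t (q.2 • (q.1 : Euc m)) * ENNReal.ofReal (q.2 ^ (m - 1))) ?_
    exact ((d.measurable_density t).comp (by fun_prop)).mul (by fun_prop)
  have h2 : (fun θ : sphere (0 : Euc m) 1 => sectorVolume (d, θ) t) =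
      fun θ : sphere (0 : Euc m) 1 =>
      (∫⁻ s in Set.Ioi (0 : ℝ),
        d.density t (s • (θ : Euc m)) * ENNReal.ofReal (s ^ (m - 1))).toReal := by
    ext θ
    rw [d.lintegral_density_ray hr hk θ h0 ht,
      ENNReal.toReal_ofReal (d.sectorVolume_nonneg hr hk θ h0 ht)]
  rw [h2]
  exact h1.ennreal_toReal

theorem volume_map_inter_ball (hm : 1 ≤ m) (hr : 0 < r) (hk : 1 ≤ k) {t : ℝ} (h0 : 0 < t)
    (ht : t < r) :
    (μHE[m] : Measure (Euc n)).real (d.map '' ball 0 r ∩ ball 0 t)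
      = ∫ θ, sectorVolume (d, θ) t ∂(volume : Measure (Euc m)).toSphere := by
  have hset : d.map '' ball 0 r ∩ ball 0 t = d.map '' d.innerDomain t := by
    ext y
    constructor
    · rintro ⟨⟨u, hu, rfl⟩, hy⟩
      exact ⟨u, ⟨hu, mem_ball_zero_iff.1 hy⟩, rfl⟩
    · rintro ⟨u, ⟨hu, hy⟩, rfl⟩
      exact ⟨⟨u, hu, rfl⟩, mem_ball_zero_iff.2 hy⟩
  have h1 : (μHE[m] : Measure (Euc n)) (d.map '' d.innerDomain t) = ∫⁻ u, d.density t u := by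
    rw [euclideanHausdorffMeasure_image_eq_lintegral isOpen_ball
      (d.contDiffOn_map.of_le (by exact_mod_cast hk))
      (fun u hu v hv => d.norm_sub_le_norm_map_sub hu hv) (fun u hu => hu.1)
      (d.isOpen_innerDomain t).measurableSet, density,
      lintegral_indicator (d.isOpen_innerDomain t).measurableSet]
  rw [hset, measureReal_def, h1, lintegral_eq_lintegral_sphere hm (d.measurable_density t),
    lintegral_congr fun θ => d.lintegral_density_ray hr hk θ h0 ht,
    integral_eq_lintegral_of_nonneg_ae
      (Eventually.of_forall fun θ => d.sectorVolume_nonneg hr hk θ h0 ht)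
      (d.measurable_sectorVolume hr hk h0 ht).aestronglyMeasurable]

/-- The volume of small balls in a graph has an expansion which is uniform in the graph. -/
theorem hasUniformExpansion_volume {N : ℕ} (hm : 1 ≤ m) (hr : 0 < r) (hk : N + 2 ≤ k) :
    HasUniformExpansion (N + 1) (fun (d : GraphDatum m n k r K) t =>
      (μHE[m] : Measure (Euc n)).real (d.map '' ball 0 r ∩ ball 0 t) / t ^ m) := by
  have h1 := (hasUniformExpansion_sectorVolume (n := n) (K := K) hm hr hk).integral
    (σ := (volume : Measure (Euc m)).toSphere) hr fun d t h0 ht =>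
      (d.measurable_sectorVolume hr (by omega) h0 ht).div_const _
  refine h1.congr hr fun d t h0 ht => ?_
  rw [d.volume_map_inter_ball hm hr (by omega) h0 ht, integral_div]

/-- The graph with origin `x`. -/
def sheet (x : Euc n) : Set (Euc n) := (fun u => x + d.map u) '' ball 0 r

theorem volume_sheet_inter_ball (x : Euc n) (t : ℝ) :
    (μHE[m] : Measure (Euc n)).real (d.sheet x ∩ ball x t)
      = (μHE[m] : Measure (Euc n)).real (d.map '' ball 0 r ∩ ball 0 t) := by
  have : d.sheet x ∩ ball x t = (fun y => x + y) '' (d.map '' ball 0 r ∩ ball 0 t) := by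
    ext y
    constructor
    · rintro ⟨⟨u, hu, rfl⟩, hy⟩
      exact ⟨d.map u, ⟨⟨u, hu, rfl⟩, by simpa [dist_eq_norm] using hy⟩, rfl⟩
    · rintro ⟨_, ⟨⟨u, hu, rfl⟩, hy⟩, rfl⟩
      exact ⟨⟨u, hu, rfl⟩, by simpa [dist_eq_norm] using hy⟩
  rw [this, measureReal_def, (isometry_add_left x).euclideanHausdorffMeasure_image,
    ← measureReal_def]

theorem measurableSet_sheet (x : Euc n) : MeasurableSet (d.sheet x) := by
  refine measurableSet_ball.image_of_continuousOn_injOn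
    (continuousOn_const.add d.contDiffOn_map.continuousOn) fun u hu v hv h => ?_
  have := d.norm_sub_le_norm_map_sub hu hv
  rw [add_left_cancel h, sub_self, norm_zero] at this
  exact sub_eq_zero.1 (norm_le_zero_iff.1 this)

theorem isPreconnected_sheet (x : Euc n) : IsPreconnected (d.sheet x) :=
  (convex_ball (0 : Euc m) r).isPreconnected.image _
    (continuousOn_const.add d.contDiffOn_map.continuousOn)

theorem self_mem_sheet (hr : 0 < r) (x : Euc n) : x ∈ d.sheet x :=
  ⟨0, mem_ball_self hr, by simp [d.map_zero]⟩

end GraphDatum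


/-! ### From bounded geometry to graphs over balls of uniform size -/

section Multilinear

variable {m j : ℕ} {E F : Type*} [NormedAddCommGroup E] [InnerProductSpace ℝ E]
  [NormedAddCommGroup F] [NormedSpace ℝ F]

/-- Expanding every argument in the basis produces m^j terms, each with coordinates bounded by the
norms of the arguments. -/
theorem norm_multilinear_le_of_orthonormalBasis (e : OrthonormalBasis (Fin m) ℝ E)
    (f : ContinuousMultilinearMap ℝ (fun _ : Fin j => E) F) {b : ℝ} (hb : 0 ≤ b)
    (h : ∀ s : Fin j → Fin m, ‖f fun i => e (s i)‖ ≤ b) : ‖f‖ ≤ (m : ℝ) ^ j * b := by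
  refine f.opNorm_le_bound (by positivity) fun w => ?_
  have h1 : f w = ∑ s : Fin j → Fin m, (∏ i, inner ℝ (e (s i)) (w i)) • f fun i => e (s i) := by
    conv_lhs => rw [show w = fun i => ∑ a, inner ℝ (e a) (w i) • e a from
      funext fun i => (e.sum_repr' (w i)).symm]
    rw [f.map_sum]
    exact Finset.sum_congr rfl fun s _ => f.map_smul_univ _ _
  rw [h1]
  refine (norm_sum_le _ _).trans ?_
  have h2 : ∀ s ∈ (Finset.univ : Finset (Fin j → Fin m)),
      ‖(∏ i, inner ℝ (e (s i)) (w i)) • f fun i => e (s i)‖ ≤ (∏ i, ‖w i‖) * b := by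
    intro s _
    rw [norm_smul, norm_prod]
    refine mul_le_mul (Finset.prod_le_prod (fun i _ => norm_nonneg _) fun i _ => ?_) (h s)
      (norm_nonneg _) (Finset.prod_nonneg fun i _ => norm_nonneg _)
    refine (norm_inner_le_norm _ _).trans ?_
    rw [e.orthonormal.1, one_mul]
  refine (Finset.sum_le_card_nsmul _ _ _ h2).trans_eq ?_
  rw [Finset.card_univ, Fintype.card_fun, Fintype.card_fin, Fintype.card_fin, nsmul_eq_mul]
  push_cast
  ring

end Multilinear

section GraphDomain

variable {n : ℕ} {T : Submodule ℝ (Euc n)} {x : Euc n} {U : Set T} {h : T → Tᗮ}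

/-- The parametrization of a graph over a subspace. -/
def graphMap (x : Euc n) (h : T → Tᗮ) (u : T) : Euc n := x + (u : Euc n) + (h u : Euc n)

theorem orthogonalProjectionOnto_graphMap_sub (u : T) :
    T.orthogonalProjectionOnto (graphMap x h u - x) = u := by
  have : graphMap x h u - x = (u : Euc n) + (h u : Euc n) := by
    rw [graphMap]
    abel
  rw [this, map_add, Submodule.orthogonalProjectionOnto_mem_subspace_eq_self,
    Submodule.orthogonalProjectionOnto_apply_of_mem_orthogonal (h u).2,
    add_zero]

theorem orthogonalProjectionOnto_orthogonal_graphMap_sub (u : T) :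
    Tᗮ.orthogonalProjectionOnto (graphMap x h u - x) = h u := by
  have : graphMap x h u - x = (u : Euc n) + (h u : Euc n) := by
    rw [graphMap]
    abel
  rw [this, map_add, Submodule.orthogonalProjectionOnto_mem_subspace_eq_self,
    Submodule.orthogonalProjectionOnto_apply_of_mem_orthogonal, zero_add]
  exact T.le_orthogonal_orthogonal u.2

theorem dist_graphMap_le (u : T) : dist (graphMap x h u) x ≤ ‖u‖ + ‖h u‖ := by
  rw [dist_eq_norm, graphMap, add_assoc, add_sub_cancel_left]
  exact norm_add_le _ _

/-- A graph with bounded slope that is closed in the ball `B_ε(x)` is a graph over a ball of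
definite radius. -/
theorem ball_subset_of_closed_graph {ε B : ℝ} (hB : 0 ≤ B) (hU : IsOpen U)
    (hd : ∀ u ∈ U, DifferentiableAt ℝ h u) (hb : ∀ u ∈ U, ‖fderiv ℝ h u‖ ≤ B)
    (hU0 : (0 : T) ∈ U) (h0 : h 0 = 0)
    (hcl : closure (graphMap x h '' U) ∩ ball x ε ⊆ graphMap x h '' U) :
    ball (0 : T) (ε / (1 + B)) ⊆ U := by
  intro u hu
  rw [mem_ball_zero_iff, lt_div_iff₀ (by positivity)] at hu
  -- As long as the segment from 0 to u stays in U, the graph over it stays in the closed ball of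
  -- radius ρ < ε, where closedness of the graph in B_ε(x) gives compactness.
  set ρ := ‖u‖ * (1 + B) with hρ
  set Y := graphMap x h '' U ∩ closedBall x ρ with hY
  have hYc : IsCompact Y := by
    have : Y = closure (graphMap x h '' U) ∩ closedBall x ρ := by
      refine Set.Subset.antisymm (Set.inter_subset_inter_left _ subset_closure) fun y hy => ?_
      exact ⟨hcl ⟨hy.1, closedBall_subset_ball hu hy.2⟩, hy.2⟩
    rw [this, Set.inter_comm]
    exact (isCompact_closedBall x ρ).inter_right isClosed_closure
  set Z : Set T := (fun y => T.orthogonalProjectionOnto (y - x)) '' Y with hZ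
  have hZc : IsClosed Z := (hYc.image (by fun_prop)).isClosed
  have hZU : Z ⊆ U := by
    rintro _ ⟨_, ⟨⟨v, hv, rfl⟩, -⟩, rfl⟩
    simp only [orthogonalProjectionOnto_graphMap_sub]
    exact hv
  have hUZ : ∀ v ∈ U, dist (graphMap x h v) x ≤ ρ → v ∈ Z := fun v hv hle =>
    ⟨_, ⟨⟨v, hv, rfl⟩, hle⟩, orthogonalProjectionOnto_graphMap_sub v⟩
  have hgrow : ∀ t : ℝ, 0 ≤ t → t ≤ 1 → (∀ s ∈ Set.Icc 0 t, s • u ∈ U) → t • u ∈ Z := by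
    intro t ht0 ht1 hs
    refine hUZ _ (hs t ⟨ht0, le_rfl⟩) ?_
    have h1 : ∀ s ∈ Set.Icc 0 t, HasDerivWithinAt (fun s : ℝ => h (s • u))
        (fderiv ℝ h (s • u) u) (Set.Icc 0 t) s := by
      intro s hs'
      have h2 : HasDerivAt (fun s : ℝ => s • u) u s := by
        simpa using (hasDerivAt_id s).smul_const u
      exact ((hd _ (hs s hs')).hasFDerivAt.comp_hasDerivAt s h2).hasDerivWithinAt
    have h3 := norm_image_sub_le_of_norm_deriv_le_segment' h1 (C := B * ‖u‖)
      (fun s hs' => (ContinuousLinearMap.le_opNorm _ _).trans (by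
        gcongr
        exact hb _ (hs s ⟨hs'.1, hs'.2.le⟩))) t ⟨ht0, le_rfl⟩
    rw [zero_smul, h0, sub_zero, sub_zero] at h3
    refine (dist_graphMap_le _).trans ?_
    rw [norm_smul, Real.norm_of_nonneg ht0]
    have h4 : 0 ≤ ‖u‖ := norm_nonneg u
    have h5 : 0 ≤ B * ‖u‖ := by positivity
    calc t * ‖u‖ + ‖h (t • u)‖ ≤ 1 * ‖u‖ + B * ‖u‖ * 1 := by
          refine add_le_add (by gcongr) (h3.trans (by gcongr))
      _ = ρ := by rw [hρ]; ring
  -- Continuation along the segment: S is closed in [0, 1] because Z is closed. It can be continued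
  -- to the right because Z ⊆ U, U is open, and `hgrow` leads from U back to Z.
  set S : Set ℝ := {t | ∀ s ∈ Set.Icc 0 t, s • u ∈ Z} with hS
  have hmain : Set.Icc (0 : ℝ) 1 ⊆ S := by
    refine IsClosed.Icc_subset_of_forall_mem_nhdsWithin ?_ ?_ ?_
    · refine isClosed_of_closure_subset fun t ht => ?_
      have htI : t ∈ Set.Icc (0 : ℝ) 1 :=
        isClosed_Icc.closure_subset_iff.2 Set.inter_subset_right ht
      refine ⟨fun s hs => ?_, htI⟩
      rcases hs.2.lt_or_eq with hlt | rfl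
      · obtain ⟨t', ht', ht'S⟩ := mem_closure_iff.1 ht (Set.Ioi s) isOpen_Ioi hlt
        exact ht'S.1 s ⟨hs.1, le_of_lt ht'⟩
      · have hmaps : Set.MapsTo (fun t : ℝ => t • u) (S ∩ Set.Icc 0 1) Z := fun t' ht' =>
          ht'.1 t' ⟨ht'.2.1, le_rfl⟩
        have := map_mem_closure (f := fun t : ℝ => t • u) (by fun_prop) ht hmaps
        rwa [hZc.closure_eq] at this
    · intro s hs
      have : s = 0 := le_antisymm hs.2 hs.1
      subst this
      refine hgrow 0 le_rfl zero_le_one fun s hs => ?_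
      have : s = 0 := le_antisymm hs.2 hs.1
      rw [this, zero_smul]
      exact hU0
    · rintro t ⟨htS, ht0, ht1⟩
      have hev : ∀ᶠ s in 𝓝 t, s • u ∈ U := by
        have hc : Continuous fun s : ℝ => s • u := by fun_prop
        exact hc.continuousAt.eventually (hU.mem_nhds (hZU (htS t ⟨ht0, le_rfl⟩)))
      obtain ⟨η, hη, hball⟩ := Metric.eventually_nhds_iff.1 hev
      have hmem : Set.Ioo t (min (t + η) 1) ∈ 𝓝[>] t :=
        Ioo_mem_nhdsGT (lt_min (by linarith) ht1)
      filter_upwards [hmem] with t' ht'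
      intro s hs
      have hs1 : s ≤ 1 := hs.2.trans (ht'.2.le.trans (min_le_right _ _))
      refine hgrow s hs.1 hs1 fun s' hs' => ?_
      rcases le_or_gt s' t with h | h
      · exact hZU (htS s' ⟨hs'.1, h⟩)
      · refine hball ?_
        rw [Real.dist_eq, abs_of_pos (by linarith)]
        have := ht'.2.trans_le (min_le_left (t + η) 1)
        linarith [hs'.2, hs.2]
  have := hZU (hmain (Set.right_mem_Icc.2 zero_le_one) 1 (Set.right_mem_Icc.2 zero_le_one))
  rwa [one_smul] at this

/-- Bounds on partial derivatives give operator norms at most m^j b. The case j = 1 with `hr1` puts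
the ball of radius r inside the domain; the case j = 2 with `hr2` and vanishing slope at 0 keeps the
slope below 1/2. The sum over j in the final constant merely dominates every order. -/
theorem exists_graphDatum_of_graph {m k : ℕ} {ε b r : ℝ} (hk : 2 ≤ k) (hb : 0 ≤ b)
    (hT : Module.finrank ℝ T = m) (hU : IsOpen U) (hh : ContDiffOn ℝ k h U)
    (hbound : ∀ (e : OrthonormalBasis (Fin m) ℝ T) (j : ℕ), j ≤ k → ∀ s : Fin j → Fin m, ∀ u ∈ U,
      ‖iteratedFDeriv ℝ j h u (fun i => e (s i))‖ ≤ b)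
    (hU0 : (0 : T) ∈ U) (h0 : h 0 = 0) (hD0 : fderiv ℝ h 0 = 0)
    (hcl : closure (graphMap x h '' U) ∩ ball x ε ⊆ graphMap x h '' U) (hr : 0 < r)
    (hr1 : r ≤ ε / (1 + m * b)) (hr2 : (m : ℝ) ^ 2 * b * r ≤ 1 / 2) :
    ∃ d : GraphDatum m n k r (∑ j ∈ Finset.range (k + 1), (m : ℝ) ^ j * b),
      d.sheet x ⊆ graphMap x h '' U := by
  set e : OrthonormalBasis (Fin m) ℝ T := (stdOrthonormalBasis ℝ T).reindex (finCongr hT) with he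
  have hnorm : ∀ j ≤ k, ∀ u ∈ U, ‖iteratedFDeriv ℝ j h u‖ ≤ (m : ℝ) ^ j * b := fun j hj u hu =>
    norm_multilinear_le_of_orthonormalBasis e _ hb fun s => hbound e j hj s u hu
  have hcd : ∀ u ∈ U, ContDiffAt ℝ k h u := fun u hu => hh.contDiffAt (hU.mem_nhds hu)
  have hk0 : (k : WithTop ℕ∞) ≠ 0 := by exact_mod_cast (by omega : k ≠ 0)
  have hball : ball (0 : T) r ⊆ U := by
    refine (ball_subset_ball hr1).trans
      (ball_subset_of_closed_graph (by positivity) hU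
        (fun u hu => (hcd u hu).differentiableAt hk0) (fun u hu => ?_) hU0 h0 hcl)
    have := hnorm 1 (by omega) u hu
    rwa [norm_iteratedFDeriv_one, pow_one] at this
  set A : Euc m ≃ₗᵢ[ℝ] T := e.repr.symm with hA
  set h' : Euc m → Euc n := Tᗮ.subtypeₗᵢ ∘ h ∘ A with hh'
  have hAball : ∀ u ∈ ball (0 : Euc m) r, A u ∈ U := fun u hu => hball (by
    rw [mem_ball_zero_iff, A.norm_map]
    exact mem_ball_zero_iff.1 hu)
  have hcd' : ∀ u ∈ ball (0 : Euc m) r, ContDiffAt ℝ k h' u := fun u hu =>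
    (Tᗮ.subtypeₗᵢ.contDiff.contDiffAt).comp u ((hcd _ (hAball u hu)).comp u A.contDiff.contDiffAt)
  have hnorm' : ∀ j ≤ k, ∀ u ∈ ball (0 : Euc m) r,
      ‖iteratedFDeriv ℝ j h' u‖ ≤ (m : ℝ) ^ j * b := by
    intro j hj u hu
    rw [hh', Tᗮ.subtypeₗᵢ.norm_iteratedFDeriv_comp_left
      ((hcd _ (hAball u hu)).comp u A.contDiff.contDiffAt) (by exact_mod_cast hj),
      A.norm_iteratedFDeriv_comp_right]
    exact hnorm j hj _ (hAball u hu)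
  have hfd0 : fderiv ℝ h' 0 = 0 := by
    have h1 : HasFDerivAt h (0 : T →L[ℝ] Tᗮ) (A 0) := by
      rw [map_zero, ← hD0]
      exact ((hcd 0 hU0).differentiableAt hk0).hasFDerivAt
    have h2 := (Tᗮ.subtypeₗᵢ.toContinuousLinearMap.hasFDerivAt.comp (0 : Euc m)
      (h1.comp (0 : Euc m) A.toContinuousLinearEquiv.hasFDerivAt)).fderiv
    refine Eq.trans h2 ?_
    ext v
    simp
  refine ⟨⟨T.subtypeₗᵢ.comp A.toLinearIsometry, h', fun u hu => (hcd' u hu).contDiffWithinAt,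
    by simp [hh', h0], hfd0, fun u _ v => ?_, fun j hj u hu => ?_, fun u hu => ?_⟩, ?_⟩
  · exact Submodule.inner_right_of_mem_orthogonal (A v).2 (h (A u)).2
  · refine (hnorm' j hj u hu).trans ?_
    exact Finset.single_le_sum (f := fun j => (m : ℝ) ^ j * b) (fun j _ => by positivity)
      (Finset.mem_range.2 (by omega))
  · have h1 : ∀ w ∈ ball (0 : Euc m) r, DifferentiableAt ℝ (fderiv ℝ h') w := fun w hw =>
      ((hcd' w hw).fderiv_right (m := 1) (by exact_mod_cast hk)).differentiableAt one_ne_zero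
    have h2 : ∀ w ∈ ball (0 : Euc m) r, ‖fderiv ℝ (fderiv ℝ h') w‖ ≤ (m : ℝ) ^ 2 * b := by
      intro w hw
      rw [← norm_iteratedFDeriv_one, norm_iteratedFDeriv_fderiv]
      exact hnorm' 2 hk w hw
    have h3 := (convex_ball (0 : Euc m) r).norm_image_sub_le_of_norm_fderiv_le h1 h2
      (mem_ball_self hr) hu
    rw [hfd0, sub_zero, sub_zero] at h3
    refine h3.trans (le_trans ?_ hr2)
    gcongr
    exact (mem_ball_zero_iff.1 hu).le
  · rintro _ ⟨u, hu, rfl⟩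
    refine ⟨A u, hAball u hu, ?_⟩
    simp [graphMap, GraphDatum.map, hh', add_assoc]

end GraphDomain

section BoundedGeometry

variable {m n k : ℕ} {N : Type*} [TopologicalSpace N] [ChartedSpace (Euc m) N]

theorem IsSheets.isOpen {g : N → Euc n} {x : Euc n} {r : ℝ} {l : ℕ} {W : Fin l → Set N}
    (hW : IsSheets m k g x r W) (i : Fin l) : IsOpen (W i) := by
  obtain ⟨e, -, ht, -, -⟩ := hW.ball i
  rw [← ht]
  exact e.open_target

/-- By compactness a limit point is g q with q in the closure of W_i. Inside the ball, q lies in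
some open W_j, which must meet W_i, so j = i. -/
theorem IsSheets.closure_image_inter_subset [CompactSpace N] {g : N → Euc n}
    (hg : Continuous g) {x : Euc n} {r : ℝ} {l : ℕ} {W : Fin l → Set N}
    (hW : IsSheets m k g x r W) (i : Fin l) :
    closure (g '' W i) ∩ Metric.ball x r ⊆ g '' W i := by
  rintro y ⟨hy, hyr⟩
  have h1 : closure (g '' W i) ⊆ g '' closure (W i) :=
    closure_minimal (Set.image_mono subset_closure)
      (isClosed_closure.isCompact.image hg).isClosed
  obtain ⟨q, hq, rfl⟩ := h1 hy
  have h2 : q ∈ ⋃ j, W j := by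
    rw [hW.iUnion_eq]
    exact hyr
  obtain ⟨j, hj⟩ := Set.mem_iUnion.1 h2
  obtain ⟨q', hq'j, hq'i⟩ := mem_closure_iff.1 hq (W j) (hW.isOpen j) hj
  have : j = i := by
    by_contra hne
    exact Set.disjoint_left.1 (hW.disjoint hne) hq'j hq'i
  subst this
  exact ⟨q, hj, rfl⟩

/-- The local representation of a differentiable map in the chart at a point. -/
theorem hasFDerivAt_chart {g : N → Euc n} {p : N}
    (hg : MDifferentiableAt (𝓡 m) 𝓘(ℝ, Euc n) g p) :
    HasFDerivAt (g ∘ (extChartAt (𝓡 m) p).symm)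
      (mfderiv (𝓡 m) 𝓘(ℝ, Euc n) g p : Euc m →L[ℝ] Euc n) (extChartAt (𝓡 m) p p) := by
  have h := hg.hasMFDerivAt.2
  simp only [writtenInExtChartAt, extChartAt_model_space_eq_id, PartialEquiv.refl_coe,
    modelWithCornersSelf_coe, Set.range_id] at h
  exact hasFDerivWithinAt_univ.1 h

theorem finrank_tangentPlane {g : N → Euc n} (hg : IsImm (m := m) k g) (p : N) :
    Module.finrank ℝ (tangentPlane m g p) = m := by
  have := LinearMap.finrank_range_of_inj (hg.2 p)
  exact this.trans finrank_euclideanSpace_fin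

/-- Near p the normal component of g - g p is h of its tangential component. On differentiating at p
the normal side vanishes, because the derivative of g takes values in T, and the tangential
component of that derivative is onto T. -/
theorem fderiv_eq_zero_of_tangentPlane {g : N → Euc n} (hk : 1 ≤ k) (hg : IsImm (m := m) k g)
    {p : N} {Wp : Set N} (hWp : Wp ∈ 𝓝 p) {T : Submodule ℝ (Euc n)} (hT : T = tangentPlane m g p)
    {U : Set T} {h : T → Tᗮ} (hh : DifferentiableAt ℝ h 0)
    (hgraph : g '' Wp ⊆ graphMap (g p) h '' U) : fderiv ℝ h 0 = 0 := by
  set D : Euc m →L[ℝ] Euc n := mfderiv (𝓡 m) 𝓘(ℝ, Euc n) g p with hD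
  have hk0 : (k : WithTop ℕ∞) ≠ 0 := by exact_mod_cast (by omega : k ≠ 0)
  have h1 := hasFDerivAt_chart ((hg.1 p).mdifferentiableAt hk0)
  set a := extChartAt (𝓡 m) p p with ha
  have hpa : (extChartAt (𝓡 m) p).symm a = p := extChartAt_to_inv p
  have hev : ∀ᶠ z in 𝓝 a, (extChartAt (𝓡 m) p).symm z ∈ Wp := by
    have := continuousAt_extChartAt_symm (I := 𝓡 m) p
    rw [ContinuousAt, hpa] at this
    exact this.eventually hWp
  set γ : Euc m → Euc n := fun z => (g ∘ (extChartAt (𝓡 m) p).symm) z - g p with hγ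
  have hγ' : HasFDerivAt γ D a := h1.sub_const _
  have hγa : γ a = 0 := by simp only [hγ, Function.comp, hpa, sub_self]
  have heq : ∀ᶠ z in 𝓝 a, Tᗮ.orthogonalProjectionOnto (γ z)
      = h (T.orthogonalProjectionOnto (γ z)) := by
    filter_upwards [hev] with z hz
    obtain ⟨u, -, hu⟩ := hgraph ⟨_, hz, rfl⟩
    simp only [hγ, Function.comp]
    rw [← hu, orthogonalProjectionOnto_graphMap_sub,
      orthogonalProjectionOnto_orthogonal_graphMap_sub]
  have h2 : HasFDerivAt (fun z => Tᗮ.orthogonalProjectionOnto (γ z))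
      (Tᗮ.orthogonalProjectionOnto ∘L D) a :=
    (Tᗮ.orthogonalProjectionOnto).hasFDerivAt.comp a hγ'
  have h3 : HasFDerivAt (fun z => h (T.orthogonalProjectionOnto (γ z)))
      (fderiv ℝ h 0 ∘L (T.orthogonalProjectionOnto ∘L D)) a := by
    have h4 : HasFDerivAt h (fderiv ℝ h 0) (T.orthogonalProjectionOnto (γ a)) := by
      rw [hγa, map_zero]
      exact hh.hasFDerivAt
    exact h4.comp a ((T.orthogonalProjectionOnto).hasFDerivAt.comp a hγ')
  have h5 := (h2.congr_of_eventuallyEq (heq.mono fun z hz => hz.symm)).unique h3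
  ext1 w
  obtain ⟨v, hv⟩ : (w : Euc n) ∈ tangentPlane m g p := hT ▸ w.2
  have hv' : D v = (w : Euc n) := hv
  have h6 := DFunLike.congr_fun h5 v
  simp only [ContinuousLinearMap.comp_apply, hv'] at h6
  rw [Submodule.orthogonalProjectionOnto_mem_subspace_eq_self,
    Submodule.orthogonalProjectionOnto_apply_of_mem_orthogonal
      (T.le_orthogonal_orthogonal w.2)] at h6
  exact h6.symm

/-- Every point of a member of the bounded-geometry class is the origin of a graph over a ball of
uniform radius, with uniformly bounded derivatives. -/
theorem exists_graphDatum_of_boundedGeometry (hk : 2 ≤ k) {ε₀ b V r : ℝ} (hb : 0 < b)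
    (hr : 0 < r) (hr1 : r ≤ ε₀ / (1 + m * b)) (hr2 : (m : ℝ) ^ 2 * b * r ≤ 1 / 2)
    {M : Set (Euc n)} (hM : M ∈ BoundedGeometry m n k ε₀ b V) {x : Euc n} (hx : x ∈ M) :
    ∃ d : GraphDatum m n k r (∑ j ∈ Finset.range (k + 1), (m : ℝ) ^ j * b), d.sheet x ⊆ M := by
  obtain ⟨-, N, _, _, _, _, _, g, hg, hrange, hsheets⟩ := hM
  obtain ⟨l, W, hW, hgraph⟩ := hsheets x hx
  obtain ⟨p, hp⟩ : x ∈ Set.range g := hrange ▸ hx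
  have hε : 0 < ε₀ := by
    have h1 : 0 < 1 + (m : ℝ) * b := by positivity
    have := hr.trans_le hr1
    rwa [lt_div_iff₀ h1, zero_mul] at this
  obtain ⟨i, hi⟩ : ∃ i, p ∈ W i := by
    rw [← Set.mem_iUnion, hW.iUnion_eq, Set.mem_preimage, hp]
    exact mem_ball_self hε
  obtain ⟨U, h, hU, hh, hS, hbound⟩ := hgraph i p hi hp
  have hS' : g '' W i = graphMap x h '' U := hS
  obtain ⟨u₀, hu₀, hxu⟩ : x ∈ graphMap x h '' U := hS' ▸ ⟨p, hi, hp⟩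
  have hu0 : u₀ = 0 := by
    have := orthogonalProjectionOnto_graphMap_sub (x := x) (h := h) u₀
    rw [hxu, sub_self, map_zero] at this
    exact this.symm
  have hh0 : h u₀ = 0 := by
    have := orthogonalProjectionOnto_orthogonal_graphMap_sub (x := x) (h := h) u₀
    rw [hxu, sub_self, map_zero] at this
    exact this.symm
  subst hu0
  have hk0 : (k : WithTop ℕ∞) ≠ 0 := by exact_mod_cast (by omega : k ≠ 0)
  have hD0 : fderiv ℝ h 0 = 0 := by
    refine fderiv_eq_zero_of_tangentPlane (U := U) (by omega) hg ((hW.isOpen i).mem_nhds hi) rfl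
      ((hh.contDiffAt (hU.mem_nhds hu₀)).differentiableAt hk0) ?_
    rw [hS', hp]
  obtain ⟨d, hd⟩ := exists_graphDatum_of_graph hk hb.le (finrank_tangentPlane hg p) hU hh hbound
    hu₀ hh0 hD0 (by
      rw [← hS']
      exact hW.closure_image_inter_subset hg.1.continuous i) hr hr1 hr2
  refine ⟨d, hd.trans ?_⟩
  rw [← hS', ← hrange]
  exact Set.image_subset_range _ _

end BoundedGeometry


/-! ### Embedded submanifolds are locally a single sheet -/

section Separation

variable {m n k : ℕ} {N : Type*} [TopologicalSpace N] [ChartedSpace (Euc m) N]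

theorem hasStrictFDerivAt_chart {g : N → Euc n} (hk : 1 ≤ k) (hg : IsImm (m := m) k g) (p : N) :
    HasStrictFDerivAt (g ∘ (extChartAt (𝓡 m) p).symm)
      (mfderiv (𝓡 m) 𝓘(ℝ, Euc n) g p : Euc m →L[ℝ] Euc n) (extChartAt (𝓡 m) p p) := by
  have hk0 : (k : WithTop ℕ∞) ≠ 0 := by exact_mod_cast (by omega : k ≠ 0)
  have h1 := (contMDiffAt_iff.1 (hg.1 p)).2
  simp only [extChartAt_model_space_eq_id, PartialEquiv.refl_coe, modelWithCornersSelf_coe,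
    Set.range_id] at h1
  have h2 : ContDiffAt ℝ k (g ∘ (extChartAt (𝓡 m) p).symm) (extChartAt (𝓡 m) p p) :=
    contDiffWithinAt_univ.1 h1
  exact h2.hasStrictFDerivAt' (hasFDerivAt_chart ((hg.1 p).mdifferentiableAt hk0)) hk0

/-- Near a point of an embedded compact submanifold all secants are almost tangent to it. -/
theorem exists_secant_le [CompactSpace N] {ι : N → Euc n} (hk : 1 ≤ k)
    (hι : IsImm (m := m) k ι) (hinj : Function.Injective ι) (p : N) {η : ℝ} (hη : 0 < η) :
    ∃ ρ > 0, ∀ y ∈ Set.range ι ∩ ball (ι p) ρ, ∀ z ∈ Set.range ι ∩ ball (ι p) ρ,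
      ‖(tangentPlane m ι p)ᗮ.starProjection (y - z)‖ ≤ η * ‖y - z‖ := by
  set T := tangentPlane m ι p with hT
  set D : Euc m →L[ℝ] Euc n := mfderiv (𝓡 m) 𝓘(ℝ, Euc n) ι p with hD
  obtain ⟨C, hC0, hC⟩ := D.toLinearMap.injective_iff_antilipschitz.1 (hι.2 p)
  have hC' : ∀ v, ‖v‖ ≤ C * ‖D v‖ := fun v => ZeroHomClass.bound_of_antilipschitz D hC v
  have hC0' : (0 : ℝ) < C := hC0
  set ε := min 1 η / (2 * C) with hε
  have hε0 : 0 < ε := div_pos (lt_min one_pos hη) (by positivity)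
  -- Being at most 1, this absorbs the linearization error when ‖a - a'‖ is bounded by the secant;
  -- being at most η, it gives the required slope.
  have hεC : 2 * C * ε = min 1 η := by
    rw [hε]
    field_simp
  have hstrict := (hasStrictFDerivAt_chart hk hι p).isLittleO.bound hε0
  rw [nhds_prod_eq] at hstrict
  obtain ⟨V, hV, hV'⟩ := eventually_prod_self_iff'.1 hstrict
  set O : Set N := (extChartAt (𝓡 m) p).source ∩ extChartAt (𝓡 m) p ⁻¹' V with hO
  have hOp : O ∈ 𝓝 p :=
    inter_mem (extChartAt_source_mem_nhds p) ((continuousAt_extChartAt p).preimage_mem_nhds hV)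
  -- Injectivity and compactness keep the part of the submanifold outside the chart neighbourhood at
  -- positive distance from ι p.
  have hcl : IsClosed (ι '' (interior O)ᶜ) :=
    (isOpen_interior.isClosed_compl.isCompact.image hι.1.continuous).isClosed
  have hnot : ι p ∈ (ι '' (interior O)ᶜ)ᶜ := by
    rintro ⟨q, hq, hqp⟩
    rw [hinj hqp] at hq
    exact hq (mem_interior_iff_mem_nhds.2 hOp)
  obtain ⟨ρ, hρ, hball⟩ := Metric.isOpen_iff.1 hcl.isOpen_compl _ hnot
  have hmem : ∀ y ∈ Set.range ι ∩ ball (ι p) ρ,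
      ∃ a ∈ V, (ι ∘ (extChartAt (𝓡 m) p).symm) a = y := by
    rintro _ ⟨⟨q, rfl⟩, hq⟩
    have hqO : q ∈ O := by
      by_contra h
      exact hball hq ⟨q, fun h' => h (interior_subset h'), rfl⟩
    exact ⟨_, hqO.2, by rw [Function.comp, (extChartAt (𝓡 m) p).left_inv hqO.1]⟩
  refine ⟨ρ, hρ, fun y hy z hz => ?_⟩
  obtain ⟨a, ha, rfl⟩ := hmem y hy
  obtain ⟨a', ha', rfl⟩ := hmem z hz
  set γ := ι ∘ (extChartAt (𝓡 m) p).symm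
  have h1 : ‖γ a - γ a' - D (a - a')‖ ≤ ε * ‖a - a'‖ := hV' a ha a' ha'
  have h2 : Tᗮ.starProjection (D (a - a')) = 0 := by
    rw [Submodule.starProjection_apply, Submodule.orthogonalProjectionOnto_apply_of_mem_orthogonal]
    · simp
    · exact T.le_orthogonal_orthogonal ⟨a - a', rfl⟩
  have h3 : ‖Tᗮ.starProjection (γ a - γ a')‖ ≤ ε * ‖a - a'‖ := by
    have : Tᗮ.starProjection (γ a - γ a')
        = Tᗮ.starProjection (γ a - γ a' - D (a - a')) := by
      rw [map_sub _ (γ a - γ a'), h2, sub_zero]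
    rw [this]
    exact (Submodule.norm_starProjection_apply_le _ _).trans h1
  have h4 := hC' (a - a')
  have h5 := norm_sub_norm_le (D (a - a')) (γ a - γ a')
  rw [norm_sub_rev (D (a - a'))] at h5
  have h6 : ‖a - a'‖ ≤ 2 * C * ‖γ a - γ a'‖ := by
    have h7 : ‖a - a'‖ ≤ C * (‖γ a - γ a'‖ + ε * ‖a - a'‖) :=
      h4.trans (by gcongr; linarith)
    have h8 : C * ε * ‖a - a'‖ ≤ 1 / 2 * ‖a - a'‖ := by
      gcongr
      have := min_le_left 1 η
      linarith
    linarith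
  calc _ ≤ _ := h3
    _ ≤ ε * (2 * C * ‖γ a - γ a'‖) := by gcongr
    _ = min 1 η * ‖γ a - γ a'‖ := by rw [← hεC]; ring
    _ ≤ _ := by
      gcongr
      exact min_le_right _ _

/-- A vector almost in `T` and orthogonal to a subspace of the same dimension almost in `T` is
zero. -/
theorem eq_zero_of_almost_tangent {T : Submodule ℝ (Euc n)} (hT : Module.finrank ℝ T = m)
    (L : Euc m →ₗᵢ[ℝ] Euc n) (hL : ∀ v, ‖Tᗮ.starProjection (L v)‖ ≤ 1 / 4 * ‖v‖) {w : Euc n}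
    (hw : ‖Tᗮ.starProjection w‖ ≤ 1 / 4 * ‖w‖) (horth : ∀ v, inner ℝ w (L v) = 0) : w = 0 := by
  have hsq : ∀ v, ‖T.orthogonalProjectionOnto (L v)‖ ^ 2 ≥ 15 / 16 * ‖v‖ ^ 2 := by
    intro v
    have h1 := Submodule.norm_sq_eq_add_norm_sq_projection (L v) T
    rw [L.norm_map] at h1
    have h2 : ‖Tᗮ.orthogonalProjectionOnto (L v)‖ ≤ 1 / 4 * ‖v‖ := hL v
    have h3 := pow_le_pow_left₀ (norm_nonneg _) h2 2
    nlinarith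
  have hinj : Function.Injective (T.orthogonalProjectionOnto.toLinearMap ∘ₗ L.toLinearMap) := by
    refine (injective_iff_map_eq_zero _).2 fun v hv => ?_
    have h1 := hsq v
    have h2 : T.orthogonalProjectionOnto (L v) = 0 := hv
    rw [h2, norm_zero] at h1
    have h3 : ‖v‖ ^ 2 ≤ 0 := by linarith
    exact norm_eq_zero.1 (pow_eq_zero_iff two_ne_zero |>.1 (le_antisymm h3 (sq_nonneg _)))
  have hsurj : Function.Surjective (T.orthogonalProjectionOnto.toLinearMap ∘ₗ L.toLinearMap) :=
    (LinearMap.injective_iff_surjective_of_finrank_eq_finrank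
      (by rw [finrank_euclideanSpace_fin, hT])).1 hinj
  -- Equality of dimensions yields v with L v and w having the same T-component. Then the inner
  -- product of w and L v is near ‖w‖², with an error of at most ‖w‖ ‖v‖/16 from the normal
  -- components, while by assumption it is 0.
  obtain ⟨v, hv⟩ := hsurj (T.orthogonalProjectionOnto w)
  have hv' : T.orthogonalProjectionOnto (L v) = T.orthogonalProjectionOnto w := hv
  have hinner : inner ℝ w (L v) = ‖T.orthogonalProjectionOnto w‖ ^ 2
      + inner ℝ (Tᗮ.starProjection w) (Tᗮ.starProjection (L v)) := by
    conv_lhs => rw [← T.starProjection_add_starProjection_orthogonal w,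
      ← T.starProjection_add_starProjection_orthogonal (L v)]
    rw [inner_add_left, inner_add_right, inner_add_right]
    have e1 : inner ℝ (T.starProjection w) (Tᗮ.starProjection (L v)) = 0 :=
      Submodule.inner_right_of_mem_orthogonal (Submodule.starProjection_apply_mem _ _)
        (Submodule.starProjection_apply_mem _ _)
    have e2 : inner ℝ (Tᗮ.starProjection w) (T.starProjection (L v)) = 0 :=
      Submodule.inner_left_of_mem_orthogonal (Submodule.starProjection_apply_mem _ _)
        (Submodule.starProjection_apply_mem _ _)
    have e3 : inner ℝ (T.starProjection w) (T.starProjection (L v))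
        = ‖T.orthogonalProjectionOnto w‖ ^ 2 := by
      rw [Submodule.starProjection_apply, Submodule.starProjection_apply, hv',
        real_inner_self_eq_norm_sq]
      rfl
    rw [e1, e2, e3]
    ring
  rw [horth v] at hinner
  have h1 := Submodule.norm_sq_eq_add_norm_sq_projection w T
  have h2 : ‖Tᗮ.orthogonalProjectionOnto w‖ ≤ 1 / 4 * ‖w‖ := hw
  have h3 := hsq v
  rw [hv'] at h3
  have h4 := abs_real_inner_le_norm (Tᗮ.starProjection w) (Tᗮ.starProjection (L v))
  have h5 : ‖Tᗮ.starProjection w‖ * ‖Tᗮ.starProjection (L v)‖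
      ≤ (1 / 4 * ‖w‖) * (1 / 4 * ‖v‖) :=
    mul_le_mul hw (hL v) (norm_nonneg _) (by positivity)
  have h6 := neg_abs_le (inner ℝ (Tᗮ.starProjection w) (Tᗮ.starProjection (L v)))
  set A := ‖T.orthogonalProjectionOnto w‖ with hA
  have hA0 : 0 ≤ A := norm_nonneg _
  have h7 := pow_le_pow_left₀ (norm_nonneg _) h2 2
  have hw0 : 0 ≤ ‖w‖ := norm_nonneg w
  have hv0 : 0 ≤ ‖v‖ := norm_nonneg v
  have h8 : ‖v‖ ≤ 2 * ‖w‖ := by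
    refine le_of_sq_le_sq ?_ (by positivity)
    nlinarith [sq_nonneg ‖Tᗮ.orthogonalProjectionOnto w‖]
  have h9 : ‖w‖ ^ 2 ≤ 0 := by nlinarith
  exact norm_eq_zero.1 (pow_eq_zero_iff two_ne_zero |>.1 (le_antisymm h9 (sq_nonneg _)))

/-- Near a point of an embedded compact submanifold, every sheet contains all points of the
submanifold near its origin. -/
theorem exists_nhds_inter_ball_subset_sheet [CompactSpace N] {ι : N → Euc n} (hk : 1 ≤ k)
    (hι : IsImm (m := m) k ι) (hinj : Function.Injective ι) {r K : ℝ} (hr : 0 < r) (p : N) :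
    ∃ ρ > 0, ∀ x ∈ Set.range ι ∩ ball (ι p) ρ, ∀ d : GraphDatum m n k r K,
      d.sheet x ⊆ Set.range ι → Set.range ι ∩ ball x ρ ⊆ d.sheet x := by
  obtain ⟨ρ', hρ', hsec⟩ := exists_secant_le hk hι hinj p (η := 1 / 4) (by norm_num)
  set T := tangentPlane m ι p with hT
  refine ⟨min (ρ' / 4) r, lt_min (by positivity) hr, ?_⟩
  intro x hx d hd y hy
  have hxp : dist x (ι p) < ρ' / 4 := hx.2.trans_le (min_le_left _ _)
  have hyx : dist y x < ρ' / 4 := hy.2.trans_le (min_le_left _ _)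
  have hyx' : dist y x < r := hy.2.trans_le (min_le_right _ _)
  -- The tangent vectors of the sheet at x are limits of secants of M near ι p, hence almost tangent
  -- to T.
  have hL : ∀ v, ‖Tᗮ.starProjection (d.L v)‖ ≤ 1 / 4 * ‖v‖ := by
    intro v
    have h0 : HasFDerivAt d.map d.L.toContinuousLinearMap 0 := by
      have := (d.contDiffOn_map.contDiffAt (ball_mem_nhds 0 hr)).differentiableAt
        (by exact_mod_cast (by omega : k ≠ 0)) |>.hasFDerivAt
      rwa [d.fderiv_map hk (mem_ball_self hr), d.fderiv_zero, add_zero] at this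
    have h1 := (h0.hasLineDerivAt v).tendsto_slope_zero_right
    have h2 := ((Tᗮ.starProjection).continuous.tendsto _ |>.comp h1).norm
    have h3 := h1.norm.const_mul (1 / 4)
    rw [LinearIsometry.coe_toContinuousLinearMap, d.L.norm_map] at h3
    refine le_of_tendsto_of_tendsto h2 h3 ?_
    have hc : Tendsto (fun t : ℝ => t • v) (𝓝[>] 0) (𝓝 0) := by
      have : Continuous fun t : ℝ => t • v := by fun_prop
      simpa using (this.tendsto 0).mono_left nhdsWithin_le_nhds
    filter_upwards [hc.eventually (ball_mem_nhds 0 (lt_min hr (by positivity : 0 < ρ' / 4)))]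
      with t ht
    rw [dist_zero_right, lt_min_iff] at ht
    have htr : t • v ∈ ball (0 : Euc m) r := mem_ball_zero_iff.2 ht.1
    have hmem : x + d.map (t • v) ∈ Set.range ι ∩ ball (ι p) ρ' := by
      refine ⟨hd ⟨_, htr, rfl⟩, ?_⟩
      have h4 : dist (x + d.map (t • v)) x ≤ 3 / 2 * ‖t • v‖ := by
        rw [dist_eq_norm, add_sub_cancel_left]
        exact d.norm_map_le hr hk htr
      have := dist_triangle (x + d.map (t • v)) x (ι p)
      rw [mem_ball]
      linarith
    have hmem' : x ∈ Set.range ι ∩ ball (ι p) ρ' := ⟨hx.1, by rw [mem_ball]; linarith⟩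
    have h5 := hsec _ hmem _ hmem'
    rw [add_sub_cancel_left] at h5
    simp only [Function.comp, zero_add, d.map_zero, sub_zero, map_smul, norm_smul]
    rw [mul_left_comm]
    gcongr
  -- The foot point of y in the plane of the sheet: the difference between y and the sheet point
  -- over u is orthogonal to the plane, but it is also a secant of M near ι p, so
  -- `eq_zero_of_almost_tangent` makes it vanish.
  set u : Euc m := d.L.toContinuousLinearMap.adjoint (y - x) with hu
  have hinner : ∀ v, inner ℝ u v = inner ℝ (y - x) (d.L v) := fun v => by
    rw [hu, ContinuousLinearMap.adjoint_inner_left, LinearIsometry.coe_toContinuousLinearMap]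
  have hun : ‖u‖ ≤ dist y x := by
    rw [dist_eq_norm]
    have h1 := hinner u
    rw [real_inner_self_eq_norm_sq] at h1
    have h2 := real_inner_le_norm (y - x) (d.L u)
    rw [d.L.norm_map, ← h1] at h2
    by_cases h0 : ‖u‖ = 0
    · rw [h0]; exact norm_nonneg _
    · have h3 : 0 < ‖u‖ := lt_of_le_of_ne (norm_nonneg _) (Ne.symm h0)
      nlinarith
  have hur : u ∈ ball (0 : Euc m) r := mem_ball_zero_iff.2 (hun.trans_lt hyx')
  have hz : x + d.map u ∈ Set.range ι ∩ ball (ι p) ρ' := by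
    refine ⟨hd ⟨_, hur, rfl⟩, ?_⟩
    have h4 : dist (x + d.map u) x ≤ 3 / 2 * ‖u‖ := by
      rw [dist_eq_norm, add_sub_cancel_left]
      exact d.norm_map_le hr hk hur
    have := dist_triangle (x + d.map u) x (ι p)
    rw [mem_ball]
    linarith
  have hy' : y ∈ Set.range ι ∩ ball (ι p) ρ' := by
    refine ⟨hy.1, ?_⟩
    have := dist_triangle y x (ι p)
    rw [mem_ball]
    linarith
  have hw : y - (x + d.map u) = 0 := by
    refine eq_zero_of_almost_tangent (finrank_tangentPlane hι p) d.L hL (hsec _ hy' _ hz)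
      fun v => ?_
    have e : y - (x + d.map u) = (y - x) - d.L u - d.h u := by
      rw [GraphDatum.map]
      abel
    rw [e, inner_sub_left, inner_sub_left, ← hinner v, d.L.inner_map_map, sub_self,
      real_inner_comm, d.inner_eq_zero u hur, sub_zero]
  exact ⟨u, hur, (sub_eq_zero.1 hw).symm⟩

/-- Compactness makes the local radii uniform over the submanifold. The radius still depends on the
submanifold itself, so it may be used for existence statements but not in the final constants. -/
theorem exists_inter_ball_subset_sheet [CompactSpace N] {ι : N → Euc n} (hk : 1 ≤ k)
    (hι : IsImm (m := m) k ι) (hinj : Function.Injective ι) (r K : ℝ) (hr : 0 < r) :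
    ∃ ρ > 0, ∀ x ∈ Set.range ι, ∀ d : GraphDatum m n k r K,
      d.sheet x ⊆ Set.range ι → Set.range ι ∩ ball x ρ ⊆ d.sheet x := by
  choose ρ hρ h using exists_nhds_inter_ball_subset_sheet (K := K) hk hι hinj hr
  have hcpt : IsCompact (Set.univ : Set N) := isCompact_univ
  obtain ⟨t, -, ht⟩ := hcpt.elim_nhds_subcover (fun p => ι ⁻¹' ball (ι p) (ρ p))
    fun p _ => hι.1.continuous.continuousAt.preimage_mem_nhds (ball_mem_nhds _ (hρ p))
  obtain ⟨ρ₀, hρ₀, hle⟩ : ∃ ρ₀ > 0, ∀ p ∈ t, ρ₀ ≤ ρ p := by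
    rcases t.eq_empty_or_nonempty with rfl | hne
    · exact ⟨1, one_pos, by simp⟩
    · obtain ⟨q, hq, hmin⟩ := t.exists_min_image ρ hne
      exact ⟨ρ q, hρ q, hmin⟩
  refine ⟨ρ₀, hρ₀, ?_⟩
  rintro _ ⟨q, rfl⟩ d hd y hy
  obtain ⟨p, hp, hqp⟩ := Set.mem_iUnion₂.1 (ht (Set.mem_univ q))
  exact h p _ ⟨⟨q, rfl⟩, hqp⟩ d hd ⟨hy.1, ball_subset_ball (hle p hp) hy.2⟩

end Separation


/-! ### Existence of the energy -/

section EnergyDefined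

variable {m n : ℕ} {α : ℝ} {M : Set (Euc n)}

theorem integrableOn_dist_rpow {μ : Measure (Euc n)} {S : Set (Euc n)} (hS : MeasurableSet S)
    (hfin : μ S ≠ ⊤) (hα : α ≤ 0) {x : Euc n} {ε : ℝ} (hε : 0 < ε) (hSε : Disjoint S (ball x ε)) :
    IntegrableOn (fun y => dist x y ^ α) S μ := by
  refine Measure.integrableOn_of_bounded (M := ε ^ α) hfin ?_ ?_
  · exact (Measurable.pow_const (by fun_prop) α).aestronglyMeasurable
  · refine (ae_restrict_mem hS).mono fun y hy => ?_
    have h1 : ε ≤ dist x y := by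
      rw [dist_comm]
      exact not_lt.1 fun h => Set.disjoint_left.1 hSε hy h
    rw [Real.norm_of_nonneg (by positivity)]
    exact Real.rpow_le_rpow_of_nonpos hε h1 hα

theorem setIntegral_dist_rpow_le {μ : Measure (Euc n)} {S : Set (Euc n)} (hS : MeasurableSet S)
    (hfin : μ S ≠ ⊤) (hα : α ≤ 0) {x : Euc n} {ε : ℝ} (hε : 0 < ε) (hSε : Disjoint S (ball x ε)) :
    ∫ y in S, dist x y ^ α ∂μ ≤ ε ^ α * μ.real S := by
  have h1 : ∫ y in S, dist x y ^ α ∂μ ≤ ∫ y in S, ε ^ α ∂μ := by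
    refine setIntegral_mono_on (integrableOn_dist_rpow hS hfin hα hε hSε)
      (integrableOn_const hfin) hS fun y hy => ?_
    have h1 : ε ≤ dist x y := by
      rw [dist_comm]
      exact not_lt.1 fun h => Set.disjoint_left.1 hSε hy h
    exact Real.rpow_le_rpow_of_nonpos hε h1 hα
  rwa [setIntegral_const, smul_eq_mul, mul_comm] at h1

theorem measurable_measureReal_inter_ball {μ : Measure (Euc n)} (hfin : μ M ≠ ⊤)
    (t : ℝ) : Measurable fun x => μ.real (M ∩ ball x t) := by
  have : IsFiniteMeasure (μ.restrict M) := isFiniteMeasure_restrict.2 hfin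
  have hs : MeasurableSet {q : Euc n × Euc n | dist q.2 q.1 < t} :=
    (isOpen_lt (by fun_prop) continuous_const).measurableSet
  have h := measurable_measure_prodMk_left (ν := μ.restrict M) hs
  convert h.ennreal_toReal using 2 with x
  rw [measureReal_def, Set.inter_comm, ← Measure.restrict_apply measurableSet_ball]
  rfl

theorem measurable_truncatedPotential (hfin : (μHE[m] : Measure (Euc n)) M ≠ ⊤) (ε : ℝ) :
    Measurable fun x => truncatedPotential m α M x ε := by
  have : IsFiniteMeasure ((μHE[m] : Measure (Euc n)).restrict M) := isFiniteMeasure_restrict.2 hfin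
  have hs : MeasurableSet {q : Euc n × Euc n | ε ≤ dist q.2 q.1} :=
    (isClosed_le continuous_const (by fun_prop)).measurableSet
  have hf : Measurable fun q : Euc n × Euc n => dist q.1 q.2 ^ α :=
    Measurable.pow_const (by fun_prop) α
  have h := ((hf.indicator hs).stronglyMeasurable.integral_prod_right'
    (ν := (μHE[m] : Measure (Euc n)).restrict M)).measurable
  convert h using 2 with x
  have e : M \ ball x ε = (ball x ε)ᶜ ∩ M := by
    rw [Set.sdiff_eq, Set.inter_comm]
  rw [truncatedPotential, e, ← Measure.restrict_restrict measurableSet_ball.compl,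
    ← integral_indicator measurableSet_ball.compl]
  refine integral_congr_ae (Eventually.of_forall fun y => ?_)
  simp only [Set.indicator, Set.mem_ofPred_eq, Set.mem_compl_iff, mem_ball, not_lt]

/-- If the volume of small balls in neighbourhoods `Q x` of the points of `M` has a uniform
expansion, then the regularized energy of `M` is defined, and the potential is, up to a uniform
constant, the contribution of the points outside `Q x`. -/
theorem exists_potential_sub_le (m N : ℕ) {α K R : ℝ} (hα : α < 0) (hN : 0 < α + m + N)
    (hN' : ∀ j < N, α + m + j ≤ 0) (hR : 0 < R) :
    ∃ C, ∀ {M : Set (Euc n)} {Q : Euc n → Set (Euc n)} {a : Euc n → ℕ → ℝ} {ρ : ℝ},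
      MeasurableSet M → (μHE[m] : Measure (Euc n)) M ≠ ⊤ → 0 < ρ →
      (∀ x ∈ M, MeasurableSet (Q x) ∧ Q x ⊆ M ∩ ball x R ∧ M ∩ ball x ρ ⊆ Q x) →
      (∀ x ∈ M, ∀ j, |a x j| ≤ K) →
      (∀ x ∈ M, ∀ t, 0 < t → t ≤ R → |(μHE[m] : Measure (Euc n)).real (Q x ∩ ball x t)
        - ∑ j ∈ Finset.range N, a x j * t ^ (m + j)| ≤ K * t ^ (m + N)) →
      RieszEnergyDefined m α M ∧ ∀ x ∈ M,
        |potential m α M x - ∫ y in M \ Q x, dist x y ^ α ∂(μHE[m] : Measure (Euc n))| ≤ C := by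
  obtain ⟨C, hC⟩ := exists_tendsto_truncated (n := n) m N (K := K) hα hN hR
  refine ⟨C, ?_⟩
  intro M Q a ρ hM hfin hρ hQ haK hexp
  set μ : Measure (Euc n) := μHE[m] with hμ
  have hQfin : ∀ x ∈ M, μ (Q x) ≠ ⊤ := fun x hx =>
    ne_top_of_le_ne_top hfin (measure_mono fun y hy => ((hQ x hx).2.1 hy).1)
  have hMQfin : ∀ x, μ (M \ Q x) ≠ ⊤ := fun x =>
    ne_top_of_le_ne_top hfin (measure_mono Set.sdiff_subset)
  have hdisj : ∀ x ∈ M, Disjoint (M \ Q x) (ball x ρ) := fun x hx =>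
    Set.disjoint_left.2 fun y hy hy' => hy.2 ((hQ x hx).2.2 ⟨hy.1, hy'⟩)
  have hlim : ∀ x ∈ M, ∃ c, |c| ≤ C ∧ Tendsto (fun ε => truncatedPotential m α M x ε
      - ∑ j ∈ Finset.range N, a x j * gauge α (α + m + j) ε) (𝓝[>] 0)
      (𝓝 (c + ∫ y in M \ Q x, dist x y ^ α ∂μ)) := by
    intro x hx
    obtain ⟨hQm, hQR, hQρ⟩ := hQ x hx
    obtain ⟨c, hc, hct⟩ := hC (μ := μ) hQm (hQfin x hx) (fun y hy => (hQR hy).2) (haK x hx)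
      (hexp x hx)
    refine ⟨c, hc, (hct.add_const (∫ y in M \ Q x, dist x y ^ α ∂μ)).congr' ?_⟩
    filter_upwards [Ioo_mem_nhdsGT hρ] with ε hε
    -- For ε < ρ the removed ball only meets Q x, so the integral over the rest of M does not depend
    -- on ε.
    have e : M \ ball x ε = (Q x \ ball x ε) ∪ (M \ Q x) := by
      ext y
      constructor
      · intro hy
        by_cases h : y ∈ Q x
        · exact Or.inl ⟨h, hy.2⟩
        · exact Or.inr ⟨hy.1, h⟩
      · rintro (hy | hy)
        · exact ⟨(hQR hy.1).1, hy.2⟩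
        · exact ⟨hy.1, fun h => hy.2 (hQρ ⟨hy.1, ball_subset_ball hε.2.le h⟩)⟩
    rw [truncatedPotential, e, setIntegral_union
      (Set.disjoint_left.2 fun y hy hy' => hy'.2 hy.1) (hM.diff hQm)
      (integrableOn_dist_rpow (hQm.diff measurableSet_ball)
        (ne_top_of_le_ne_top (hQfin x hx) (measure_mono Set.sdiff_subset)) hα.le hε.1
        Set.disjoint_sdiff_left)
      (integrableOn_dist_rpow (hM.diff hQm) (hMQfin x) hα.le hρ (hdisj x hx))]
    ring
  have hpf : ∀ x ∈ M, ∀ c, Tendsto (fun ε => truncatedPotential m α M x ε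
      - ∑ j ∈ Finset.range N, a x j * gauge α (α + m + j) ε) (𝓝[>] 0) (𝓝 c) →
      HasFinitePart (truncatedPotential m α M x) c := by
    intro x hx c hc
    have h1 := (hasFinitePart_of_tendsto hc).add (HasFinitePart.sum (s := Finset.range N)
      fun j hj => (hasFinitePart_gauge α (hN' j (Finset.mem_range.1 hj))).const_mul (a x j))
    simpa using h1
  have hpot : ∀ x ∈ M, Tendsto (fun ε => truncatedPotential m α M x ε
      - ∑ j ∈ Finset.range N, a x j * gauge α (α + m + j) ε) (𝓝[>] 0)
      (𝓝 (potential m α M x)) := by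
    intro x hx
    obtain ⟨c, -, hct⟩ := hlim x hx
    rwa [potential, finitePart_eq (hpf x hx _ hct)]
  have hsub : ∀ x ∈ M, |potential m α M x - ∫ y in M \ Q x, dist x y ^ α ∂μ| ≤ C := by
    intro x hx
    obtain ⟨c, hc, hct⟩ := hlim x hx
    rw [tendsto_nhds_unique (hpot x hx) hct, add_sub_cancel_right]
    exact hc
  -- No measurability is assumed for x ↦ Q x. For t < ρ, however, Q x ∩ B_t(x) equals M ∩ B_t(x),
  -- whose volume is measurable in x, and these volumes determine the coefficients.
  have hcoeff : ∀ j < N, Measurable fun x : M => a x j := by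
    refine HasUniformExpansionWith.measurable_coeff (K := K) (R := min ρ R)
      (φ := fun (x : M) t => μ.real (M ∩ ball x t) / t ^ m)
      ⟨lt_min hρ hR, fun x j => haK x x.2 j, ?_⟩ fun t _ _ =>
        ((measurable_measureReal_inter_ball hfin t).comp measurable_subtype_coe).div_const _
    intro x t h0 ht
    have htp : 0 < t ^ m := pow_pos h0 m
    have e : M ∩ ball (x : Euc n) t = Q x ∩ ball (x : Euc n) t := by
      refine Set.Subset.antisymm (fun y hy => ⟨(hQ x x.2).2.2 ⟨hy.1, ?_⟩, hy.2⟩)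
        fun y hy => ⟨((hQ x x.2).2.1 hy.1).1, hy.2⟩
      exact ball_subset_ball (ht.le.trans (min_le_left _ _)) hy.2
    have h1 := hexp x x.2 t h0 (ht.le.trans (min_le_right _ _))
    have e2 : ∑ j ∈ Finset.range N, a x j * t ^ (m + j)
        = t ^ m * ∑ j ∈ Finset.range N, a x j * t ^ j := by
      rw [Finset.mul_sum]
      exact Finset.sum_congr rfl fun j _ => by ring
    beta_reduce
    rw [e]
    have e3 : μ.real (Q x ∩ ball (x : Euc n) t) - ∑ j ∈ Finset.range N, a x j * t ^ (m + j)
        = t ^ m * (μ.real (Q x ∩ ball (x : Euc n) t) / t ^ m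
          - ∑ j ∈ Finset.range N, a x j * t ^ j) := by
      rw [e2]
      field_simp
    rw [e3, abs_mul, abs_of_pos htp, pow_add, mul_left_comm] at h1
    exact le_of_mul_le_mul_left h1 htp
  have hmeas : Measurable fun x : M => potential m α M x := by
    obtain ⟨u, -, hu, hulim⟩ := exists_seq_strictAnti_tendsto' (one_pos (α := ℝ))
    have hu' : Tendsto u atTop (𝓝[>] 0) :=
      tendsto_nhdsWithin_iff.2 ⟨hulim, Eventually.of_forall fun i => (hu i).1⟩
    refine measurable_of_tendsto_metrizable (f := fun i (x : M) => truncatedPotential m α M x (u i)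
      - ∑ j ∈ Finset.range N, a x j * gauge α (α + m + j) (u i)) (fun i => ?_)
      (tendsto_pi_nhds.2 fun x => (hpot x x.2).comp hu')
    refine ((measurable_truncatedPotential hfin _).comp measurable_subtype_coe).sub ?_
    exact Finset.measurable_fun_sum _ fun j hj =>
      (hcoeff j (Finset.mem_range.1 hj)).mul_const _
  refine ⟨⟨?_, ?_, ?_⟩, hsub⟩
  · intro x _ ε hε
    exact integrableOn_dist_rpow (hM.diff measurableSet_ball)
      (ne_top_of_le_ne_top hfin (measure_mono Set.sdiff_subset)) hα.le hε Set.disjoint_sdiff_left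
  · intro x hx
    exact ⟨_, hpf x hx _ (hpot x hx)⟩
  · have : IsFiniteMeasure (μ.restrict M) := isFiniteMeasure_restrict.2 hfin
    refine Integrable.of_bound (AEMeasurable.aestronglyMeasurable ?_) (C + ρ ^ α * μ.real M)
      ((ae_restrict_mem hM).mono fun x hx => ?_)
    · exact (aemeasurable_restrict_iff_comap_subtype hM).2 hmeas.aemeasurable
    have h1 := hsub x hx
    have h2 := setIntegral_dist_rpow_le (hM.diff (hQ x hx).1) (hMQfin x) hα.le hρ (hdisj x hx)
    have h3 : 0 ≤ ∫ y in M \ Q x, dist x y ^ α ∂μ := integral_nonneg fun y => by positivity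
    have h4 : μ.real (M \ Q x) ≤ μ.real M := measureReal_mono Set.sdiff_subset hfin
    have h5 : ρ ^ α * μ.real (M \ Q x) ≤ ρ ^ α * μ.real M := by gcongr
    rw [Real.norm_eq_abs]
    have h6 := abs_add_le (potential m α M x - ∫ y in M \ Q x, dist x y ^ α ∂μ)
      (∫ y in M \ Q x, dist x y ^ α ∂μ)
    rw [sub_add_cancel, abs_of_nonneg h3] at h6
    linarith

end EnergyDefined


/-! ### The potential of a manifold with bounded geometry -/

/-- As α ≤ -2m, the truncation at 0 in ᾱ is inactive. Thus ᾱ + 1 is exactly the number of terms of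
the volume expansion that diverge or give a logarithm, and the next exponent is positive. -/
theorem alphaBar_spec {m : ℕ} {α : ℝ} (hα : α ≤ -2 * (m : ℝ)) :
    0 < α + m + (alphaBar m α + 1 : ℕ) ∧ ∀ j < alphaBar m α + 1, α + m + (j : ℝ) ≤ 0 := by
  have h1 : (2 * m : ℤ) ≤ ⌊-α⌋ := Int.le_floor.2 (by push_cast; linarith)
  have h2 : ((alphaBar m α : ℕ) : ℤ) = ⌊-α⌋ - m := Int.toNat_of_nonneg (by omega)
  have h3 : ((alphaBar m α : ℕ) : ℝ) = ⌊-α⌋ - m := by exact_mod_cast congrArg (Int.cast (R := ℝ)) h2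
  have h4 := Int.lt_floor_add_one (-α)
  have h5 := Int.floor_le (-α)
  refine ⟨by push_cast; linarith, fun j hj => ?_⟩
  have : (j : ℝ) ≤ alphaBar m α := by exact_mod_cast Nat.lt_succ_iff.1 hj
  linarith

/-- The energy of an embedded closed submanifold with bounded geometry is defined, and the potential
at a point is bounded below, up to a uniform constant, by the contribution of any part of the
submanifold away from a sheet through that point. -/
theorem exists_setIntegral_le_potential_add {m n : ℕ} (hm : 1 ≤ m) {α : ℝ}
    (hα : α ≤ -2 * (m : ℝ)) {ε₀ b V r : ℝ} (hb : 0 < b) (hr : 0 < r)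
    (hr1 : r ≤ ε₀ / (1 + m * b)) (hr2 : (m : ℝ) ^ 2 * b * r ≤ 1 / 2) :
    ∃ C K : ℝ, ∀ (N : Type*) [TopologicalSpace N] [ChartedSpace (Euc m) N]
      [IsManifold (𝓡 m) (alphaBar m α + 3 : ℕ) N] [CompactSpace N] (ι : N → Euc n),
      IsImm (m := m) (alphaBar m α + 3) ι → Function.Injective ι →
      Set.range ι ∈ BoundedGeometry m n (alphaBar m α + 3) ε₀ b V →
      RieszEnergyDefined m α (Set.range ι) ∧ ∀ x ∈ Set.range ι,
        ∃ d : GraphDatum m n (alphaBar m α + 3) r K, d.sheet x ⊆ Set.range ι ∧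
          ∀ S ⊆ Set.range ι, MeasurableSet S → Disjoint S (d.sheet x) →
            IntegrableOn (fun y => dist x y ^ α) S (μHE[m] : Measure (Euc n)) ∧
            ∫ y in S, dist x y ^ α ∂(μHE[m] : Measure (Euc n))
              ≤ potential m α (Set.range ι) x + C := by
  classical
  have hα0 : α < 0 := by
    have : (1 : ℝ) ≤ m := by exact_mod_cast hm
    linarith
  obtain ⟨hN, hN'⟩ := alphaBar_spec hα
  set k := alphaBar m α + 3 with hk
  set K : ℝ := ∑ j ∈ Finset.range (k + 1), (m : ℝ) ^ j * b with hK
  obtain ⟨c, K', R', hexp⟩ := GraphDatum.hasUniformExpansion_volume (n := n) (K := K)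
    (N := alphaBar m α) (k := k) hm hr (by omega)
  obtain ⟨hR', hc, hb'⟩ := hexp
  -- The halving makes R strictly less than R', since `exists_potential_sub_le` needs the expansion
  -- at t = R as well.
  set R := min R' r / 2 with hR
  have hR0 : 0 < R := by positivity
  have hRR' : R < R' := (half_lt_self (by positivity)).trans_le (min_le_left _ _)
  obtain ⟨C, hC⟩ := exists_potential_sub_le (n := n) (K := K') m (alphaBar m α + 1) hα0 hN hN' hR0
  refine ⟨C, K, ?_⟩
  intro N _ _ _ _ ι hι hinj hBG
  set M := Set.range ι with hM
  have hMm : MeasurableSet M := (isCompact_range hι.1.continuous).isClosed.measurableSet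
  have hfin : (μHE[m] : Measure (Euc n)) M ≠ ⊤ := ne_top_of_le_ne_top ENNReal.ofReal_ne_top hBG.1
  obtain ⟨ρ, hρ, hsep⟩ := exists_inter_ball_subset_sheet (by omega : 1 ≤ k) hι hinj r K hr
  have hd : ∀ x ∈ M, ∃ d : GraphDatum m n k r K, d.sheet x ⊆ M := fun x hx =>
    exists_graphDatum_of_boundedGeometry (by omega) hb hr hr1 hr2 hBG hx
  choose d hdM using hd
  set Q : Euc n → Set (Euc n) := fun x => if hx : x ∈ M then (d x hx).sheet x ∩ ball x R else ∅
    with hQ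
  set a : Euc n → ℕ → ℝ := fun x => if hx : x ∈ M then c (d x hx) else 0 with ha
  have hQx : ∀ x (hx : x ∈ M), Q x = (d x hx).sheet x ∩ ball x R := fun x hx => by
    simp only [hQ, dif_pos hx]
  have hax : ∀ x (hx : x ∈ M), a x = c (d x hx) := fun x hx => by
    simp only [ha, dif_pos hx]
  obtain ⟨hdef, hpot⟩ := hC (M := M) (Q := Q) (a := a) (ρ := min ρ R) hMm hfin (lt_min hρ hR0)
    (fun x hx => by
      rw [hQx x hx]
      refine ⟨((d x hx).measurableSet_sheet x).inter measurableSet_ball,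
        fun y hy => ⟨hdM x hx hy.1, hy.2⟩, fun y hy => ⟨hsep x hx _ (hdM x hx) ⟨hy.1, ?_⟩, ?_⟩⟩
      · exact ball_subset_ball (min_le_left _ _) hy.2
      · exact ball_subset_ball (min_le_right _ _) hy.2)
    (fun x hx j => by rw [hax x hx]; exact hc _ j)
    (fun x hx t h0 ht => by
      have htp : 0 < t ^ m := pow_pos h0 m
      rw [hQx x hx, hax x hx, Set.inter_assoc, Set.inter_eq_right.2 (ball_subset_ball ht),
        GraphDatum.volume_sheet_inter_ball]
      have h1 := mul_le_mul_of_nonneg_left (hb' (d x hx) t h0 (ht.trans_lt hRR')) htp.le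
      rw [← abs_of_pos htp, ← abs_mul, abs_of_pos htp, mul_sub, mul_div_cancel₀ _ htp.ne',
        Finset.mul_sum] at h1
      calc _ = _ := by
            congr 2
            exact Finset.sum_congr rfl fun j _ => by ring
        _ ≤ _ := h1
        _ = _ := by ring)
  refine ⟨hdef, fun x hx => ⟨d x hx, hdM x hx, fun S hSM hS hdisj => ?_⟩⟩
  have hρR : 0 < min ρ R := lt_min hρ hR0
  have hSQ : S ⊆ M \ Q x := fun y hy => ⟨hSM hy, fun h => by
    rw [hQx x hx] at h
    exact Set.disjoint_left.1 hdisj hy h.1⟩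
  have hQm : MeasurableSet (Q x) := by
    rw [hQx x hx]
    exact ((d x hx).measurableSet_sheet x).inter measurableSet_ball
  have hintg : IntegrableOn (fun y => dist x y ^ α) (M \ Q x) (μHE[m] : Measure (Euc n)) := by
    refine integrableOn_dist_rpow (hMm.diff hQm)
      (ne_top_of_le_ne_top hfin (measure_mono Set.sdiff_subset)) hα0.le hρR
      (Set.disjoint_left.2 fun y hy hy' => hy.2 ?_)
    rw [hQx x hx]
    exact ⟨hsep x hx _ (hdM x hx) ⟨hy.1, ball_subset_ball (min_le_left _ _) hy'⟩,
      ball_subset_ball (min_le_right _ _) hy'⟩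
  refine ⟨hintg.mono_set hSQ, ?_⟩
  -- Positivity of the kernel allows all of M outside Q x except S to be discarded.
  have h1 := setIntegral_mono_set hintg (Eventually.of_forall fun y => by positivity)
    hSQ.eventuallyLE
  have h2 := (abs_le.1 (hpot x hx)).1
  linarith

/-! ### Separation of the two sheets through a double point -/

theorem GraphDatum.dist_lt_of_mem_sheet {m n k : ℕ} {r K : ℝ} (d : GraphDatum m n k r K)
    (hr : 0 < r) (hk : 1 ≤ k) {x y : Euc n} (hy : y ∈ d.sheet x) : dist y x < 3 / 2 * r := by
  obtain ⟨u, hu, rfl⟩ := hy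
  have h1 := d.norm_map_le hr hk hu
  rw [mem_ball_zero_iff] at hu
  rw [dist_eq_norm, add_sub_cancel_left]
  linarith

/-- If an embedding `ι` is close to a map `f` whose double point has separate sheets, then small
sheets of the image of `ι` through the two preimages of the double point cannot be joined by a third
one. -/
theorem disjoint_sheet_of_isSheets {m n k k' : ℕ} {N : Type*} [TopologicalSpace N]
    [ChartedSpace (Euc m) N] [CompactSpace N] {ι f : N → Euc n} (hι : Continuous ι)
    (hinj : Function.Injective ι) {δ ε₀ r K : ℝ} (hr : 0 < r) (hk : 1 ≤ k)
    (hε₀ : 3 * r + 2 * δ ≤ ε₀) (hf : ∀ p, dist (f p) (ι p) < δ) {x' : Euc n} {p₁ p₂ : N}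
    (hne : p₁ ≠ p₂) (hp₁ : f p₁ = x') (hp₂ : f p₂ = x') {l : ℕ} {W : Fin l → Set N}
    (hW : IsSheets m k' f x' ε₀ W) {d₁ d₂ d : GraphDatum m n k r K} {x : Euc n}
    (h₁ : d₁.sheet (ι p₁) ⊆ Set.range ι) (h₂ : d₂.sheet (ι p₂) ⊆ Set.range ι)
    (h : d.sheet x ⊆ Set.range ι) (hx : x ∈ d₁.sheet (ι p₁)) :
    Disjoint (d₂.sheet (ι p₂)) (d.sheet x) := by
  refine Set.disjoint_left.2 fun y hy₂ hy => hne ?_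
  set A := d₁.sheet (ι p₁) ∪ d.sheet x ∪ d₂.sheet (ι p₂) with hA
  have hApre : IsPreconnected A :=
    ((d₁.isPreconnected_sheet _).union x hx (d.self_mem_sheet hr x)
      (d.isPreconnected_sheet x)).union y (Or.inr hy) hy₂ (d₂.isPreconnected_sheet _)
  have hAr : A ⊆ Set.range ι := Set.union_subset (Set.union_subset h₁ h) h₂
  have hpre : IsPreconnected (ι ⁻¹' A) := hApre.preimage_of_isClosedMap hinj hι.isClosedMap hAr
  have hδ₁ : dist (ι p₁) x' < δ := by rw [← hp₁, dist_comm]; exact hf p₁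
  have hδ₂ : dist (ι p₂) x' < δ := by rw [← hp₂, dist_comm]; exact hf p₂
  -- Each sheet has radius at most 3r/2. The worst path goes from f q to ι q, to x, to ι p₁, to x',
  -- with total length below δ + 3r/2 + 3r/2 + δ.
  have hsub : ι ⁻¹' A ⊆ ⋃ i, W i := by
    intro q hq
    rw [hW.iUnion_eq, Set.mem_preimage, mem_ball]
    have hq' := hf q
    have hxd := d₁.dist_lt_of_mem_sheet hr hk hx
    have t1 := dist_triangle (f q) (ι q) x'
    rcases hq with (hq | hq) | hq
    · have := d₁.dist_lt_of_mem_sheet hr hk hq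
      have := dist_triangle (ι q) (ι p₁) x'
      linarith
    · have := d.dist_lt_of_mem_sheet hr hk hq
      have := dist_triangle4 (ι q) x (ι p₁) x'
      linarith
    · have := d₂.dist_lt_of_mem_sheet hr hk hq
      have := dist_triangle (ι q) (ι p₂) x'
      linarith
  have hp₁A : p₁ ∈ ι ⁻¹' A := Or.inl (Or.inl (d₁.self_mem_sheet hr _))
  have hp₂A : p₂ ∈ ι ⁻¹' A := Or.inr (d₂.self_mem_sheet hr _)
  obtain ⟨i, hi⟩ := Set.mem_iUnion.1 (hsub hp₁A)
  have hsub' : ι ⁻¹' A ⊆ W i ∪ ⋃ j ∈ {j | j ≠ i}, W j := by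
    intro q hq
    obtain ⟨j, hj⟩ := Set.mem_iUnion.1 (hsub hq)
    by_cases hji : j = i
    · exact Or.inl (hji ▸ hj)
    · exact Or.inr (Set.mem_biUnion (show j ∈ {j | j ≠ i} from hji) hj)
  have hWi : ι ⁻¹' A ⊆ W i := by
    refine hpre.subset_left_of_subset_union (hW.isOpen i)
      (isOpen_biUnion fun j _ => hW.isOpen j) ?_ hsub' ⟨p₁, hp₁A, hi⟩
    exact Set.disjoint_iUnion₂_right.2 fun j hj => hW.disjoint (Ne.symm hj)
  have := (hW.embedding i).injective (a₁ := ⟨p₁, hi⟩) (a₂ := ⟨p₂, hWi hp₂A⟩)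
    (hp₁.trans hp₂.symm)
  exact congrArg Subtype.val this


/-! ### The interaction of two close sheets -/

section Interaction

variable {m n k : ℕ} {r K : ℝ}

theorem GraphDatum.injOn_add_map (d : GraphDatum m n k r K) (x : Euc n) :
    Set.InjOn (fun u => x + d.map u) (ball 0 r) := fun u hu v hv h => by
  have := d.norm_sub_le_norm_map_sub hu hv
  rw [add_left_cancel h, sub_self, norm_zero] at this
  exact sub_eq_zero.1 (norm_le_zero_iff.1 this)

theorem GraphDatum.measurableSet_image (d : GraphDatum m n k r K) (x : Euc n) {A : Set (Euc m)}
    (hA : MeasurableSet A) (hAr : A ⊆ ball 0 r) :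
    MeasurableSet ((fun u => x + d.map u) '' A) :=
  hA.image_of_continuousOn_injOn
    ((continuousOn_const.add d.contDiffOn_map.continuousOn).mono hAr) ((d.injOn_add_map x).mono hAr)

/-- The projection of the graph to its parameter domain is 1-Lipschitz. -/
theorem GraphDatum.volume_le_image (d : GraphDatum m n k r K) (x : Euc n) {A : Set (Euc m)}
    (hAr : A ⊆ ball 0 r)
    (hfin : (μHE[m] : Measure (Euc n)) ((fun u => x + d.map u) '' A) ≠ ⊤) :
    (volume : Measure (Euc m)).real A
      ≤ (μHE[m] : Measure (Euc n)).real ((fun u => x + d.map u) '' A) := by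
  have h := euclideanHausdorffMeasure_image_le_of_edist_le (f := id)
    (g := fun u => x + d.map u) (A := A) (K := 1) m fun u hu v hv => by
      rw [ENNReal.coe_one, one_mul, edist_dist, edist_dist, id, id]
      refine ENNReal.ofReal_le_ofReal ?_
      rw [dist_eq_norm, dist_eq_norm, add_sub_add_left_eq_sub]
      exact d.norm_sub_le_norm_map_sub (hAr hu) (hAr hv)
  rw [Set.image_id, ENNReal.coe_one, one_pow, one_mul,
    EuclideanSpace.euclideanHausdorffMeasure_eq_volume] at h
  exact ENNReal.toReal_mono hfin h

theorem volume_real_ball_zero {σ : ℝ} (hσ : 0 < σ) :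
    (volume : Measure (Euc m)).real (ball 0 σ)
      = σ ^ m * (volume : Measure (Euc m)).real (ball 0 1) := by
  rw [measureReal_def, Measure.addHaar_ball_of_pos _ _ hσ, ENNReal.toReal_mul,
    ENNReal.toReal_ofReal (by positivity), finrank_euclideanSpace_fin, ← measureReal_def]

theorem half_volume_ball_le_shell (hm : 1 ≤ m) {σ : ℝ} (hσ : 0 < σ) :
    σ ^ m * (volume : Measure (Euc m)).real (ball 0 1) / 2
      ≤ (volume : Measure (Euc m)).real (ball 0 σ \ ball 0 (σ / 2)) := by
  rw [measureReal_sdiff (ball_subset_ball (by linarith)) measurableSet_ball,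
    volume_real_ball_zero hσ, volume_real_ball_zero (half_pos hσ)]
  have h1 : (σ / 2) ^ m ≤ σ ^ m / 2 := by
    rw [div_pow]
    exact div_le_div_of_nonneg_left (by positivity) two_pos (le_self_pow₀ one_le_two (by omega))
  have h2 : 0 ≤ (volume : Measure (Euc m)).real (ball 0 1) := measureReal_nonneg
  nlinarith

/-- Two sheets whose origins are closer than `2 * (r / 2 ^ J)` have a large interaction, of size at
least a multiple of `J`. -/
theorem le_setIntegral_of_close_sheets (hm : 1 ≤ m) (hk : 1 ≤ k) {α : ℝ}
    (hα : α ≤ -2 * (m : ℝ)) (hr : 0 < r) (hr1 : r ≤ 1) {M : Set (Euc n)} (hM : MeasurableSet M)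
    (hfin : (μHE[m] : Measure (Euc n)) M ≠ ⊤) {g : Euc n → ℝ}
    (hg : IntegrableOn g M (μHE[m] : Measure (Euc n))) (hg0 : ∀ x ∈ M, 0 ≤ g x)
    (d₁ d₂ : GraphDatum m n k r K) {x₁ x₂ : Euc n} (h₁ : d₁.sheet x₁ ⊆ M) (h₂ : d₂.sheet x₂ ⊆ M)
    (hdisj : Disjoint (d₁.sheet x₁) (d₂.sheet x₂)) {J : ℕ} (hx : dist x₁ x₂ ≤ 2 * (r / 2 ^ J))
    (hgS : ∀ x ∈ d₁.sheet x₁, ∀ S ⊆ d₂.sheet x₂, MeasurableSet S →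
      IntegrableOn (fun y => dist x y ^ α) S (μHE[m] : Measure (Euc n)) ∧
        ∫ y in S, dist x y ^ α ∂(μHE[m] : Measure (Euc n)) ≤ g x) :
    J * ((volume : Measure (Euc m)).real (ball 0 1) ^ 2 * 5 ^ α / 2)
      ≤ ∫ x in M, g x ∂(μHE[m] : Measure (Euc n)) := by
  set μ : Measure (Euc n) := μHE[m] with hμ
  set v := (volume : Measure (Euc m)).real (ball 0 1) with hv
  have hv0 : 0 ≤ v := measureReal_nonneg
  have hα0 : α ≤ 0 := by
    have : (0 : ℝ) ≤ m := Nat.cast_nonneg m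
    linarith
  set σ : ℕ → ℝ := fun j => r / 2 ^ j with hσ
  have hσ0 : ∀ j, 0 < σ j := fun j => by positivity
  have hσanti : Antitone σ := fun i j hij => by
    simp only [hσ]
    gcongr
    exact one_le_two
  have hσr : ∀ j, σ j ≤ r := fun j => by simpa [hσ] using hσanti (Nat.zero_le j)
  have hσsucc : ∀ j, σ (j + 1) = σ j / 2 := fun j => by
    simp only [hσ, pow_succ]
    field_simp
  -- Disjoint shells on the first sheet let the scales be summed without double counting. On the
  -- second sheet full balls suffice, because for each x only one scale is used.
  set A : ℕ → Set (Euc m) := fun j => ball 0 (σ j) \ ball 0 (σ j / 2) with hA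
  have hAr : ∀ j, A j ⊆ ball 0 r := fun j u hu => ball_subset_ball (hσr j) hu.1
  have hBr : ∀ j, ball (0 : Euc m) (σ j) ⊆ ball 0 r := fun j => ball_subset_ball (hσr j)
  set S : ℕ → Set (Euc n) := fun j => (fun u => x₁ + d₁.map u) '' A j with hS
  set T : ℕ → Set (Euc n) := fun j => (fun u => x₂ + d₂.map u) '' ball 0 (σ j) with hT
  have hSm : ∀ j, MeasurableSet (S j) := fun j =>
    d₁.measurableSet_image x₁ (measurableSet_ball.diff measurableSet_ball) (hAr j)
  have hTm : ∀ j, MeasurableSet (T j) := fun j =>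
    d₂.measurableSet_image x₂ measurableSet_ball (hBr j)
  have hSM : ∀ j, S j ⊆ M := fun j => (Set.image_mono (hAr j)).trans h₁
  have hTS : ∀ j, T j ⊆ d₂.sheet x₂ := fun j => Set.image_mono (hBr j)
  have hSfin : ∀ j, μ (S j) ≠ ⊤ := fun j => ne_top_of_le_ne_top hfin (measure_mono (hSM j))
  have hTfin : ∀ j, μ (T j) ≠ ⊤ := fun j =>
    ne_top_of_le_ne_top hfin (measure_mono ((hTS j).trans h₂))
  have hAdisj : Pairwise fun i j => Disjoint (A i) (A j) := by
    have hlt : ∀ i j, i < j → Disjoint (A i) (A j) := fun i j hij => by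
      refine Set.disjoint_left.2 fun u hu hu' => hu.2 (ball_subset_ball ?_ hu'.1)
      rw [← hσsucc]
      exact hσanti hij
    exact fun i j hij => hij.lt_or_gt.elim (hlt i j) fun h => (hlt j i h).symm
  have hSdisj : Pairwise fun i j => Disjoint (S i) (S j) := fun i j hij =>
    Set.disjoint_image_image fun u hu w hw huw => by
      have := d₁.injOn_add_map x₁ (hAr i hu) (hAr j hw) huw
      exact Set.disjoint_left.1 (hAdisj hij) hu (this ▸ hw)
  have hterm : ∀ j ∈ Finset.range J, v ^ 2 * 5 ^ α / 2 ≤ ∫ x in S j, g x ∂μ := by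
    intro j hj
    have hJ : r / 2 ^ J ≤ σ j := hσanti (Finset.mem_range.1 hj).le
    -- The factor 5 is 3/2 + 2 + 3/2: the two sheet points are within 3σ/2 of their origins, and the
    -- origins are within 2σ of each other because j < J.
    have hlow : ∀ x ∈ S j, (5 * σ j) ^ α * (σ j ^ m * v) ≤ g x := by
      rintro _ ⟨u, hu, rfl⟩
      have hT' : σ j ^ m * v ≤ μ.real (T j) := by
        rw [← volume_real_ball_zero (hσ0 j)]
        exact d₂.volume_le_image x₂ (hBr j) (hTfin j)
      obtain ⟨hintg, hle⟩ := hgS (x₁ + d₁.map u) ⟨u, hAr j hu, rfl⟩ (T j) (hTS j) (hTm j)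
      refine le_trans ?_ ((setIntegral_ge_of_const_le_real (c := (5 * σ j) ^ α) (hTm j) (hTfin j) ?_
        hintg).trans hle)
      · have := hσ0 j
        gcongr
      · rintro _ ⟨w, hw, rfl⟩
        -- Disjointness of the sheets excludes distance 0, where the real power takes a default
        -- value.
        refine Real.rpow_le_rpow_of_nonpos (dist_pos.2 fun h => ?_) ?_ hα0
        · exact Set.disjoint_left.1 hdisj ⟨u, hAr j hu, rfl⟩ ⟨w, hBr j hw, h.symm⟩
        · have e1 := d₁.norm_map_le hr hk (hAr j hu)
          have e2 := d₂.norm_map_le hr hk (hBr j hw)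
          have e3 := mem_ball_zero_iff.1 hu.1
          have e4 := mem_ball_zero_iff.1 hw
          have e5 := dist_triangle4 (x₁ + d₁.map u) x₁ x₂ (x₂ + d₂.map w)
          rw [dist_self_add_left, dist_self_add_right] at e5
          exact e5.trans (by linarith)
    have h1 := setIntegral_ge_of_const_le_real (hSm j) (hSfin j) hlow (hg.mono_set (hSM j))
    refine le_trans ?_ h1
    have h2 : σ j ^ m * v / 2 ≤ μ.real (S j) :=
      (half_volume_ball_le_shell hm (hσ0 j)).trans (d₁.volume_le_image x₁ (hAr j) (hSfin j))
    -- This is where α ≤ -2m enters: σ ≤ 1 and the exponent α + 2m is at most 0, so no scale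
    -- contributes less than a fixed amount.
    have h3 : 1 ≤ σ j ^ α * (σ j ^ m * σ j ^ m) := by
      rw [← Real.rpow_natCast, ← Real.rpow_add (hσ0 j), ← Real.rpow_add (hσ0 j)]
      exact Real.one_le_rpow_of_pos_of_le_one_of_nonpos (hσ0 j) ((hσr j).trans hr1) (by linarith)
    calc v ^ 2 * 5 ^ α / 2 ≤ v ^ 2 * 5 ^ α / 2 * (σ j ^ α * (σ j ^ m * σ j ^ m)) :=
          le_mul_of_one_le_right (by positivity) h3
      _ = (5 * σ j) ^ α * (σ j ^ m * v) * (σ j ^ m * v / 2) := by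
          rw [Real.mul_rpow (by norm_num) (hσ0 j).le]
          ring
      _ ≤ _ := by
          have := hσ0 j
          gcongr
  calc J * (v ^ 2 * 5 ^ α / 2) = ∑ j ∈ Finset.range J, v ^ 2 * 5 ^ α / 2 := by
        rw [Finset.sum_const, Finset.card_range, nsmul_eq_mul]
    _ ≤ ∑ j ∈ Finset.range J, ∫ x in S j, g x ∂μ := Finset.sum_le_sum hterm
    _ = ∫ x in ⋃ j ∈ Finset.range J, S j, g x ∂μ :=
        (integral_biUnion_finset _ (fun j _ => hSm j) (fun i _ j _ hij => hSdisj hij)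
          fun j _ => hg.mono_set (hSM j)).symm
    _ ≤ _ := setIntegral_mono_set hg ((ae_restrict_mem hM).mono hg0)
        (Set.iUnion₂_subset fun j _ => hSM j).eventuallyLE

end Interaction

end

end RieszRepulsion

/-! ### The main theorem. -/

open RieszRepulsion in
/-- `M = range ι` is the embedded closed submanifold, `f` (read on the parametrizing manifold `N`)
is the immersion `M → M'`, and `M' = range f`. -/
theorem theorem1 (m n : ℕ) (hm : 1 ≤ m) (α : ℝ) (hα : α ≤ -2 * (m : ℝ))
    (ε₀ b V : ℝ) (hε₀ : 0 < ε₀) (hb : 0 < b) (hV : 0 < V) (C : ℝ) (hC : 0 < C) :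
    ∃ δ : ℝ, 0 < δ ∧
      ∀ (N : Type*) [TopologicalSpace N] [ChartedSpace (Euc m) N]
        [IsManifold (𝓡 m) (alphaBar m α + 3 : ℕ) N] [CompactSpace N] [T2Space N]
        (ι f : N → Euc n),
        IsImm (m := m) (alphaBar m α + 3) ι → Function.Injective ι →
        Set.range ι ∈ BoundedGeometry m n (alphaBar m α + 3) ε₀ b V →
        IsImm (m := m) (alphaBar m α + 3) f →
        Set.range f ∈ BoundedGeometry m n (alphaBar m α + 3) ε₀ b V →
        (∀ p : N, dist (f p) (ι p) < δ) →
        ∀ x' : Euc n, (∃ p₁ p₂ : N, p₁ ≠ p₂ ∧ f p₁ = x' ∧ f p₂ = x') →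
        (∃ (l : ℕ) (W : Fin l → Set N), 2 ≤ l ∧ IsSheets m (alphaBar m α + 3) f x' ε₀ W) →
        RieszEnergyDefined m α (Set.range ι) ∧ C < rieszEnergy m α (Set.range ι) := by
  have hm0 : (0 : ℝ) < m := by exact_mod_cast hm
  -- The first two bounds provide graphs over balls of radius r, r ≤ 1 makes every dyadic scale
  -- count, and 5r ≤ ε₀ gives 3r + 2δ ≤ ε₀ because δ ≤ r.
  obtain ⟨r, hr, hr1, hr2, hr3, hr4⟩ : ∃ r : ℝ, 0 < r ∧ r ≤ ε₀ / (1 + m * b) ∧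
      (m : ℝ) ^ 2 * b * r ≤ 1 / 2 ∧ r ≤ 1 ∧ 5 * r ≤ ε₀ := by
    refine ⟨min (min (ε₀ / (1 + m * b)) (1 / 2 / ((m : ℝ) ^ 2 * b))) (min 1 (ε₀ / 5)),
      by positivity, (min_le_left _ _).trans (min_le_left _ _), ?_,
      (min_le_right _ _).trans (min_le_left _ _), ?_⟩
    · rw [mul_comm, ← le_div_iff₀ (by positivity)]
      exact (min_le_left _ _).trans (min_le_right _ _)
    · rw [mul_comm, ← le_div_iff₀ (by positivity)]
      exact (min_le_right _ _).trans (min_le_right _ _)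
  obtain ⟨C₀, K, hC₀⟩ := exists_setIntegral_le_potential_add (n := n) (V := V) hm hα hb hr hr1 hr2
  set c : ℝ := (volume : Measure (Euc m)).real (ball 0 1) ^ 2 * 5 ^ α / 2 with hc
  have hc0 : 0 < c := by
    have : 0 < (volume : Measure (Euc m)).real (ball 0 1) :=
      ENNReal.toReal_pos (measure_ball_pos _ _ one_pos).ne' measure_ball_lt_top.ne
    positivity
  -- Enough scales to exceed C after paying for the uniform constant C₀ over a volume of at most V.
  obtain ⟨J, hJ⟩ := exists_nat_gt ((C + |C₀| * V) / c)
  rw [div_lt_iff₀ hc0] at hJ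
  refine ⟨r / 2 ^ J, by positivity, ?_⟩
  intro N _ _ _ _ _ ι f hι hinj hBG hf _ hδ x' hdouble hsheets
  obtain ⟨p₁, p₂, hne, hp₁, hp₂⟩ := hdouble
  obtain ⟨l, W, -, hW⟩ := hsheets
  obtain ⟨hdef, hpot⟩ := hC₀ N ι hι hinj hBG
  refine ⟨hdef, ?_⟩
  set M := Set.range ι with hM
  have hMm : MeasurableSet M := (isCompact_range hι.1.continuous).isClosed.measurableSet
  have hfin : (μHE[m] : Measure (Euc n)) M ≠ ⊤ := ne_top_of_le_ne_top ENNReal.ofReal_ne_top hBG.1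
  have hMV : (μHE[m] : Measure (Euc n)).real M ≤ V := ENNReal.toReal_le_of_le_ofReal hV.le hBG.1
  obtain ⟨d₁, h₁, -⟩ := hpot (ι p₁) ⟨p₁, rfl⟩
  obtain ⟨d₂, h₂, -⟩ := hpot (ι p₂) ⟨p₂, rfl⟩
  have hδr : r / 2 ^ J ≤ r := div_le_self hr.le (one_le_pow₀ one_le_two)
  have hconst : IntegrableOn (fun _ : Euc n => C₀) M (μHE[m] : Measure (Euc n)) :=
    integrableOn_const hfin
  have hsep : ∀ x ∈ d₁.sheet (ι p₁), ∀ d : GraphDatum m n (alphaBar m α + 3) r K,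
      d.sheet x ⊆ M → Disjoint (d₂.sheet (ι p₂)) (d.sheet x) := fun x hx d hd =>
    disjoint_sheet_of_isSheets hι.1.continuous hinj hr (by omega) (by linarith) hδ hne hp₁ hp₂ hW
      h₁ h₂ hd hx
  have hlow : J * c ≤ ∫ x in M, (potential m α M x + C₀) ∂(μHE[m] : Measure (Euc n)) := by
    refine le_setIntegral_of_close_sheets hm (by omega) hα hr hr3 hMm hfin
      (hdef.integrableOn_potential.add hconst) ?_ d₁ d₂ h₁ h₂ ?_ ?_ ?_
    · intro x hx
      obtain ⟨d, -, hd⟩ := hpot x hx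
      -- The empty set as S yields nonnegativity of the potential plus C₀.
      simpa using (hd ∅ (Set.empty_subset _) MeasurableSet.empty (Set.empty_disjoint _)).2
    · exact (hsep _ (d₁.self_mem_sheet hr _) d₁ h₁).symm
    · have e1 := hδ p₁
      have e2 := hδ p₂
      have := dist_triangle (ι p₁) x' (ι p₂)
      rw [hp₁, dist_comm] at e1
      rw [hp₂] at e2
      linarith
    · intro x hx S hS hSm
      obtain ⟨d, hdM, hd⟩ := hpot x (h₁ hx)
      exact hd S (hS.trans h₂) hSm ((hsep x hx d hdM).mono_left hS)
  rw [integral_add hdef.integrableOn_potential hconst, setIntegral_const, smul_eq_mul] at hlow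
  have h3 : (μHE[m] : Measure (Euc n)).real M * C₀ ≤ |C₀| * V := by
    rw [mul_comm]
    exact mul_le_mul (le_abs_self _) hMV measureReal_nonneg (abs_nonneg _)
  rw [rieszEnergy]
  linarith
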